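/- **Setting.** Let $s\ge 1$, $I=\{1,\dots,s+1\}$, and let $\overline{\mathbb R}=\mathbb R\cup\{\pm\infty\}$ be the two-point compactification of $\mathbb R$ with a metric $d$ that induces its topology and is strongly equivalent to the Euclidean metric on compact subsets of $\mathbb R$ (for each compact $K\subset\mathbb R$ there is $c>0$ with $c^{-1}|x-y|\le d(x,y)\le c|x-y|$ on $K$). Let $f_i:\mathbb R\to\mathbb R$ $(i\in I)$ be $\mathcal C^1$ diffeomorphisms whose derivatives are $\epsilon$-Hölder continuous for some $\epsilon>0$, extended to $\overline{\mathbb R}$ by $f_i(\pm\infty)=\pm\infty$, such that * (expanding) there is $\lambda>1$ with $f_i'(x)\ge\lambda$ for all $i\in I$, $x\in\mathbb R$; * (no common fixed point) there is no $x\in\mathbb R$ with $f_i(x)=x$ for all $i\in I$; * (contracting near infinity) there are neighbourhoods $V^{\pm}$ of $\pm\infty$ on each of which every $f_i$ is Lipschitz with respect to $d$ with constant $<1$. Assume the *open set condition*: there is a non-empty bounded open interval $O\subset\mathbb R$ with $f_i^{-1}(O)\subset O$ for all $i$ and $f_i^{-1}(O)\cap f_j^{-1}(O)=\emptyset$ for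 $i\ne j$. Let $\Sigma=I^{\mathbb N}$ with shift $\sigma$, and $f_{\omega|n}=f_{\omega_n}\circ\dots\circ f_{\omega_1}$. Let $J$ be the Julia set, i.e. the set of $x\in\overline{\mathbb R}$ such that the semigroup generated by the $f_i$ is not equicontinuous (with respect to $d$) in any neighbourhood of $x$; then $J\subset\mathbb R$, and $\dim_H J$ is its Hausdorff dimension in the Euclidean metric. For $\omega\in\Sigma$ let $\pi(\omega)\in\mathbb R$ be the unique point whose orbit $(f_{\omega|n}(\pi(\omega)))_n$ is bounded in $\mathbb R$. Let $\vec p=(p_1,\dots,p_s)\in(0,1)^s$ with $\sum_{i\le s}p_i<1$, put $p_{s+1}=1-\sum_{i\le s}p_i$, let $\mu_{\vec p}$ be the Bernoulli measure on $\Sigma$ with weights $(p_i)_{i\in I}$, and let $$T_{\vec p}(x)=\mu_{\vec p}\{\omega\in\Sigma: \lim_{n\to\infty} f_{\omega|n}(x)=+\infty\},\qquad x\in\overline{\mathbb R}.$$ For $\vec n\in\mathbb N_0^s$ let $C_{\vec n}(x)=\frac{\partial^{n_1+\dots+n_s}}{\partial u_1^{n_1}\cdots\partial u_s^{n_s}}T_{\vec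 u}(x)\big|_{\vec u=\vec p}$, and let $\mathcal T$ be the real vector space spanned by the $C_{\vec n}$. An element $C\in\mathcal T$ is *non-trivial* if $C=\sum_{\vec n}\beta_{\vec n}C_{\vec n}$ for some finitely supported family $(\beta_{\vec n})\ne0$. With $\varphi(\omega)=-\log|f_{\omega_1}'(\pi(\omega))|$, $\psi(\omega)=\log p_{\omega_1}$ and $S_nu=\sum_{k=0}^{n-1}u\circ\sigma^k$, let $$\alpha_-=\inf_{\omega\in\Sigma}\liminf_{n\to\infty}\frac{S_n\psi(\omega)}{S_n\varphi(\omega)},\qquad \alpha_+=\sup_{\omega\in\Sigma}\limsup_{n\to\infty}\frac{S_n\psi(\omega)}{S_n\varphi(\omega)}.$$ Write $h\in\mathcal C^\alpha(\overline{\mathbb R})$ if $|h(x)-h(y)|\le K\,d(x,y)^\alpha$ for some constant $K$ and all $x,y\in\overline{\mathbb R}$ (with $d(x,y)^0:=1$). **Theorem.** For every $x\in\overline{\mathbb R}$ the map $\vec u\mapsto T_{\vec u}(x)$ is $\mathcal C^\infty$ at $\vec p$ (so that the $C_{\vec n}$ are well defined), and: 1. $T_{\vec p}\in\mathcal C^{\alpha_-}(\overline{\mathbb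 R})$. 2. $\mathcal T\subset\mathcal C^{\alpha}(\overline{\mathbb R})$ for every $0<\alpha<\alpha_-$. 3. For every non-trivial $C\in\mathcal T$, $\alpha_-=\sup\{\alpha\ge0: C\in\mathcal C^\alpha(\overline{\mathbb R})\}$. 4. $\alpha_-\le\dim_H J$. 5. $\alpha_-=\alpha_+$ if and only if $T_{\vec p}\in\mathcal C^{\dim_H J}(\overline{\mathbb R})$. -/

import Mathlib

open Filter Topology MeasureTheory
open scoped NNReal ENNReal

noncomputable section

namespace GenTakagi

/-! ### The two-point compactification of the real line -/

/-- `d` is a metric on the two-point compactification `EReal` of the real line: it induces the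
topology of the compactification, and on every compact subset of `ℝ` it is strongly equivalent to
the Euclidean metric. -/
structure IsCompactificationMetric (d : EReal → EReal → ℝ) : Prop where
  self : ∀ x, d x x = 0
  eq_of_dist_eq_zero : ∀ x y, d x y = 0 → x = y
  symm : ∀ x y, d x y = d y x
  triangle : ∀ x y z, d x z ≤ d x y + d y z
  mem_nhds_iff : ∀ (x : EReal) (U : Set EReal), U ∈ 𝓝 x ↔ ∃ ε > 0, {y | d x y < ε} ⊆ U
  strongly_equivalent : ∀ K : Set ℝ, IsCompact K → ∃ C > 0, ∀ x ∈ K, ∀ y ∈ K,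
    C⁻¹ * |x - y| ≤ d x y ∧ d x y ≤ C * |x - y|

/-- `h` is `α`-Hölder continuous with respect to `d`. (For `α = 0` this says that the oscillation
of `h` is bounded.) -/
def IsHolder (d : EReal → EReal → ℝ) (α : ℝ) (h : EReal → ℝ) : Prop :=
  ∃ C : ℝ, ∀ x y, |h x - h y| ≤ C * d x y ^ α

/-- The extension of `g : ℝ → ℝ` to the compactification with `g (±∞) = ±∞`. -/
def extend (g : ℝ → ℝ) : EReal → EReal :=
  fun x => EReal.rec (motive := fun _ => EReal) ⊥ (fun y : ℝ => ((g y : ℝ) : EReal)) ⊤ x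

/-! ### The random dynamical system

The index set `I = {1, …, s+1}` is `Fin (s + 1)`, and `Σ = I^ℕ` is `ℕ → Fin (s + 1)`. -/

/-- `iter F ω n = F_{ω_n} ∘ ⋯ ∘ F_{ω_1}`, the composition along the first `n` letters of `ω`. -/
def iter {ι X : Type*} (F : ι → X → X) (ω : ℕ → ι) : ℕ → X → X
  | 0 => id
  | n + 1 => F (ω n) ∘ iter F ω n

/-- The standing assumptions on the family `(f_i)`. Since `f_i' ≥ λ > 1`, each `f_i` is
automatically a `C^1` diffeomorphism of `ℝ`. -/
structure IsAdmissible {s : ℕ} (d : EReal → EReal → ℝ) (f : Fin (s + 1) → ℝ → ℝ) : Prop where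
  contDiff : ∀ i, ContDiff ℝ 1 (f i)
  holder_deriv : ∃ ε : ℝ≥0, 0 < ε ∧ ∀ i, ∃ C : ℝ≥0, HolderWith C ε (deriv (f i))
  expanding : ∃ lam : ℝ, 1 < lam ∧ ∀ i x, lam ≤ deriv (f i) x
  no_common_fixed_point : ¬ ∃ x : ℝ, ∀ i, f i x = x
  contracting_near_infinity : ∃ Vp ∈ 𝓝 (⊤ : EReal), ∃ Vm ∈ 𝓝 (⊥ : EReal), ∃ c < (1 : ℝ), ∀ i,
    (∀ x ∈ Vp, ∀ y ∈ Vp, d (extend (f i) x) (extend (f i) y) ≤ c * d x y) ∧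
    (∀ x ∈ Vm, ∀ y ∈ Vm, d (extend (f i) x) (extend (f i) y) ≤ c * d x y)

/-- The open set condition, with the bounded open interval `O = (a, b)`. -/
def OpenSetCondition {s : ℕ} (f : Fin (s + 1) → ℝ → ℝ) : Prop :=
  ∃ a b : ℝ, a < b ∧ (∀ i, f i ⁻¹' Set.Ioo a b ⊆ Set.Ioo a b) ∧
    ∀ i j, i ≠ j → Disjoint (f i ⁻¹' Set.Ioo a b) (f j ⁻¹' Set.Ioo a b)

/-- The semigroup generated by the extended maps: all compositions along non-empty words. -/
def semigroup {s : ℕ} (f : Fin (s + 1) → ℝ → ℝ) : Set (EReal → EReal) :=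
  {g | ∃ (ω : ℕ → Fin (s + 1)) (n : ℕ), 1 ≤ n ∧ g = iter (fun i => extend (f i)) ω n}

/-- The family of maps `G` is equicontinuous on `U` with respect to `d`. -/
def EquicontOn (d : EReal → EReal → ℝ) (G : Set (EReal → EReal)) (U : Set EReal) : Prop :=
  ∀ x ∈ U, ∀ ε > 0, ∃ δ > 0, ∀ g ∈ G, ∀ y ∈ U, d x y < δ → d (g x) (g y) < ε

/-- The Julia set: the points without a neighbourhood on which the semigroup is
equicontinuous. -/
def juliaSet {s : ℕ} (d : EReal → EReal → ℝ) (f : Fin (s + 1) → ℝ → ℝ) : Set EReal :=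
  {x | ∀ U ∈ 𝓝 x, ¬ EquicontOn d (semigroup f) U}

/-- The Hausdorff dimension of the Julia set (a subset of `ℝ`) in the Euclidean metric. -/
def dimJulia {s : ℕ} (d : EReal → EReal → ℝ) (f : Fin (s + 1) → ℝ → ℝ) : ℝ≥0∞ :=
  dimH {x : ℝ | (x : EReal) ∈ juliaSet d f}

/-! ### The probability of tending to infinity and its parameter derivatives -/

/-- The parameters `(p_1, …, p_s) ∈ (0,1)^s` with `∑ p_i < 1`. -/
def simplex (s : ℕ) : Set (Fin s → ℝ) :=
  {p | (∀ i, p i ∈ Set.Ioo (0 : ℝ) 1) ∧ ∑ i, p i < 1}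

/-- The weights `(p_1, …, p_s, p_{s+1})` with `p_{s+1} = 1 - ∑ p_i`. -/
def weight {s : ℕ} (p : Fin s → ℝ) : Fin (s + 1) → ℝ :=
  Fin.snoc (α := fun _ => ℝ) p (1 - ∑ i, p i)

/-- The Bernoulli measure on `Σ` with weights `(p_1, …, p_{s+1})`. -/
def bernoulli {s : ℕ} (p : Fin s → ℝ) : Measure (ℕ → Fin (s + 1)) :=
  Measure.infinitePi fun _ : ℕ => ∑ i, ENNReal.ofReal (weight p i) • Measure.dirac i

/-- `T_p(x)`, the probability that the random orbit of `x` tends to `+∞`. -/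
def probInfty {s : ℕ} (f : Fin (s + 1) → ℝ → ℝ) (p : Fin s → ℝ) (x : EReal) : ℝ :=
  (bernoulli p).real
    {ω | Tendsto (fun n => iter (fun i => extend (f i)) ω n x) atTop (𝓝 ⊤)}

/-- The partial derivative with respect to the `i`-th parameter. -/
def partialDeriv {s : ℕ} (i : Fin s) (F : (Fin s → ℝ) → ℝ) : (Fin s → ℝ) → ℝ :=
  fun u => lineDeriv ℝ F u (Pi.single i 1)

/-- The mixed partial derivative `∂_1^{n_1} ∂_2^{n_2} ⋯ ∂_s^{n_s} F`. -/
def mixedPartial {s : ℕ} (n : Fin s → ℕ) (F : (Fin s → ℝ) → ℝ) : (Fin s → ℝ) → ℝ :=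
  (List.finRange s).foldr (fun i H => (partialDeriv i)^[n i] H) F

/-- The function `C_n(x) = ∂^{|n|} T_u(x) / ∂u_1^{n_1} ⋯ ∂u_s^{n_s}` at `u = p`. -/
def takagi {s : ℕ} (f : Fin (s + 1) → ℝ → ℝ) (p : Fin s → ℝ) (n : Fin s → ℕ) : EReal → ℝ :=
  fun x => mixedPartial n (fun u => probInfty f u x) p

/-- The vector space `𝒯` of generalised Takagi functions. -/
def takagiSpace {s : ℕ} (f : Fin (s + 1) → ℝ → ℝ) (p : Fin s → ℝ) : Submodule ℝ (EReal → ℝ) :=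
  Submodule.span ℝ (Set.range (takagi f p))

/-- `C ∈ 𝒯` is non-trivial: `C = ∑ β_n C_n` for a finitely supported family `β ≠ 0`. -/
def IsNontrivial {s : ℕ} (f : Fin (s + 1) → ℝ → ℝ) (p : Fin s → ℝ) (C : EReal → ℝ) : Prop :=
  ∃ β : (Fin s → ℕ) →₀ ℝ, β ≠ 0 ∧ C = ∑ n ∈ β.support, β n • takagi f p n

/-! ### The exponents `α₋` and `α₊` -/

/-- `J_ω`: the points of `ℝ` whose orbit along `ω` never enters a suitable neighbourhood of
`{-∞, +∞}` (all of whose points escape to `±∞`), that is, whose orbit stays bounded. -/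
def fiberJulia {s : ℕ} (f : Fin (s + 1) → ℝ → ℝ) (ω : ℕ → Fin (s + 1)) : Set ℝ :=
  {x | ∃ R : ℝ, ∀ n, |iter f ω n x| ≤ R}

/-- The coding map `π : Σ → ℝ`: for an expanding family, `π ω` is the unique point of `J_ω`. -/
def codingMap {s : ℕ} (f : Fin (s + 1) → ℝ → ℝ) (ω : ℕ → Fin (s + 1)) : ℝ :=
  Classical.epsilon fun x => x ∈ fiberJulia f ω

/-- The shift map on `Σ`. -/
def shift {ι : Type*} (ω : ℕ → ι) : ℕ → ι := fun n => ω (n + 1)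

/-- The geometric potential `φ(ω) = -log |f_{ω_1}'(π ω)|`. -/
def potPhi {s : ℕ} (f : Fin (s + 1) → ℝ → ℝ) (ω : ℕ → Fin (s + 1)) : ℝ :=
  -Real.log |deriv (f (ω 0)) (codingMap f ω)|

/-- The potential `ψ(ω) = log p_{ω_1}`. -/
def potPsi {s : ℕ} (p : Fin s → ℝ) (ω : ℕ → Fin (s + 1)) : ℝ :=
  Real.log (weight p (ω 0))

/-- The quotient `S_n ψ(ω) / S_n φ(ω)` of ergodic sums. Under the standing assumptions these
quotients lie, for `n ≥ 1`, in a compact subinterval of `(0, ∞)` not depending on `ω` and `n`. -/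
def ratio {s : ℕ} (f : Fin (s + 1) → ℝ → ℝ) (p : Fin s → ℝ) (ω : ℕ → Fin (s + 1)) (n : ℕ) : ℝ :=
  birkhoffSum shift (potPsi p) n ω / birkhoffSum shift (potPhi f) n ω

/-- The bottom of the spectrum `α₋`. -/
def alphaMinus {s : ℕ} (f : Fin (s + 1) → ℝ → ℝ) (p : Fin s → ℝ) : ℝ :=
  ⨅ ω, liminf (ratio f p ω) atTop

/-- The top of the spectrum `α₊`. -/
def alphaPlus {s : ℕ} (f : Fin (s + 1) → ℝ → ℝ) (p : Fin s → ℝ) : ℝ :=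
  ⨆ ω, limsup (ratio f p ω) atTop

end GenTakagi

end

noncomputable section

namespace GenTakagi

section

variable {ι : Type*}

/-! ### Expanding families of homeomorphisms of the line -/

/-! Write I_w for the image of [a, b] under the inverse branch of a word w, |I_w| for its length and
P(w) for the product of the weights of its letters. Every statement reduces to comparing P(w) with
powers of |I_w|.

Exponents. Bounded distortion (`exists_distortion`) equates log |I_w| with a Birkhoff sum of φ up to
a constant, while log P(w) is the Birkhoff sum of ψ. Continuing w periodically shows that α₋ and α₊
bound the quotient of these sums at the finite time n = |w|, not only in the limit. Hence P(w) ≤ K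
|I_w|^α₋ and |I_w|^α₊ ≤ K P(w) for all words, with no loss in the exponent (`exists_weight_le`,
`exists_le_weight`). Conversely, a bound of either kind with an exponent α gives α ≤ α₋ or α₊ ≤ α
(`le_alphaMinus`, `alphaPlus_le`).

Hölder continuity. T_u is 0 left of a, 1 right of b, and equals the weighted sum of the T_u ∘ f_i.
By the open set condition at most one f_i x lies in (a, b), so increments are multiplied by weights
essentially along one branch. `Subinvariant.holder_bound` turns this into an α-Hölder estimate
whenever the word weights are at most K |I_w|^α. Applied to |T x - T y| it gives part 1. Applied to
a norm of the m-jet at p of u ↦ T_u x - T_u y it gives part 2: the jet norm is submultiplicative,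
and at a small scale ρ the jet of the i-th weight has norm at most r p_i with r as close to 1 as
desired; the factor r per letter costs an arbitrarily small part of the exponent. Smoothness in u
holds because T_u solves a linear equation (1 - M_u) h = e_u in the bounded functions, with M_p of
norm < 1.

Optimality. The increment of T_u over I_w is P_u(w), a polynomial in u, so a non-trivial C sees a
combination of Taylor coefficients of P_u(w) at p. Multiplying by a product of powers of u_i - p_i,
with a maximal multi-index from the combination, isolates P(w). Multiplying by u_j amounts to
appending the letter j, which only shrinks the cylinder. So a Hölder bound for C passes to P(w)
(`exists_weight_le_of_isHolder`).

Dimension. The Julia set is the limit set, and T maps it onto a set containing (0, 1); since T is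
α₋-Hölder, the dimension is at least α₋. If α₋ = α₊, covering by cylinders gives equality.
Conversely, if T is Hölder with exponent the dimension δ, then δ = α₋. Were P(w) not comparable to
|I_w|^δ, doubling the weight of one bad word would produce a mass distribution of exponent larger
than δ (`exists_le_weight_of_dimH_le`); comparability then forces α₊ ≤ α₋. -/

/-- The maps `f i` are expanding homeomorphisms of `ℝ` with inverses `g i`, and the interval
`(a, b)` satisfies the open set condition for the contractions `g i`. -/
structure ExpandingFamily (f g : ι → ℝ → ℝ) (a b lam : ℝ) : Prop where
  lt : a < b
  one_lt : 1 < lam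
  continuous : ∀ i, Continuous (f i)
  expand : ∀ i x y, x ≤ y → lam * (y - x) ≤ f i y - f i x
  right_inv : ∀ i z, f i (g i z) = z
  left_le : ∀ i, f i a ≤ a
  le_right : ∀ i, b ≤ f i b
  disj : ∀ i j, i ≠ j → ∀ x, f i x ∈ Set.Ioo a b → f j x ∉ Set.Ioo a b

/-- The inverse branch `g_{w_1} ∘ ⋯ ∘ g_{w_n}` along the word `w`. -/
def wordInv (g : ι → ℝ → ℝ) : List ι → ℝ → ℝ
  | [] => id
  | i :: w => g i ∘ wordInv g w

/-- The composition `f_{w_n} ∘ ⋯ ∘ f_{w_1}` along the word `w`. -/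
def wordMap (f : ι → ℝ → ℝ) : List ι → ℝ → ℝ
  | [] => id
  | i :: w => wordMap f w ∘ f i

/-- The length of the cylinder interval of the word `w`. -/
def cylLen (g : ι → ℝ → ℝ) (a b : ℝ) (w : List ι) : ℝ := wordInv g w b - wordInv g w a

lemma wordInv_append (g : ι → ℝ → ℝ) (u v : List ι) (z : ℝ) :
    wordInv g (u ++ v) z = wordInv g u (wordInv g v z) := by
  induction u with
  | nil => rfl
  | cons i u ih => simp [wordInv, ih]

lemma wordMap_append (f : ι → ℝ → ℝ) (u v : List ι) (z : ℝ) :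
    wordMap f (u ++ v) z = wordMap f v (wordMap f u z) := by
  induction u generalizing z with
  | nil => rfl
  | cons i u ih => simp [wordMap, ih]

namespace ExpandingFamily

variable {f g : ι → ℝ → ℝ} {a b lam : ℝ} (h : ExpandingFamily f g a b lam)
include h

lemma strictMono (i : ι) : StrictMono (f i) := fun x y hxy => by
  nlinarith [h.expand i x y hxy.le, h.one_lt]

lemma left_inv (i : ι) (x : ℝ) : g i (f i x) = x :=
  (h.strictMono i).injective (h.right_inv i _)

lemma strictMono_inv (i : ι) : StrictMono (g i) := fun x y hxy => by
  rwa [← (h.strictMono i).lt_iff_lt, h.right_inv, h.right_inv]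

lemma le_iff (i : ι) (x z : ℝ) : f i x ≤ z ↔ x ≤ g i z := by
  conv_lhs => rw [← h.right_inv i z]
  exact (h.strictMono i).le_iff_le

lemma ge_iff (i : ι) (x z : ℝ) : z ≤ f i x ↔ g i z ≤ x := by
  conv_lhs => rw [← h.right_inv i z]
  exact (h.strictMono i).le_iff_le

lemma left_le_inv (i : ι) : a ≤ g i a := (h.le_iff i a a).1 (h.left_le i)

lemma inv_le_right (i : ι) : g i b ≤ b := (h.ge_iff i b b).1 (h.le_right i)

/-- Disjoint non-empty open intervals of the line are ordered. Adjacent cylinders may share an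
endpoint, hence the weak inequalities. -/
lemma sep {i j : ι} (hij : i ≠ j) : g i b ≤ g j a ∨ g j b ≤ g i a := by
  have hd : Disjoint (Set.Ioo (g i a) (g i b)) (Set.Ioo (g j a) (g j b)) := by
    rw [Set.disjoint_left]
    intro x hx hx'
    refine h.disj i j hij x ?_ ?_
    · exact ⟨not_le.1 fun hc => not_le.2 hx.1 ((h.le_iff i x a).1 hc),
        not_le.1 fun hc => not_le.2 hx.2 ((h.ge_iff i x b).1 hc)⟩
    · exact ⟨not_le.1 fun hc => not_le.2 hx'.1 ((h.le_iff j x a).1 hc),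
        not_le.1 fun hc => not_le.2 hx'.2 ((h.ge_iff j x b).1 hc)⟩
  rw [Set.Ioo_disjoint_Ioo] at hd
  have h1 := h.strictMono_inv i h.lt
  have h2 := h.strictMono_inv j h.lt
  rcases min_le_iff.1 hd with hd | hd <;> rcases le_max_iff.1 hd with hd | hd
  · linarith
  · exact Or.inl hd
  · exact Or.inr hd
  · linarith

lemma strictMono_wordInv (w : List ι) : StrictMono (wordInv g w) := by
  induction w with
  | nil => exact strictMono_id
  | cons i w ih => exact (h.strictMono_inv i).comp ih

lemma wordMap_wordInv (w : List ι) (z : ℝ) : wordMap f w (wordInv g w z) = z := by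
  induction w with
  | nil => rfl
  | cons i w ih => simpa [wordMap, wordInv, h.right_inv] using ih

lemma wordInv_wordMap (w : List ι) (z : ℝ) : wordInv g w (wordMap f w z) = z := by
  induction w generalizing z with
  | nil => rfl
  | cons i w ih => simp [wordMap, wordInv, ih, h.left_inv]

lemma continuous_wordMap (w : List ι) : Continuous (wordMap f w) := by
  induction w with
  | nil => exact continuous_id
  | cons i w ih => exact ih.comp (h.continuous i)

lemma strictMono_wordMap (w : List ι) : StrictMono (wordMap f w) := fun x y hxy => by
  rwa [← (h.strictMono_wordInv w).lt_iff_lt, h.wordInv_wordMap, h.wordInv_wordMap]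

lemma wordMap_expand (w : List ι) {x y : ℝ} (hxy : x ≤ y) :
    lam ^ w.length * (y - x) ≤ wordMap f w y - wordMap f w x := by
  induction w generalizing x y with
  | nil => simp [wordMap]
  | cons i w ih =>
    have h1 := ih ((h.strictMono i).monotone hxy)
    have h2 := h.expand i x y hxy
    have h3 : 0 ≤ lam ^ w.length := pow_nonneg (by linarith [h.one_lt]) _
    calc lam ^ (i :: w).length * (y - x) = lam ^ w.length * (lam * (y - x)) := by
          simp [pow_succ]; ring
      _ ≤ lam ^ w.length * (f i y - f i x) := by gcongr
      _ ≤ _ := h1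

lemma wordInv_mem (w : List ι) {z : ℝ} (hz : z ∈ Set.Icc a b) :
    wordInv g w z ∈ Set.Icc a b := by
  induction w with
  | nil => exact hz
  | cons i w ih =>
    exact ⟨(h.left_le_inv i).trans ((h.strictMono_inv i).monotone ih.1),
      ((h.strictMono_inv i).monotone ih.2).trans (h.inv_le_right i)⟩

lemma left_mem : a ∈ Set.Icc a b := ⟨le_rfl, h.lt.le⟩

lemma right_mem : b ∈ Set.Icc a b := ⟨h.lt.le, le_rfl⟩

lemma cylLen_pos (w : List ι) : 0 < cylLen g a b w :=
  sub_pos.2 (h.strictMono_wordInv w h.lt)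

lemma cylLen_le (w : List ι) : cylLen g a b w ≤ (b - a) / lam ^ w.length := by
  have := h.wordMap_expand w (h.strictMono_wordInv w h.lt).le
  rw [h.wordMap_wordInv, h.wordMap_wordInv] at this
  rw [le_div_iff₀ (pow_pos (by linarith [h.one_lt]) _), mul_comm]
  exact this

lemma cylLen_append_le (u v : List ι) : cylLen g a b (u ++ v) ≤ cylLen g a b u := by
  have hm := (h.strictMono_wordInv u).monotone
  have h1 := hm (h.wordInv_mem v h.right_mem).2
  have h2 := hm (h.wordInv_mem v h.left_mem).1
  simp only [cylLen, wordInv_append]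
  linarith

/-- Reflection exchanges the two ends of [a, b], so one-sided estimates are only proved at the right
end. -/
lemma neg : ExpandingFamily (fun i x => -f i (-x)) (fun i x => -g i (-x)) (-b) (-a) lam where
  lt := neg_lt_neg h.lt
  one_lt := h.one_lt
  continuous i := ((h.continuous i).comp continuous_neg).neg
  expand i x y hxy := by
    have := h.expand i (-y) (-x) (neg_le_neg hxy)
    linarith
  right_inv i z := by simp [h.right_inv]
  left_le i := by simpa using h.le_right i
  le_right i := by simpa using h.left_le i
  disj i j hij x hx hx' :=
    h.disj i j hij (-x) ⟨by linarith [hx.2], by linarith [hx.1]⟩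
      ⟨by linarith [hx'.2], by linarith [hx'.1]⟩

end ExpandingFamily

lemma wordInv_neg (g : ι → ℝ → ℝ) (w : List ι) (x : ℝ) :
    wordInv (fun i x => -g i (-x)) w x = -wordInv g w (-x) := by
  induction w with
  | nil => simp [wordInv]
  | cons i w ih => simp [wordInv, ih]

lemma cylLen_neg (g : ι → ℝ → ℝ) (a b : ℝ) (w : List ι) :
    cylLen (fun i x => -g i (-x)) (-b) (-a) w = cylLen g a b w := by
  simp only [cylLen, wordInv_neg, neg_neg]
  ring

/-! ### A Hölder estimate for subinvariant distances -/

/-- A bounded symmetric function `N` that does not see the points outside `(a, b)` and satisfies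
`N x y ≤ ∑ i, κ i * N (f i x) (f i y)`. -/
structure Subinvariant [Fintype ι] (f : ι → ℝ → ℝ) (a b : ℝ) (κ : ι → ℝ) (N : ℝ → ℝ → ℝ)
    (B : ℝ) : Prop where
  pos : ∀ i, 0 < κ i
  lt_one : ∀ i, κ i < 1
  nonneg : ∀ x y, 0 ≤ N x y
  bound : ∀ x y, N x y ≤ B
  symm : ∀ x y, N x y = N y x
  self : ∀ x, N x x = 0
  left : ∀ x y, x ≤ a → N x y = N a y
  right : ∀ x y, b ≤ x → N x y = N b y
  le_sum : ∀ x y, N x y ≤ ∑ i, κ i * N (f i x) (f i y)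

namespace Subinvariant

variable [Fintype ι] {f g : ι → ℝ → ℝ} {a b lam : ℝ} {κ : ι → ℝ} {N : ℝ → ℝ → ℝ} {B : ℝ}

lemma right' (hN : Subinvariant f a b κ N B) {x y : ℝ} (hy : b ≤ y) : N x y = N x b := by
  rw [hN.symm, hN.right _ _ hy, hN.symm]

lemma left_left (hN : Subinvariant f a b κ N B) {x y : ℝ} (hx : x ≤ a) (hy : y ≤ a) :
    N x y = 0 := by
  rw [hN.left _ _ hx, hN.symm, hN.left _ _ hy, hN.self]

lemma right_right (hN : Subinvariant f a b κ N B) {x y : ℝ} (hx : b ≤ x) (hy : b ≤ y) :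
    N x y = 0 := by
  rw [hN.right _ _ hx, hN.right' hy, hN.self]

lemma neg (hN : Subinvariant f a b κ N B) :
    Subinvariant (fun i x => -f i (-x)) (-b) (-a) κ (fun x y => N (-x) (-y)) B where
  pos := hN.pos
  lt_one := hN.lt_one
  nonneg _ _ := hN.nonneg _ _
  bound _ _ := hN.bound _ _
  symm _ _ := hN.symm _ _
  self _ := hN.self _
  left x y hx := by simpa using hN.right (-x) (-y) (by linarith)
  right x y hx := by simpa using hN.left (-x) (-y) (by linarith)
  le_sum x y := by simpa using hN.le_sum (-x) (-y)

lemma exists_bounds (hN : Subinvariant f a b κ N B) :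
    ∃ m θ : ℝ, 0 < m ∧ 0 ≤ θ ∧ θ < 1 ∧ ∀ i, m ≤ κ i ∧ κ i ≤ θ := by
  rcases isEmpty_or_nonempty ι with hι | hι
  · exact ⟨1, 0, one_pos, le_rfl, one_pos, fun i => hι.elim i⟩
  · obtain ⟨i, hi⟩ := Finite.exists_min κ
    obtain ⟨j, hj⟩ := Finite.exists_max κ
    exact ⟨κ i, κ j, hN.pos i, (hN.pos j).le, hN.lt_one j, fun k => ⟨hi k, hj k⟩⟩

lemma word_pos (hN : Subinvariant f a b κ N B) (w : List ι) : 0 < (w.map κ).prod :=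
  List.prod_pos (by simpa using fun i _ => hN.pos i)

/-- If a point pair has a subcylinder of `w` between its images under the inverse branch of `w`,
the trivial bound on `N` is good enough. -/
lemma bound_of_subcylinder (h : ExpandingFamily f g a b lam) (hN : Subinvariant f a b κ N B)
    {K α m : ℝ} (hα : 0 ≤ α) (hK : ∀ w : List ι, (w.map κ).prod ≤ K * cylLen g a b w ^ α)
    (hm : 0 < m) (hmκ : ∀ i, m ≤ κ i) (w : List ι) (j : ι) {x y : ℝ}
    (hx : x ≤ g j a) (hy : g j b ≤ y) (x' y' : ℝ) :
    (w.map κ).prod * N x' y' ≤ B * K / m * (wordInv g w y - wordInv g w x) ^ α := by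
  have hB : 0 ≤ B := (hN.nonneg 0 0).trans (hN.bound 0 0)
  have hw := hN.word_pos w
  have hL := h.cylLen_pos (w ++ [j])
  -- Origin of the constant B K / m: `N` is at most B, and appending the letter j multiplies the
  -- word weight by at least m.
  have h1 : (w.map κ).prod * m ≤ K * cylLen g a b (w ++ [j]) ^ α := by
    refine le_trans ?_ (hK _)
    simp only [List.map_append, List.prod_append, List.map_cons, List.map_nil, List.prod_cons,
      List.prod_nil, mul_one]
    exact mul_le_mul_of_nonneg_left (hmκ j) hw.le
  have hmono := (h.strictMono_wordInv w).monotone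
  have h2 : cylLen g a b (w ++ [j]) ≤ wordInv g w y - wordInv g w x := by
    have e1 := hmono hx
    have e2 := hmono hy
    simp only [cylLen, wordInv_append, wordInv, Function.comp, id]
    linarith
  have hK0 : 0 < K := by
    have h3 := (hN.word_pos (w ++ [j])).trans_le (hK (w ++ [j]))
    exact pos_of_mul_pos_left h3 (Real.rpow_nonneg hL.le _)
  have h4 : cylLen g a b (w ++ [j]) ^ α ≤ (wordInv g w y - wordInv g w x) ^ α :=
    Real.rpow_le_rpow hL.le h2 hα
  calc (w.map κ).prod * N x' y' ≤ (w.map κ).prod * B :=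
        mul_le_mul_of_nonneg_left (hN.bound _ _) hw.le
    _ = B / m * ((w.map κ).prod * m) := by field_simp
    _ ≤ B / m * (K * (wordInv g w y - wordInv g w x) ^ α) :=
        mul_le_mul_of_nonneg_left (h1.trans (mul_le_mul_of_nonneg_left h4 hK0.le)) (by positivity)
    _ = _ := by ring

/-- Removes the error term of an induction that gains a factor θ at each step. -/
lemma le_of_forall_add_pow {x y c θ : ℝ} (h0 : 0 ≤ θ) (h1 : θ < 1)
    (h : ∀ k : ℕ, x ≤ y + c * θ ^ k) : x ≤ y := by
  have ht : Tendsto (fun k : ℕ => y + c * θ ^ k) atTop (𝓝 (y + c * 0)) :=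
    (((tendsto_pow_atTop_nhds_zero_of_lt_one h0 h1).const_mul c).const_add y)
  simpa using ge_of_tendsto' ht h

/-- There are three cases. If some first-level cylinder lies to the right of x, the trivial bound is
good enough. If x lies inside the cylinder of j and all others are to its left, only the j-th term
survives, and the pair becomes (f_j x, b) because f_j b ≥ b. Otherwise all images of x are at least
b and `N` vanishes. Carrying the word w along makes the estimate stable in the second case: the
weight and the pulled-back distance both refer to the original scale. -/
lemma bound_right (h : ExpandingFamily f g a b lam) (hN : Subinvariant f a b κ N B)
    {K α m : ℝ} (hα : 0 ≤ α) (hK : ∀ w : List ι, (w.map κ).prod ≤ K * cylLen g a b w ^ α)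
    (hm : 0 < m) (hmκ : ∀ i, m ≤ κ i) (w : List ι) {x : ℝ} (hx : x ≤ b) :
    (w.map κ).prod * N x b ≤ B * K / m * (wordInv g w b - wordInv g w x) ^ α := by
  have hB : 0 ≤ B := (hN.nonneg 0 0).trans (hN.bound 0 0)
  obtain ⟨_, θ, _, hθ0, hθ1, hθ⟩ := hN.exists_bounds
  have hK0 : 0 < K := by
    have h3 := (hN.word_pos []).trans_le (hK [])
    exact pos_of_mul_pos_left h3 (Real.rpow_nonneg (h.cylLen_pos []).le _)
  have hmono := fun w => (h.strictMono_wordInv w).monotone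
  have hR : ∀ (w : List ι) (x : ℝ), x ≤ b →
      0 ≤ B * K / m * (wordInv g w b - wordInv g w x) ^ α := fun w x hx =>
    mul_nonneg (by positivity) (Real.rpow_nonneg (sub_nonneg.2 (hmono w hx)) _)
  -- The error term is the trivial bound at k = 0 and shrinks by θ at each descent into a longer
  -- word.
  suffices H : ∀ (k : ℕ) (w : List ι) (x : ℝ), x ≤ b →
      (w.map κ).prod * N x b ≤
        B * K / m * (wordInv g w b - wordInv g w x) ^ α + (w.map κ).prod * B * θ ^ k from
    le_of_forall_add_pow hθ0 hθ1 fun k => H k w x hx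
  intro k
  induction k with
  | zero =>
    intro w x hx
    have := mul_le_mul_of_nonneg_left (hN.bound x b) (hN.word_pos w).le
    simpa using this.trans (le_add_of_nonneg_left (hR w x hx))
  | succ k ih =>
    intro w x hx
    have hrest : 0 ≤ (w.map κ).prod * B * θ ^ (k + 1) := by
      have := hN.word_pos w
      positivity
    by_cases hA : ∃ j, x ≤ g j a
    · obtain ⟨j, hj⟩ := hA
      exact (bound_of_subcylinder h hN hα hK hm hmκ w j hj (h.inv_le_right j) x b).trans
        (le_add_of_nonneg_right hrest)
    push Not at hA
    by_cases hC : ∃ j, x < g j b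
    · obtain ⟨j, hj⟩ := hC
      have hsum : ∑ i, κ i * N (f i x) (f i b) = κ j * N (f j x) b := by
        rw [Finset.sum_eq_single_of_mem j (Finset.mem_univ _), hN.right' (h.le_right j)]
        intro i _ hij
        rcases h.sep hij with hs | hs
        · rw [hN.right_right ((h.ge_iff i x b).2 (hs.trans (hA j).le)) (h.le_right i), mul_zero]
        · exact absurd (hs.trans (hA i).le) (not_le.2 hj)
      have hfx : f j x ≤ b := (h.le_iff j x b).2 hj.le
      have h1 := ih (w ++ [j]) (f j x) hfx
      have h2 : wordInv g (w ++ [j]) (f j x) = wordInv g w x := by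
        simp [wordInv_append, wordInv, h.left_inv]
      have h3 : wordInv g (w ++ [j]) b ≤ wordInv g w b := by
        simpa [wordInv_append, wordInv] using hmono w (h.inv_le_right j)
      have h4 : 0 ≤ wordInv g (w ++ [j]) b - wordInv g (w ++ [j]) (f j x) :=
        sub_nonneg.2 (hmono _ hfx)
      have hp : ((w ++ [j]).map κ).prod = (w.map κ).prod * κ j := by simp
      have h5 : (wordInv g (w ++ [j]) b - wordInv g (w ++ [j]) (f j x)) ^ α ≤
          (wordInv g w b - wordInv g w x) ^ α :=
        Real.rpow_le_rpow h4 (by rw [h2]; linarith) hα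
      have hw := hN.word_pos w
      calc (w.map κ).prod * N x b ≤ (w.map κ).prod * (κ j * N (f j x) b) := by
            rw [← hsum]; exact mul_le_mul_of_nonneg_left (hN.le_sum _ _) hw.le
        _ = ((w ++ [j]).map κ).prod * N (f j x) b := by rw [hp]; ring
        _ ≤ _ := h1
        _ ≤ B * K / m * (wordInv g w b - wordInv g w x) ^ α +
              (w.map κ).prod * θ * B * θ ^ k := by
            rw [hp]
            gcongr
            exact (hθ j).2
        _ = _ := by ring
    · push Not at hC
      have h0 : N x b = 0 := by
        refine le_antisymm ((hN.le_sum _ _).trans_eq (Finset.sum_eq_zero fun i _ => ?_))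
          (hN.nonneg _ _)
        rw [hN.right_right ((h.ge_iff i x b).2 (hC i)) (h.le_right i), mul_zero]
      rw [h0, mul_zero]
      exact add_nonneg (hR w x hx) hrest

lemma bound_left (h : ExpandingFamily f g a b lam) (hN : Subinvariant f a b κ N B)
    {K α m : ℝ} (hα : 0 ≤ α) (hK : ∀ w : List ι, (w.map κ).prod ≤ K * cylLen g a b w ^ α)
    (hm : 0 < m) (hmκ : ∀ i, m ≤ κ i) (w : List ι) {y : ℝ} (hy : a ≤ y) :
    (w.map κ).prod * N a y ≤ B * K / m * (wordInv g w y - wordInv g w a) ^ α := by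
  have := bound_right h.neg hN.neg hα (K := K) (by simpa only [cylLen_neg] using hK) hm hmκ w
    (x := -y) (by linarith)
  simp only [wordInv_neg, neg_neg] at this
  rw [hN.symm]
  convert this using 3
  ring

/-- **Hölder estimate.** If the word weights of `κ` are dominated by the `α`-th powers of the
lengths of the cylinders, then `N` is dominated by the `α`-th power of the distance. -/
theorem holder_bound (h : ExpandingFamily f g a b lam) (hN : Subinvariant f a b κ N B)
    {K α : ℝ} (hα : 0 ≤ α) (hK : ∀ w : List ι, (w.map κ).prod ≤ K * cylLen g a b w ^ α) :
    ∃ K' : ℝ, 0 ≤ K' ∧ ∀ x y, x ≤ y → N x y ≤ K' * (y - x) ^ α := by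
  have hB : 0 ≤ B := (hN.nonneg 0 0).trans (hN.bound 0 0)
  obtain ⟨m, θ, hm, hθ0, hθ1, hθ⟩ := hN.exists_bounds
  have hmκ := fun i => (hθ i).1
  have hK0 : 0 < K := by
    have h3 := (hN.word_pos []).trans_le (hK [])
    exact pos_of_mul_pos_left h3 (Real.rpow_nonneg (h.cylLen_pos []).le _)
  have hmono := fun w => (h.strictMono_wordInv w).monotone
  set M : ℝ := B * K / m with hM
  have hM0 : 0 ≤ M := by positivity
  -- The first M pays for a cylinder between x and y; one further M per letter pays for splitting
  -- the pair into one-sided pairs.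
  set M' : ℝ := M + ∑ _i : ι, M with hM'
  have hs0 : 0 ≤ ∑ _i : ι, M := Finset.sum_nonneg fun _ _ => hM0
  have hM'0 : 0 ≤ M' := by positivity
  have hR : ∀ (w : List ι) (x y : ℝ), x ≤ y →
      0 ≤ (wordInv g w y - wordInv g w x) ^ α := fun w x y hxy =>
    Real.rpow_nonneg (sub_nonneg.2 (hmono w hxy)) _
  have H : ∀ (k : ℕ) (w : List ι) (x y : ℝ), x ≤ y →
      (w.map κ).prod * N x y ≤
        M' * (wordInv g w y - wordInv g w x) ^ α + (w.map κ).prod * B * θ ^ k := by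
    intro k
    induction k with
    | zero =>
      intro w x y hxy
      have := mul_le_mul_of_nonneg_left (hN.bound x y) (hN.word_pos w).le
      simpa using this.trans (le_add_of_nonneg_left (mul_nonneg hM'0 (hR w x y hxy)))
    | succ k ih =>
      intro w x y hxy
      have hw := hN.word_pos w
      have hrest : 0 ≤ (w.map κ).prod * B * θ ^ (k + 1) := by positivity
      by_cases hA : ∃ j, x ≤ g j a ∧ g j b ≤ y
      · obtain ⟨j, hj1, hj2⟩ := hA
        refine (bound_of_subcylinder h hN hα hK hm hmκ w j hj1 hj2 x y).trans
          (le_trans ?_ (le_add_of_nonneg_right hrest))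
        exact mul_le_mul_of_nonneg_right (le_add_of_nonneg_right hs0) (hR w x y hxy)
      push Not at hA
      by_cases hC : ∃ j, g j a ≤ x ∧ y ≤ g j b
      · obtain ⟨j, hj1, hj2⟩ := hC
        have hsum : ∑ i, κ i * N (f i x) (f i y) = κ j * N (f j x) (f j y) := by
          rw [Finset.sum_eq_single_of_mem j (Finset.mem_univ _)]
          intro i _ hij
          rcases h.sep hij with hs | hs
          · rw [hN.right_right ((h.ge_iff i x b).2 (hs.trans hj1))
              ((h.ge_iff i y b).2 (hs.trans (hj1.trans hxy))), mul_zero]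
          · rw [hN.left_left ((h.le_iff i x a).2 (hxy.trans (hj2.trans hs)))
              ((h.le_iff i y a).2 (hj2.trans hs)), mul_zero]
        have h1 := ih (w ++ [j]) (f j x) (f j y) ((h.strictMono j).monotone hxy)
        have h2 : ∀ z, wordInv g (w ++ [j]) (f j z) = wordInv g w z := fun z => by
          simp [wordInv_append, wordInv, h.left_inv]
        rw [h2, h2] at h1
        have hp : ((w ++ [j]).map κ).prod = (w.map κ).prod * κ j := by simp
        calc (w.map κ).prod * N x y ≤ (w.map κ).prod * (κ j * N (f j x) (f j y)) := by
              rw [← hsum]; exact mul_le_mul_of_nonneg_left (hN.le_sum _ _) hw.le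
          _ = ((w ++ [j]).map κ).prod * N (f j x) (f j y) := by rw [hp]; ring
          _ ≤ _ := h1
          _ ≤ M' * (wordInv g w y - wordInv g w x) ^ α +
                (w.map κ).prod * θ * B * θ ^ k := by
              rw [hp]
              gcongr
              exact (hθ j).2
          _ = _ := by ring
      -- No cylinder lies between x and y and none contains both. Hence for each letter an image
      -- point can be replaced by an endpoint of [a, b], or the term vanishes; the one-sided bounds
      -- finish without further recursion.
      push Not at hC
      refine le_trans ?_ (le_add_of_nonneg_right hrest)
      have hterm : ∀ j, (w.map κ).prod * (κ j * N (f j x) (f j y)) ≤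
          M * (wordInv g w y - wordInv g w x) ^ α := by
        intro j
        have hp : (w.map κ).prod * (κ j * N (f j x) (f j y)) =
            ((w ++ [j]).map κ).prod * N (f j x) (f j y) := by simp; ring
        have h2 : ∀ z, wordInv g (w ++ [j]) (f j z) = wordInv g w z := fun z => by
          simp [wordInv_append, wordInv, h.left_inv]
        have h0 := mul_nonneg hM0 (hR w x y hxy)
        rcases le_or_gt x (g j a) with hxa | hxa
        · have hyb := hA j hxa
          rcases le_or_gt y (g j a) with hya | hya
          · rw [hN.left_left ((h.le_iff j x a).2 hxa) ((h.le_iff j y a).2 hya)]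
            simpa using h0
          · rw [hp, hN.left _ _ ((h.le_iff j x a).2 hxa)]
            have hay := (h.ge_iff j y a).2 hya.le
            refine (bound_left h hN hα hK hm hmκ (w ++ [j]) hay).trans ?_
            refine mul_le_mul_of_nonneg_left (Real.rpow_le_rpow
              (sub_nonneg.2 (hmono _ hay)) ?_ hα) hM0
            have := hmono (w ++ [j]) ((h.le_iff j x a).2 hxa)
            rw [h2] at this ⊢
            linarith
        · have hyb := hC j hxa.le
          rcases le_or_gt (g j b) x with hxb | hxb
          · rw [hN.right_right ((h.ge_iff j x b).2 hxb) ((h.ge_iff j y b).2 hyb.le)]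
            simpa using h0
          · have hby := (h.ge_iff j y b).2 hyb.le
            rw [hp, hN.right' hby]
            have hxb' := (h.le_iff j x b).2 hxb.le
            refine (bound_right h hN hα hK hm hmκ (w ++ [j]) hxb').trans ?_
            refine mul_le_mul_of_nonneg_left (Real.rpow_le_rpow
              (sub_nonneg.2 (hmono _ hxb')) ?_ hα) hM0
            have := hmono (w ++ [j]) hby
            rw [h2] at this ⊢
            linarith
      calc (w.map κ).prod * N x y
          ≤ (w.map κ).prod * ∑ i, κ i * N (f i x) (f i y) :=
            mul_le_mul_of_nonneg_left (hN.le_sum _ _) hw.le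
        _ = ∑ i, (w.map κ).prod * (κ i * N (f i x) (f i y)) := Finset.mul_sum _ _ _
        _ ≤ ∑ _i : ι, M * (wordInv g w y - wordInv g w x) ^ α :=
            Finset.sum_le_sum fun j _ => hterm j
        _ = (∑ _i : ι, M) * (wordInv g w y - wordInv g w x) ^ α := by rw [Finset.sum_mul]
        _ ≤ _ := mul_le_mul_of_nonneg_right (le_add_of_nonneg_left hM0) (hR w x y hxy)
  refine ⟨M', hM'0, fun x y hxy => ?_⟩
  have := le_of_forall_add_pow hθ0 hθ1 fun k => H k [] x y hxy
  simpa [wordInv] using this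

end Subinvariant

end

section

variable {ι : Type*}

/-! ### The distribution function of a Bernoulli measure -/

/-- `T` is bounded, is `0` to the left of `a` and `1` to the right of `b`, and satisfies the
functional equation `T = ∑ i, P i * T ∘ f i`. -/
structure IsDistribution [Fintype ι] (f : ι → ℝ → ℝ) (a b : ℝ) (P : ι → ℝ) (T : ℝ → ℝ) :
    Prop where
  nonneg : ∀ x, 0 ≤ T x
  le_one : ∀ x, T x ≤ 1
  left : ∀ x, x ≤ a → T x = 0
  right : ∀ x, b ≤ x → T x = 1
  eq_sum : ∀ x, T x = ∑ i, P i * T (f i x)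

/-- The sequence `i, ω 0, ω 1, …`. -/
def consSeq (i : ι) (ω : ℕ → ι) : ℕ → ι
  | 0 => i
  | n + 1 => ω n

lemma iter_succ' {X : Type*} (F : ι → X → X) (ω : ℕ → ι) (n : ℕ) (x : X) :
    iter F ω (n + 1) x = iter F (shift ω) n (F (ω 0) x) := by
  induction n with
  | zero => rfl
  | succ n ih =>
    change F (ω (n + 1)) (iter F ω (n + 1) x) = _
    rw [ih]
    rfl

/-- The product measure on `ℕ → ι` whose marginals have the weights `P`. -/
def productMeasure [Fintype ι] [MeasurableSpace ι] (P : ι → ℝ) : Measure (ℕ → ι) :=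
  Measure.infinitePi fun _ : ℕ => ∑ i, ENNReal.ofReal (P i) • Measure.dirac i

lemma isProbabilityMeasure_marginal [Fintype ι] [MeasurableSpace ι] {P : ι → ℝ}
    (hP : ∀ i, 0 ≤ P i) (hP1 : ∑ i, P i = 1) :
    IsProbabilityMeasure (∑ i, ENNReal.ofReal (P i) • Measure.dirac i : Measure ι) := by
  refine ⟨?_⟩
  simp only [Measure.coe_finsetSum, Finset.sum_apply, Measure.smul_apply, measure_univ,
    smul_eq_mul, mul_one]
  rw [← ENNReal.ofReal_sum_of_nonneg fun i _ => hP i, hP1, ENNReal.ofReal_one]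

lemma measurable_consSeq [MeasurableSpace ι] (i : ι) : Measurable (consSeq i) := by
  refine measurable_pi_lambda _ fun n => ?_
  cases n with
  | zero => exact measurable_const
  | succ n => exact measurable_pi_apply n

/-! ### Self-similarity of the product measure and of the escape probability. -/

section Measure

variable [Fintype ι] [MeasurableSpace ι] [DiscreteMeasurableSpace ι] {P : ι → ℝ}

/-- The first letter is independent of the rest, which has the same law. Both sides are compared on
finite boxes, which determine an infinite product measure. -/
lemma productMeasure_eq_sum (hP : ∀ i, 0 ≤ P i) (hP1 : ∑ i, P i = 1) :
    productMeasure P =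
      ∑ i, ENNReal.ofReal (P i) • (productMeasure P).map (consSeq i) := by
  have := isProbabilityMeasure_marginal hP hP1
  symm
  refine Measure.eq_infinitePi _ fun s t ht => ?_
  classical
  set μ : Measure ι := ∑ i, ENNReal.ofReal (P i) • Measure.dirac i with hμ
  -- The index set is enlarged to an initial segment, with full factors at the new places, so that
  -- coordinate 0 is present and can be split off.
  obtain ⟨N, hN⟩ : ∃ N, s ⊆ Finset.range (N + 1) :=
    ⟨s.sup id, fun n hn => Finset.mem_range.2 (Nat.lt_succ_of_le (Finset.le_sup (f := id) hn))⟩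
  set t' : ℕ → Set ι := fun n => if n ∈ s then t n else Set.univ with ht'
  have hpi : Set.pi s t = Set.pi (Finset.range (N + 1) : Finset ℕ) t' := by
    ext ω
    simp only [Set.mem_pi, Finset.mem_coe, ht']
    constructor
    · intro hω n _
      split_ifs with hn
      · exact hω n hn
      · trivial
    · intro hω n hn
      have := hω n (hN hn)
      rwa [if_pos hn] at this
  have hprod : ∏ n ∈ s, μ (t n) = ∏ n ∈ Finset.range (N + 1), μ (t' n) := by
    rw [← Finset.prod_subset hN (f := fun n => μ (t' n))]
    · exact Finset.prod_congr rfl fun n hn => by simp [ht', hn]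
    · intro n _ hn
      simp [ht', hn]
  have ht'm : ∀ n, MeasurableSet (t' n) := fun n => MeasurableSet.of_discrete
  have hpre : ∀ i, consSeq i ⁻¹' Set.pi (Finset.range (N + 1) : Finset ℕ) t' =
      {_ω | i ∈ t' 0} ∩ Set.pi (Finset.range N : Finset ℕ) fun n => t' (n + 1) := by
    intro i
    ext ω
    simp only [Set.mem_preimage, Set.mem_pi, Finset.coe_range, Set.mem_Iio, Set.mem_inter_iff,
      Set.mem_ofPred_eq]
    constructor
    · intro hω
      exact ⟨hω 0 (Nat.succ_pos _), fun n hn => hω (n + 1) (Nat.succ_lt_succ hn)⟩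
    · rintro ⟨h0, hω⟩ n hn
      cases n with
      | zero => exact h0
      | succ n => exact hω n (Nat.lt_of_succ_lt_succ hn)
  have hms : MeasurableSet (Set.pi (Finset.range (N + 1) : Finset ℕ) t') :=
    MeasurableSet.pi (Finset.countable_toSet _) fun n _ => ht'm n
  have hval : ∀ i, (productMeasure P).map (consSeq i)
      (Set.pi (Finset.range (N + 1) : Finset ℕ) t') =
      (t' 0).indicator 1 i * ∏ n ∈ Finset.range N, μ (t' (n + 1)) := by
    intro i
    rw [Measure.map_apply (measurable_consSeq i) hms, hpre]
    by_cases hi : i ∈ t' 0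
    · simp only [hi, Set.ofPred_true, Set.univ_inter, Set.indicator_of_mem, Pi.one_apply, one_mul]
      exact Measure.infinitePi_pi _ fun n _ => ht'm (n + 1)
    · simp [hi]
  rw [hpi, hprod, Finset.prod_range_succ', mul_comm]
  simp only [Measure.coe_finsetSum, Finset.sum_apply, Measure.smul_apply, smul_eq_mul, hval]
  simp only [← mul_assoc, ← Finset.sum_mul]
  congr 1
  simp only [hμ, Measure.coe_finsetSum, Finset.sum_apply, Measure.smul_apply, smul_eq_mul,
    Measure.dirac_apply' _ (ht'm 0)]

/-- The probability that the random orbit of `x` tends to `+∞`. -/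
def escapeProb (f : ι → ℝ → ℝ) (P : ι → ℝ) (x : ℝ) : ℝ :=
  (productMeasure P).real {ω | Tendsto (fun n => iter f ω n x) atTop atTop}

lemma measurable_iter {f : ι → ℝ → ℝ} (hf : ∀ i, Continuous (f i)) (n : ℕ) (x : ℝ) :
    Measurable fun ω : ℕ → ι => iter f ω n x := by
  induction n with
  | zero => exact measurable_const
  | succ n ih =>
    have : Measurable fun q : ι × ℝ => f q.1 q.2 :=
      measurable_from_prod_countable_right fun i => (hf i).measurable
    exact this.comp ((measurable_pi_apply n).prodMk ih)

lemma escapeProb_eq_sum {f : ι → ℝ → ℝ} (hf : ∀ i, Continuous (f i)) (hP : ∀ i, 0 ≤ P i)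
    (hP1 : ∑ i, P i = 1) (x : ℝ) :
    escapeProb f P x = ∑ i, P i * escapeProb f P (f i x) := by
  have := isProbabilityMeasure_marginal hP hP1
  have : IsProbabilityMeasure (productMeasure P) := by
    unfold productMeasure; infer_instance
  have hm : MeasurableSet {ω : ℕ → ι | Tendsto (fun n => iter f ω n x) atTop atTop} :=
    measurableSet_tendsto _ fun n => measurable_iter hf n x
  have hpre : ∀ i, consSeq i ⁻¹' {ω | Tendsto (fun n => iter f ω n x) atTop atTop} =
      {ω | Tendsto (fun n => iter f ω n (f i x)) atTop atTop} := by
    intro i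
    ext ω
    simp only [Set.mem_preimage, Set.mem_ofPred_eq]
    rw [← tendsto_add_atTop_iff_nat 1]
    simp only [iter_succ']
    rfl
  have key : productMeasure P {ω | Tendsto (fun n => iter f ω n x) atTop atTop} =
      ∑ i, ENNReal.ofReal (P i) *
        productMeasure P {ω | Tendsto (fun n => iter f ω n (f i x)) atTop atTop} := by
    conv_lhs => rw [productMeasure_eq_sum hP hP1]
    simp only [Measure.coe_finsetSum, Finset.sum_apply, Measure.smul_apply, smul_eq_mul]
    refine Finset.sum_congr rfl fun i _ => ?_
    rw [Measure.map_apply (measurable_consSeq i) hm, hpre]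
  unfold escapeProb Measure.real
  rw [key, ENNReal.toReal_sum fun i _ =>
    ENNReal.mul_ne_top ENNReal.ofReal_ne_top (measure_ne_top _ _)]
  refine Finset.sum_congr rfl fun i _ => ?_
  rw [ENNReal.toReal_mul, ENNReal.toReal_ofReal (hP i)]

end Measure

/-! ### Orbits outside (a, b) and boundary values of the escape probability. -/

namespace ExpandingFamily

variable {f g : ι → ℝ → ℝ} {a b lam : ℝ} (h : ExpandingFamily f g a b lam)
include h

lemma iter_right (ω : ℕ → ι) (n : ℕ) {x : ℝ} (hx : b ≤ x) :
    lam ^ n * (x - b) ≤ iter f ω n x - b := by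
  induction n with
  | zero => simp [iter]
  | succ n ih =>
    have h0 : 0 ≤ lam ^ n * (x - b) :=
      mul_nonneg (pow_nonneg (by linarith [h.one_lt]) _) (sub_nonneg.2 hx)
    have h1 := h.expand (ω n) b (iter f ω n x) (by linarith)
    have h2 := h.le_right (ω n)
    have h3 : lam * (lam ^ n * (x - b)) ≤ lam * (iter f ω n x - b) :=
      mul_le_mul_of_nonneg_left ih (by linarith [h.one_lt])
    change _ ≤ f (ω n) (iter f ω n x) - b
    rw [pow_succ']
    linarith

lemma iter_left (ω : ℕ → ι) (n : ℕ) {x : ℝ} (hx : x ≤ a) :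
    lam ^ n * (a - x) ≤ a - iter f ω n x := by
  induction n with
  | zero => simp [iter]
  | succ n ih =>
    have h0 : 0 ≤ lam ^ n * (a - x) :=
      mul_nonneg (pow_nonneg (by linarith [h.one_lt]) _) (sub_nonneg.2 hx)
    have h1 := h.expand (ω n) (iter f ω n x) a (by linarith)
    have h2 := h.left_le (ω n)
    have h3 : lam * (lam ^ n * (a - x)) ≤ lam * (a - iter f ω n x) :=
      mul_le_mul_of_nonneg_left ih (by linarith [h.one_lt])
    change _ ≤ a - f (ω n) (iter f ω n x)
    rw [pow_succ']
    linarith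

lemma tendsto_iter_right (ω : ℕ → ι) {x : ℝ} (hx : b < x) :
    Tendsto (fun n => iter f ω n x) atTop atTop := by
  have h1 : Tendsto (fun n : ℕ => lam ^ n * (x - b) + b) atTop atTop :=
    tendsto_atTop_add_const_right _ _
      ((tendsto_pow_atTop_atTop_of_one_lt h.one_lt).atTop_mul_const (sub_pos.2 hx))
  exact tendsto_atTop_mono (fun n => by linarith [h.iter_right ω n hx.le]) h1

lemma not_tendsto_iter_left (ω : ℕ → ι) {x : ℝ} (hx : x ≤ a) :
    ¬ Tendsto (fun n => iter f ω n x) atTop atTop := by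
  intro ht
  obtain ⟨n, hn⟩ := (ht.eventually_gt_atTop a).exists
  have h0 : 0 ≤ lam ^ n * (a - x) :=
    mul_nonneg (pow_nonneg (by linarith [h.one_lt]) _) (sub_nonneg.2 hx)
  linarith [h.iter_left ω n hx]

/-- Two distinct letters fixing b would have cylinders both ending at b, which would overlap. -/
lemma eq_of_fixed_right {i j : ι} (hi : f i b = b) (hj : f j b = b) : i = j := by
  by_contra hij
  have e1 : g i b = b := by conv_lhs => rw [← hi, h.left_inv]
  have e2 : g j b = b := by conv_lhs => rw [← hj, h.left_inv]
  have l1 := h.strictMono_inv i h.lt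
  have l2 := h.strictMono_inv j h.lt
  rcases h.sep hij with hs | hs <;> linarith

/-- The delicate value is at b, whose orbit may stay at b. At most one letter i fixes b and the
others push it beyond b, so the functional equation reads T(b) = 1 - P_i + P_i T(b). As P_i < 1,
this forces T(b) = 1. At a nothing is needed, since orbits starting at or below a stay there. -/
theorem isDistribution_escapeProb [Fintype ι] [MeasurableSpace ι] [DiscreteMeasurableSpace ι]
    {P : ι → ℝ} (hP : ∀ i, 0 ≤ P i) (hP1 : ∑ i, P i = 1) (hlt : ∀ i, P i < 1) :
    IsDistribution f a b P (escapeProb f P) := by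
  have := isProbabilityMeasure_marginal hP hP1
  have : IsProbabilityMeasure (productMeasure P) := by
    unfold productMeasure; infer_instance
  have heq := escapeProb_eq_sum h.continuous hP hP1
  have hgt : ∀ x, b < x → escapeProb f P x = 1 := by
    intro x hx
    have : {ω : ℕ → ι | Tendsto (fun n => iter f ω n x) atTop atTop} = Set.univ :=
      Set.eq_univ_of_forall fun ω => h.tendsto_iter_right ω hx
    simp [escapeProb, this]
  refine ⟨fun x => measureReal_nonneg, fun x => measureReal_le_one, fun x hx => ?_,
    fun x hx => ?_, heq⟩
  · have : {ω : ℕ → ι | Tendsto (fun n => iter f ω n x) atTop atTop} = ∅ :=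
      Set.eq_empty_of_forall_notMem fun ω => h.not_tendsto_iter_left ω hx
    simp [escapeProb, this]
  · rcases hx.eq_or_lt with rfl | hx
    swap
    · exact hgt x hx
    by_cases hfix : ∃ i, f i b = b
    · obtain ⟨i, hi⟩ := hfix
      have h1 : ∑ j, P j * escapeProb f P (f j b) =
          ∑ j, P j - P i + P i * escapeProb f P b := by
        classical
        rw [← Finset.add_sum_erase _ _ (Finset.mem_univ i),
          ← Finset.add_sum_erase Finset.univ P (Finset.mem_univ i), hi,
          Finset.sum_congr rfl (g := P)]
        · ring
        · intro j hj
          have hne : f j b ≠ b := fun hc =>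
            (Finset.ne_of_mem_erase hj) (h.eq_of_fixed_right hc hi)
          rw [hgt _ (lt_of_le_of_ne (h.le_right j) (Ne.symm hne)), mul_one]
      have h2 := heq b
      rw [h1, hP1] at h2
      have h3 : (1 - P i) * (escapeProb f P b - 1) = 0 := by linarith
      rcases mul_eq_zero.1 h3 with h4 | h4
      · linarith [hlt i]
      · linarith
    · push Not at hfix
      rw [heq b, ← hP1]
      refine Finset.sum_congr rfl fun j _ => ?_
      rw [hgt _ (lt_of_le_of_ne (h.le_right j) (Ne.symm (hfix j))), mul_one]

end ExpandingFamily

/-! ### Increments of a distribution function over cylinders. -/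

namespace IsDistribution

variable [Fintype ι] {f g : ι → ℝ → ℝ} {a b lam : ℝ} {P : ι → ℝ} {T : ℝ → ℝ}

lemma subinvariant (hT : IsDistribution f a b P T) (hP : ∀ i, 0 < P i) (hlt : ∀ i, P i < 1) :
    Subinvariant f a b P (fun x y => |T x - T y|) 1 where
  pos := hP
  lt_one := hlt
  nonneg _ _ := abs_nonneg _
  bound x y := abs_sub_le_iff.2
    ⟨by linarith [hT.le_one x, hT.nonneg y], by linarith [hT.le_one y, hT.nonneg x]⟩
  symm _ _ := abs_sub_comm _ _
  self x := by simp
  left x y hx := by rw [hT.left x hx, hT.left a le_rfl]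
  right x y hx := by rw [hT.right x hx, hT.right b le_rfl]
  le_sum x y := by
    rw [hT.eq_sum x, hT.eq_sum y, ← Finset.sum_sub_distrib]
    refine (Finset.abs_sum_le_sum_abs _ _).trans_eq (Finset.sum_congr rfl fun i _ => ?_)
    rw [← mul_sub, abs_mul, abs_of_pos (hP i)]

/-- On a cylinder, the increments of `T` are scaled by the weight of the word. -/
lemma sub_wordInv (hT : IsDistribution f a b P T) (h : ExpandingFamily f g a b lam)
    (w : List ι) {x y : ℝ} (hx : x ∈ Set.Icc a b) (hy : y ∈ Set.Icc a b) :
    T (wordInv g w y) - T (wordInv g w x) = (w.map P).prod * (T y - T x) := by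
  induction w with
  | nil => simp [wordInv]
  | cons i w ih =>
    have hx' := h.wordInv_mem w hx
    have hy' := h.wordInv_mem w hy
    rw [hT.eq_sum, hT.eq_sum (wordInv g (i :: w) x), ← Finset.sum_sub_distrib,
      Finset.sum_eq_single_of_mem i (Finset.mem_univ _)]
    · simp only [wordInv, Function.comp, h.right_inv, List.map_cons, List.prod_cons]
      rw [← mul_sub, ih, mul_assoc]
    -- Under another letter both points land on the same side of (a, b), where T is constant.
    · intro j _ hj
      have hlo : ∀ z ∈ Set.Icc a b, g i a ≤ g i z ∧ g i z ≤ g i b := fun z hz =>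
        ⟨(h.strictMono_inv i).monotone hz.1, (h.strictMono_inv i).monotone hz.2⟩
      simp only [wordInv, Function.comp]
      rcases h.sep hj with hs | hs
      · rw [hT.right _ ((h.ge_iff j _ b).2 (hs.trans (hlo _ hy').1)),
          hT.right _ ((h.ge_iff j _ b).2 (hs.trans (hlo _ hx').1)), sub_self]
      · rw [hT.left _ ((h.le_iff j _ a).2 ((hlo _ hy').2.trans hs)),
          hT.left _ ((h.le_iff j _ a).2 ((hlo _ hx').2.trans hs)), sub_self]

lemma sub_endpoints (hT : IsDistribution f a b P T) (h : ExpandingFamily f g a b lam)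
    (w : List ι) : T (wordInv g w b) - T (wordInv g w a) = (w.map P).prod := by
  rw [hT.sub_wordInv h w h.left_mem h.right_mem, hT.left a le_rfl, hT.right b le_rfl]
  ring

end IsDistribution

end

section

variable {ι : Type*}

/-! ### The limit set -/

/-- The points of the line having an orbit in `[a, b]`. -/
def limitSet (f : ι → ℝ → ℝ) (a b : ℝ) : Set ℝ :=
  {x | ∃ ω : ℕ → ι, ∀ n, iter f ω n x ∈ Set.Icc a b}

/-- The `n`-prefix of `ω`. -/
def prefixWord (ω : ℕ → ι) : ℕ → List ι
  | 0 => []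
  | n + 1 => ω 0 :: prefixWord (shift ω) n

lemma length_prefixWord (ω : ℕ → ι) (n : ℕ) : (prefixWord ω n).length = n := by
  induction n generalizing ω with
  | zero => rfl
  | succ n ih => simp [prefixWord, ih]

lemma iter_eq_wordMap (f : ι → ℝ → ℝ) (ω : ℕ → ι) (n : ℕ) (x : ℝ) :
    iter f ω n x = wordMap f (prefixWord ω n) x := by
  induction n generalizing ω x with
  | zero => rfl
  | succ n ih => rw [iter_succ', ih]; rfl

lemma iter_consSeq_succ {X : Type*} (F : ι → X → X) (i : ι) (ω : ℕ → ι) (n : ℕ) (x : X) :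
    iter F (consSeq i ω) (n + 1) x = iter F ω n (F i x) := by
  rw [iter_succ']
  rfl

/-- Both points lie below `a`, or both points lie above `b`. -/
def SameSide (a b x y : ℝ) : Prop := (x < a ∧ y < a) ∨ (b < x ∧ b < y)

/-- By compactness of the space of sequences, a point all of whose orbits leave the backward
invariant closed set `I` leaves it in bounded time. -/
lemma exists_escape_time [Finite ι] {f : ι → ℝ → ℝ} (hf : ∀ i, Continuous (f i)) {I : Set ℝ}
    (hI : IsClosed I) (hfI : ∀ i x, f i x ∈ I → x ∈ I) {x : ℝ}
    (hx : ¬ ∃ ω : ℕ → ι, ∀ n, iter f ω n x ∈ I) :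
    ∃ N, ∀ ω : ℕ → ι, iter f ω N x ∉ I := by
  by_contra! hc
  refine hx ?_
  let _ : TopologicalSpace ι := ⊥
  have : DiscreteTopology ι := ⟨rfl⟩
  have hcont : ∀ n, Continuous fun ω : ℕ → ι => iter f ω n x := by
    intro n
    induction n with
    | zero => exact continuous_const
    | succ n ih =>
      have h1 : Continuous fun q : ι × ℝ => f q.1 q.2 :=
        continuous_prod_of_discrete_left.2 hf
      exact h1.comp ((continuous_apply n).prodMk ih)
  have hclosed : ∀ n, IsClosed {ω : ℕ → ι | iter f ω n x ∈ I} := fun n =>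
    hI.preimage (hcont n)
  obtain ⟨ω, hω⟩ := IsCompact.nonempty_iInter_of_sequence_nonempty_isCompact_isClosed
    (fun n => {ω : ℕ → ι | iter f ω n x ∈ I})
    (fun n ω hω => hfI (ω n) _ hω) hc (hclosed 0).isCompact hclosed
  exact ⟨ω, fun n => Set.mem_iInter.1 hω n⟩

/-- The points near a point which escapes in time `N` escape on the same side. -/
lemma eventually_sameSide [Finite ι] [Nonempty ι] {f : ι → ℝ → ℝ} (hf : ∀ i, Continuous (f i))
    {a b : ℝ} {N : ℕ} {x : ℝ}
    (hx : ∀ ω : ℕ → ι, iter f ω N x ∉ Set.Icc a b) :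
    ∀ᶠ y in 𝓝 x, ∀ ω : ℕ → ι, SameSide a b (iter f ω N x) (iter f ω N y) := by
  induction N generalizing x with
  | zero =>
    have hx0 : x ∉ Set.Icc a b := hx fun _ => Classical.arbitrary ι
    rcases lt_or_ge x a with hxa | hxa
    · filter_upwards [gt_mem_nhds hxa] with y hy ω
      exact Or.inl ⟨hxa, hy⟩
    · have hxb : b < x := lt_of_not_ge fun hc => hx0 ⟨hxa, hc⟩
      filter_upwards [lt_mem_nhds hxb] with y hy ω
      exact Or.inr ⟨hxb, hy⟩
  | succ N ih =>
    have h1 : ∀ i, ∀ᶠ y in 𝓝 x, ∀ ω : ℕ → ι,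
        SameSide a b (iter f ω N (f i x)) (iter f ω N (f i y)) := fun i =>
      (hf i).continuousAt.eventually
        (ih fun ω => by simpa [iter_consSeq_succ] using hx (consSeq i ω))
    filter_upwards [eventually_all.2 h1] with y hy ω
    rw [iter_succ', iter_succ']
    exact hy _ _

namespace ExpandingFamily

variable {f g : ι → ℝ → ℝ} {a b lam : ℝ} (h : ExpandingFamily f g a b lam)
include h

lemma mem_of_map_mem (i : ι) {x : ℝ} (hx : f i x ∈ Set.Icc a b) : x ∈ Set.Icc a b :=
  ⟨(h.left_le_inv i).trans ((h.ge_iff i x a).1 hx.1),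
    ((h.le_iff i x b).1 hx.2).trans (h.inv_le_right i)⟩

lemma mem_of_map_mem_Ioo (i : ι) {x : ℝ} (hx : f i x ∈ Set.Ioo a b) : x ∈ Set.Ioo a b :=
  ⟨lt_of_not_ge fun hc => not_lt.2 (((h.strictMono i).monotone hc).trans (h.left_le i)) hx.1,
    lt_of_not_ge fun hc => not_lt.2 ((h.le_right i).trans ((h.strictMono i).monotone hc)) hx.2⟩

lemma mem_of_wordMap_mem (w : List ι) {x : ℝ} (hx : wordMap f w x ∈ Set.Icc a b) :
    x ∈ Set.Icc a b := by
  induction w generalizing x with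
  | nil => exact hx
  | cons i w ih => exact h.mem_of_map_mem i (ih hx)

lemma mem_of_wordMap_mem_Ioo (w : List ι) {x : ℝ} (hx : wordMap f w x ∈ Set.Ioo a b) :
    x ∈ Set.Ioo a b := by
  induction w generalizing x with
  | nil => exact hx
  | cons i w ih => exact h.mem_of_map_mem_Ioo i (ih hx)

lemma exists_escape_time [Finite ι] {x : ℝ} (hx : x ∉ limitSet f a b) :
    ∃ N, ∀ ω : ℕ → ι, iter f ω N x ∉ Set.Icc a b :=
  GenTakagi.exists_escape_time h.continuous isClosed_Icc (fun i _ => h.mem_of_map_mem i) hx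

/-- By backward invariance of [a, b], an orbit that has left it never returns, so the escape time
serves all longer words. -/
lemma wordMap_notMem [Nonempty ι] {N : ℕ} {x : ℝ}
    (hx : ∀ ω : ℕ → ι, iter f ω N x ∉ Set.Icc a b) {w : List ι} (hw : N ≤ w.length) :
    wordMap f w x ∉ Set.Icc a b := by
  induction N generalizing x w with
  | zero => exact fun hc => hx (fun _ => Classical.arbitrary ι) (h.mem_of_wordMap_mem w hc)
  | succ N ih =>
    cases w with
    | nil => simp at hw
    | cons i w =>
      refine ih (x := f i x) (fun ω hc => hx (consSeq i ω) ?_) (by simpa using hw)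
      rwa [iter_consSeq_succ]

lemma mem_cylinder_of_mem_limitSet {x : ℝ} (hx : x ∈ limitSet f a b) (n : ℕ) :
    ∃ w : List ι, w.length = n ∧ x ∈ Set.Icc (wordInv g w a) (wordInv g w b) := by
  obtain ⟨ω, hω⟩ := hx
  refine ⟨prefixWord ω n, length_prefixWord ω n, ?_⟩
  have h1 := hω n
  rw [iter_eq_wordMap] at h1
  have hm := (h.strictMono_wordInv (prefixWord ω n)).monotone
  have h2 := hm h1.1
  have h3 := hm h1.2
  rw [h.wordInv_wordMap] at h2 h3
  exact ⟨h2, h3⟩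

end ExpandingFamily

/-- After N uses of the functional equation only the values 0 and 1 remain, and they agree for x and
y. So T is locally constant off the limit set. -/
lemma IsDistribution.eq_of_sameSide [Fintype ι] [Nonempty ι] {f : ι → ℝ → ℝ} {a b : ℝ}
    {P : ι → ℝ} {T : ℝ → ℝ} (hT : IsDistribution f a b P T) {N : ℕ} {x y : ℝ}
    (hxy : ∀ ω : ℕ → ι, SameSide a b (iter f ω N x) (iter f ω N y)) : T x = T y := by
  induction N generalizing x y with
  | zero =>
    rcases hxy fun _ => Classical.arbitrary ι with ⟨h1, h2⟩ | ⟨h1, h2⟩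
    · rw [hT.left x h1.le, hT.left y h2.le]
    · rw [hT.right x h1.le, hT.right y h2.le]
  | succ N ih =>
    rw [hT.eq_sum x, hT.eq_sum y]
    refine Finset.sum_congr rfl fun i _ => ?_
    rw [ih fun ω => by simpa [iter_consSeq_succ] using hxy (consSeq i ω)]

/-! ### Lower and upper bounds for the Hausdorff dimension of the limit set. -/

namespace ExpandingFamily

variable [Fintype ι] {f g : ι → ℝ → ℝ} {a b lam : ℝ} (h : ExpandingFamily f g a b lam)
include h

/-- The smallest solution of T x = c in [a, b] is in the limit set: otherwise T would be constant
near it and there would be a smaller solution. -/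
lemma Ioo_subset_image_limitSet [Nonempty ι] {P : ι → ℝ} {T : ℝ → ℝ}
    (hT : IsDistribution f a b P T) (hc : Continuous T) :
    Set.Ioo 0 1 ⊆ T '' limitSet f a b := by
  intro c hcI
  have hivt : c ∈ T '' Set.Icc a b := by
    refine intermediate_value_Icc h.lt.le hc.continuousOn ?_
    rw [hT.left a le_rfl, hT.right b le_rfl]
    exact ⟨hcI.1.le, hcI.2.le⟩
  have hS : IsCompact (Set.Icc a b ∩ T ⁻¹' {c}) :=
    isCompact_Icc.inter_right (isClosed_singleton.preimage hc)
  have hne : (Set.Icc a b ∩ T ⁻¹' {c}).Nonempty := by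
    obtain ⟨x, hx, hxc⟩ := hivt
    exact ⟨x, hx, hxc⟩
  obtain ⟨x, ⟨hx, hxc⟩, hmin⟩ := hS.exists_isMinOn hne continuousOn_id
  refine ⟨x, ?_, hxc⟩
  by_contra hxL
  obtain ⟨N, hN⟩ := h.exists_escape_time hxL
  have hax : a < x := by
    refine lt_of_le_of_ne hx.1 ?_
    rintro rfl
    rw [Set.mem_preimage, hT.left _ le_rfl] at hxc
    exact hcI.1.ne hxc
  have h1 : ∀ᶠ y in 𝓝[<] x, ∀ ω : ℕ → ι, SameSide a b (iter f ω N x) (iter f ω N y) :=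
    (eventually_sameSide h.continuous hN).filter_mono nhdsWithin_le_nhds
  have h2 : ∀ᶠ y in 𝓝[<] x, a < y := (lt_mem_nhds hax).filter_mono nhdsWithin_le_nhds
  obtain ⟨y, hy1, hy2, hy3⟩ := (h1.and (h2.and self_mem_nhdsWithin)).exists
  have hyx : y < x := hy3
  have hTy : T y = c := by rw [← hT.eq_of_sameSide hy1]; exact hxc
  have hle : x ≤ y := hmin ⟨⟨hy2.le, hyx.le.trans hx.2⟩, hTy⟩
  exact not_lt.2 hle hyx

/-- **Mass distribution.** If the weights of the words are dominated by the `t`-th powers of the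
lengths of the cylinders, then the limit set has dimension at least `t`. -/
theorem le_dimH_limitSet {P : ι → ℝ} (hP : ∀ i, 0 < P i) (hP1 : ∑ i, P i = 1)
    (hlt : ∀ i, P i < 1) {K t : ℝ} (ht : 0 ≤ t)
    (hK : ∀ w : List ι, (w.map P).prod ≤ K * cylLen g a b w ^ t) :
    ENNReal.ofReal t ≤ dimH (limitSet f a b) := by
  have hne : Nonempty ι := by
    by_contra hι
    rw [not_nonempty_iff] at hι
    simp at hP1
  -- The bound for the dimension of a Hölder image requires a positive exponent.
  rcases ht.eq_or_lt with rfl | ht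
  · simp
  let _ : MeasurableSpace ι := ⊤
  have hT := h.isDistribution_escapeProb (fun i => (hP i).le) hP1 hlt
  set T := escapeProb f P
  obtain ⟨K', hK'0, hK'⟩ := (hT.subinvariant hP hlt).holder_bound h ht.le hK
  have hH : HolderWith K'.toNNReal t.toNNReal T := by
    intro x y
    rw [Real.coe_toNNReal _ ht.le, edist_dist, edist_dist,
      ENNReal.ofReal_rpow_of_nonneg dist_nonneg ht.le]
    change _ ≤ ENNReal.ofReal K' * _
    rw [← ENNReal.ofReal_mul hK'0]
    refine ENNReal.ofReal_le_ofReal ?_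
    rw [Real.dist_eq, Real.dist_eq]
    rcases le_total x y with hxy | hxy
    · rw [abs_sub_comm x y, abs_of_nonneg (sub_nonneg.2 hxy)]
      exact hK' x y hxy
    · rw [abs_of_nonneg (sub_nonneg.2 hxy), abs_sub_comm]
      exact hK' y x hxy
  have ht' : 0 < t.toNNReal := Real.toNNReal_pos.2 ht
  -- The image contains (0, 1), so 1 ≤ dim(image) ≤ dim(limit set) / t.
  have h1 := hH.dimH_image_le ht' (limitSet f a b)
  have h2 : (1 : ℝ≥0∞) ≤ dimH (T '' limitSet f a b) := by
    refine le_trans ?_ (dimH_mono (h.Ioo_subset_image_limitSet hT (hH.continuous ht')))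
    rw [Real.dimH_of_nonempty_interior]
    · simp
    · rw [interior_Ioo]
      exact Set.nonempty_Ioo.2 one_pos
  have h3 := h2.trans h1
  rw [ENNReal.le_div_iff_mul_le (Or.inl (by simpa using ht)) (Or.inl ENNReal.coe_ne_top),
    one_mul] at h3
  exact h3

omit h in
lemma sum_prod_ofFn {P : ι → ℝ} (hP1 : ∑ i, P i = 1) (n : ℕ) :
    ∑ v : Fin n → ι, ((List.ofFn v).map P).prod = 1 := by
  have := Fintype.sum_pow P n
  rw [hP1, one_pow] at this
  rw [this]
  refine Finset.sum_congr rfl fun v _ => ?_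
  rw [List.map_ofFn, List.prod_ofFn]
  rfl

/-- If the weights of the words dominate the `t`-th powers of the lengths of the cylinders, then
the limit set has dimension at most `t`. -/
theorem dimH_limitSet_le {P : ι → ℝ} (hP1 : ∑ i, P i = 1) {K t : ℝ} (ht : 0 ≤ t)
    (hK : ∀ w : List ι, cylLen g a b w ^ t ≤ K * (w.map P).prod) :
    dimH (limitSet f a b) ≤ ENNReal.ofReal t := by
  have hlam := h.one_lt
  have hfin : μH[t] (limitSet f a b) ≤ ENNReal.ofReal K := by
    -- Cover by all cylinders of level n: their lengths tend uniformly to 0, and the t-th powers sum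
    -- to at most K because the word weights of each level sum to 1.
    refine (Measure.hausdorffMeasure_le_liminf_sum (l := atTop) (ι := fun n => Fin n → ι) t _
      (fun n => ENNReal.ofReal ((b - a) / lam ^ n)) ?_
      (fun n v => Set.Icc (wordInv g (List.ofFn v) a) (wordInv g (List.ofFn v) b))
      (Eventually.of_forall fun n v => ?_) (Eventually.of_forall fun n x hx => ?_)).trans ?_
    · rw [← ENNReal.ofReal_zero]
      refine ENNReal.tendsto_ofReal ?_
      exact tendsto_const_nhds.div_atTop (tendsto_pow_atTop_atTop_of_one_lt hlam)
    · rw [Real.ediam_Icc]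
      refine ENNReal.ofReal_le_ofReal ?_
      simpa [cylLen] using h.cylLen_le (List.ofFn v)
    · obtain ⟨w, rfl, hw⟩ := h.mem_cylinder_of_mem_limitSet hx n
      exact Set.mem_iUnion.2 ⟨w.get, by rwa [List.ofFn_get]⟩
    · have hbound : ∀ n : ℕ, ∑ v : Fin n → ι,
          Metric.ediam (Set.Icc (wordInv g (List.ofFn v) a) (wordInv g (List.ofFn v) b)) ^ t ≤
          ENNReal.ofReal K := by
        intro n
        have e : ∀ v : Fin n → ι,
            Metric.ediam (Set.Icc (wordInv g (List.ofFn v) a) (wordInv g (List.ofFn v) b)) ^ t =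
            ENNReal.ofReal (cylLen g a b (List.ofFn v) ^ t) := by
          intro v
          rw [Real.ediam_Icc, ENNReal.ofReal_rpow_of_nonneg _ ht]
          · rfl
          · exact (h.cylLen_pos _).le
        simp only [e]
        rw [← ENNReal.ofReal_sum_of_nonneg fun v _ => Real.rpow_nonneg (h.cylLen_pos _).le _]
        refine ENNReal.ofReal_le_ofReal ?_
        calc ∑ v : Fin n → ι, cylLen g a b (List.ofFn v) ^ t
            ≤ ∑ v : Fin n → ι, K * ((List.ofFn v).map P).prod :=
              Finset.sum_le_sum fun v _ => hK _
          _ = K := by rw [← Finset.mul_sum, sum_prod_ofFn hP1, mul_one]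
      exact (liminf_le_liminf (Eventually.of_forall hbound)).trans_eq (liminf_const _)
  have := dimH_le_of_hausdorffMeasure_ne_top (d := t.toNNReal) (s := limitSet f a b)
    (by rw [Real.coe_toNNReal _ ht]; exact ne_top_of_le_ne_top ENNReal.ofReal_ne_top hfin)
  exact this

end ExpandingFamily

/-! ### Iterated families -/

namespace ExpandingFamily

variable {f g : ι → ℝ → ℝ} {a b lam : ℝ} (h : ExpandingFamily f g a b lam)
include h

lemma wordMap_disj {u v : List ι} (huv : u.length = v.length) {x : ℝ}
    (hu : wordMap f u x ∈ Set.Ioo a b) (hv : wordMap f v x ∈ Set.Ioo a b) : u = v := by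
  induction u generalizing v x with
  | nil => exact (List.length_eq_zero_iff.1 huv.symm).symm
  | cons i u ih =>
    cases v with
    | nil => simp at huv
    | cons j v =>
      have hij : i = j := by
        by_contra hij
        exact h.disj i j hij x (h.mem_of_wordMap_mem_Ioo u hu) (h.mem_of_wordMap_mem_Ioo v hv)
      subst hij
      rw [ih (by simpa using huv) hu hv]

/-- The family of all `ℓ`-fold compositions. -/
theorem iterate {l : ℕ} (hl : l ≠ 0) :
    ExpandingFamily (fun v : Fin l → ι => wordMap f (List.ofFn v))
      (fun v => wordInv g (List.ofFn v)) a b (lam ^ l) where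
  lt := h.lt
  one_lt := one_lt_pow₀ h.one_lt hl
  continuous v := h.continuous_wordMap _
  expand v x y hxy := by simpa using h.wordMap_expand (List.ofFn v) hxy
  right_inv v z := h.wordMap_wordInv _ z
  left_le v := by
    have := (h.strictMono_wordMap (List.ofFn v)).monotone (h.wordInv_mem (List.ofFn v) h.left_mem).1
    rwa [h.wordMap_wordInv] at this
  le_right v := by
    have := (h.strictMono_wordMap (List.ofFn v)).monotone (h.wordInv_mem (List.ofFn v) h.right_mem).2
    rwa [h.wordMap_wordInv] at this
  disj u v huv x hu hv := huv (List.ofFn_injective (h.wordMap_disj (by simp) hu hv))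

omit h in
lemma iter_wordMap {l : ℕ} (Ω : ℕ → Fin l → ι) (n : ℕ) (x : ℝ) :
    ∃ w : List ι, w.length = n * l ∧
      iter (fun v : Fin l → ι => wordMap f (List.ofFn v)) Ω n x = wordMap f w x := by
  induction n with
  | zero => exact ⟨[], by simp, rfl⟩
  | succ n ih =>
    obtain ⟨w, hw, hx⟩ := ih
    refine ⟨w ++ List.ofFn (Ω n), by simp [hw, add_mul], ?_⟩
    rw [wordMap_append, ← hx]
    rfl

/-- Escape times avoid unfolding a sequence of blocks into a sequence of letters: a point escaping
within N letters also escapes within N blocks, since a block has at least one letter. -/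
lemma limitSet_iterate_subset [Finite ι] [Nonempty ι] {l : ℕ} (hl : l ≠ 0) :
    limitSet (fun v : Fin l → ι => wordMap f (List.ofFn v)) a b ⊆ limitSet f a b := by
  rintro x ⟨Ω, hΩ⟩
  by_contra hx
  obtain ⟨N, hN⟩ := h.exists_escape_time hx
  obtain ⟨w, hw, hxw⟩ := iter_wordMap (f := f) Ω N x
  refine h.wordMap_notMem hN (w := w) ?_ (hxw ▸ hΩ N)
  rw [hw]
  exact Nat.le_mul_of_pos_right N (Nat.pos_of_ne_zero hl)

omit h in
lemma wordInv_iterate {l : ℕ} (ws : List (Fin l → ι)) (z : ℝ) :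
    wordInv (fun v => wordInv g (List.ofFn v)) ws z = wordInv g (ws.flatMap List.ofFn) z := by
  induction ws generalizing z with
  | nil => rfl
  | cons v ws ih => simp [wordInv, wordInv_append, ih]

end ExpandingFamily

end

section

/-! ### Smooth dependence of solutions of a functional equation on parameters -/

section TransferOperator

variable {X : Type*}

/-- The operator `h ↦ 1_{φ ∈ S} * (h ∘ φ)` on bounded functions. -/
def cutoffComp (φ : X → X) (S : Set X) : lp (fun _ : X => ℝ) ∞ →L[ℝ] lp (fun _ : X => ℝ) ∞ :=
  LinearMap.mkContinuous
    { toFun := fun u => ⟨fun x => S.indicator (fun y => (u : X → ℝ) y) (φ x), by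
        refine memℓp_infty ⟨‖u‖, ?_⟩
        rintro _ ⟨x, rfl⟩
        exact (norm_indicator_le_norm_self _ _).trans
          (lp.norm_apply_le_norm ENNReal.top_ne_zero u _)⟩
      map_add' := fun u v => by
        ext x
        change S.indicator (fun y => (u : X → ℝ) y + (v : X → ℝ) y) (φ x) = _
        rw [Set.indicator_add]
        rfl
      map_smul' := fun c u => by
        ext x
        by_cases hx : φ x ∈ S <;> simp [hx] }
    1 fun u => by
      rw [one_mul]
      refine lp.norm_le_of_forall_le (norm_nonneg _) fun x => ?_
      exact (norm_indicator_le_norm_self _ _).trans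
        (lp.norm_apply_le_norm ENNReal.top_ne_zero u _)

lemma cutoffComp_apply (φ : X → X) (S : Set X) (u : lp (fun _ : X => ℝ) ∞) (x : X) :
    (cutoffComp φ S u : X → ℝ) x = S.indicator (fun y => (u : X → ℝ) y) (φ x) := rfl

variable {ι : Type*} [Fintype ι] {E : Type*} [NormedAddCommGroup E] [NormedSpace ℝ E]

/-- At each x at most one summand is non-zero, so the norm is bounded by the maximum of the
coefficients and not by their sum. For probability weights the sum is 1 and would give no
contraction. -/
lemma norm_sum_cutoffComp_le {φ : ι → X → X} {S : Set X}
    (hS : ∀ i j x, φ i x ∈ S → φ j x ∈ S → i = j) {c : ι → ℝ} {θ : ℝ} (hθ : 0 ≤ θ)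
    (hc : ∀ i, |c i| ≤ θ) : ‖∑ i, c i • cutoffComp (φ i) S‖ ≤ θ := by
  refine ContinuousLinearMap.opNorm_le_bound _ hθ fun u => ?_
  refine lp.norm_le_of_forall_le (by positivity) fun x => ?_
  have e : ((∑ i, c i • cutoffComp (φ i) S) u : X → ℝ) x =
      ∑ i, c i * S.indicator (fun y => (u : X → ℝ) y) (φ i x) := by
    simp only [_root_.sum_apply, _root_.smul_apply, lp.coeFn_sum,
      Finset.sum_apply, lp.coeFn_smul, Pi.smul_apply, smul_eq_mul, cutoffComp_apply]
  rw [e]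
  by_cases hx : ∃ i, φ i x ∈ S
  · obtain ⟨i, hi⟩ := hx
    rw [Finset.sum_eq_single_of_mem i (Finset.mem_univ _), norm_mul]
    · exact mul_le_mul (hc i) ((norm_indicator_le_norm_self _ _).trans
        (lp.norm_apply_le_norm ENNReal.top_ne_zero u _)) (norm_nonneg _) hθ
    · intro j _ hj
      rw [Set.indicator_of_notMem fun hc => hj (hS _ _ _ hc hi), mul_zero]
  · push Not at hx
    rw [Finset.sum_eq_zero fun i _ => by rw [Set.indicator_of_notMem (hx i), mul_zero]]
    simpa using mul_nonneg hθ (norm_nonneg u)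

/-- A bounded solution of `h_u = ∑ i, c_i(u) * (e_i + 1_{φ_i ∈ S} * h_u ∘ φ_i)`
depends smoothly on the parameter `u`, as an element of the space of bounded functions. -/
theorem exists_contDiffAt_solution {φ : ι → X → X} {S : Set X}
    (hS : ∀ i j x, φ i x ∈ S → φ j x ∈ S → i = j) {c : E → ι → ℝ} {p : E}
    (hc : ∀ i, ContDiffAt ℝ (⊤ : ℕ∞) (fun u => c u i) p) {θ : ℝ} (hθ : 0 ≤ θ) (hθ1 : θ < 1)
    (hcp : ∀ i, |c p i| ≤ θ) (e : ι → lp (fun _ : X => ℝ) ∞) {h : E → X → ℝ}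
    (hb : ∀ᶠ u in 𝓝 p, ∀ x, |h u x| ≤ 1)
    (heq : ∀ᶠ u in 𝓝 p, ∀ x,
      h u x = ∑ i, c u i * ((e i : X → ℝ) x + S.indicator (h u) (φ i x))) :
    ∃ H : E → lp (fun _ : X => ℝ) ∞, ContDiffAt ℝ (⊤ : ℕ∞) H p ∧
      ∀ᶠ u in 𝓝 p, ∀ x, (H u : X → ℝ) x = h u x := by
  set M : E → lp (fun _ : X => ℝ) ∞ →L[ℝ] lp (fun _ : X => ℝ) ∞ :=
    fun u => ∑ i, c u i • cutoffComp (φ i) S with hM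
  have hMs : ContDiffAt ℝ (⊤ : ℕ∞) M p :=
    ContDiffAt.sum fun i _ => (hc i).smul contDiffAt_const
  have hes : ContDiffAt ℝ (⊤ : ℕ∞) (fun u => ∑ i, c u i • e i) p :=
    ContDiffAt.sum fun i _ => (hc i).smul contDiffAt_const
  -- The solution is the inverse of 1 - M applied to the inhomogeneous term; inversion is smooth on
  -- the units of a Banach algebra.
  have hunit : IsUnit (1 - M p) :=
    isUnit_one_sub_of_norm_lt_one ((norm_sum_cutoffComp_le hS hθ hcp).trans_lt hθ1)
  have hsub : ContDiffAt ℝ (⊤ : ℕ∞) (fun u => 1 - M u) p := contDiffAt_const.sub hMs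
  have hinv : ContDiffAt ℝ (⊤ : ℕ∞) (fun u => Ring.inverse (1 - M u)) p := by
    refine ContDiffAt.comp (g := Ring.inverse) p ?_ hsub
    obtain ⟨v, hv⟩ := hunit
    rw [← hv]
    exact contDiffAt_ringInverse ℝ v
  refine ⟨fun u => Ring.inverse (1 - M u) (∑ i, c u i • e i), hinv.clm_apply hes, ?_⟩
  have hnear : ∀ᶠ u in 𝓝 p, IsUnit (1 - M u) :=
    hsub.continuousAt.eventually (Units.isOpen.mem_nhds hunit)
  filter_upwards [hnear, hb, heq] with u hu hbu hequ x
  -- Being bounded, `h u` is itself an element of the space and solves the same equation, so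
  -- invertibility identifies it with the constructed solution.
  set t : lp (fun _ : X => ℝ) ∞ := ⟨h u, memℓp_infty ⟨1, by
    rintro _ ⟨y, rfl⟩
    exact hbu y⟩⟩ with ht
  have h1 : (1 - M u) t = ∑ i, c u i • e i := by
    rw [_root_.sub_apply, sub_eq_iff_eq_add]
    ext y
    simp only [hM, one_apply_eq_self, _root_.sum_apply,
      _root_.smul_apply, lp.coeFn_add, lp.coeFn_sum, Pi.add_apply,
      Finset.sum_apply, lp.coeFn_smul, Pi.smul_apply, smul_eq_mul, cutoffComp_apply]
    rw [← Finset.sum_add_distrib]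
    simp only [← mul_add]
    exact hequ y
  have h2 : Ring.inverse (1 - M u) (∑ i, c u i • e i) = t := by
    rw [← h1, ← mul_apply_eq_comp, Ring.inverse_mul_cancel _ hu,
      one_apply_eq_self]
  rw [h2]

end TransferOperator

/-! ### Jets -/

section Jets

variable {E : Type*} [NormedAddCommGroup E] [NormedSpace ℝ E]

/-- A submultiplicative norm on the jets of order `n` at `p`. -/
def jetNorm (ρ : ℝ) (n : ℕ) (p : E) (F : E → ℝ) : ℝ :=
  ∑ k ∈ Finset.range (n + 1), ρ ^ k / k.factorial * ‖iteratedFDeriv ℝ k F p‖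

variable {ρ : ℝ} {n : ℕ} {p : E} {F G : E → ℝ}

lemma jetNorm_nonneg (hρ : 0 ≤ ρ) : 0 ≤ jetNorm ρ n p F :=
  Finset.sum_nonneg fun _ _ => by positivity

lemma jetNorm_congr (h : F =ᶠ[𝓝 p] G) : jetNorm ρ n p F = jetNorm ρ n p G := by
  unfold jetNorm
  refine Finset.sum_congr rfl fun k _ => ?_
  rw [(h.iteratedFDeriv ℝ k).eq_of_nhds]

lemma jetNorm_zero : jetNorm ρ n p (fun _ => 0) = 0 := by
  unfold jetNorm
  refine Finset.sum_eq_zero fun k _ => ?_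
  rw [iteratedFDeriv_fun_zero]
  simp

lemma jetNorm_sub_comm : jetNorm ρ n p (fun u => F u - G u) = jetNorm ρ n p fun u => G u - F u := by
  unfold jetNorm
  refine Finset.sum_congr rfl fun k _ => ?_
  have : (fun u => F u - G u) = -(fun u => G u - F u) := by
    ext u
    simp
  rw [this, iteratedFDeriv_neg_apply, norm_neg]

lemma ContDiffAt.of_infty_nat (hF : ContDiffAt ℝ (⊤ : ℕ∞) F p) (k : ℕ) : ContDiffAt ℝ k F p :=
  hF.of_le (by exact_mod_cast le_top)

lemma jetNorm_sub_le (hρ : 0 ≤ ρ) (hF : ContDiffAt ℝ (⊤ : ℕ∞) F p)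
    (hG : ContDiffAt ℝ (⊤ : ℕ∞) G p) :
    jetNorm ρ n p (fun u => F u - G u) ≤ jetNorm ρ n p F + jetNorm ρ n p G := by
  unfold jetNorm
  rw [← Finset.sum_add_distrib]
  refine Finset.sum_le_sum fun k _ => ?_
  rw [← mul_add]
  refine mul_le_mul_of_nonneg_left ?_ (by positivity)
  change ‖iteratedFDeriv ℝ k (F - G) p‖ ≤ _
  rw [iteratedFDeriv_sub_apply (ContDiffAt.of_infty_nat hF k) (ContDiffAt.of_infty_nat hG k)]
  exact norm_sub_le _ _

lemma jetNorm_sum_le {ι : Type*} (s : Finset ι) (hρ : 0 ≤ ρ) {F : ι → E → ℝ}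
    (hF : ∀ i ∈ s, ContDiffAt ℝ (⊤ : ℕ∞) (F i) p) :
    jetNorm ρ n p (fun u => ∑ i ∈ s, F i u) ≤ ∑ i ∈ s, jetNorm ρ n p (F i) := by
  unfold jetNorm
  rw [Finset.sum_comm]
  refine Finset.sum_le_sum fun k _ => ?_
  rw [← Finset.mul_sum]
  refine mul_le_mul_of_nonneg_left ?_ (by positivity)
  rw [iteratedFDeriv_fun_sum_apply fun i hi => ContDiffAt.of_infty_nat (hF i hi) k]
  exact norm_sum_le _ _

lemma norm_iteratedFDeriv_mul_le_of_contDiffAt (hF : ContDiffAt ℝ (⊤ : ℕ∞) F p)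
    (hG : ContDiffAt ℝ (⊤ : ℕ∞) G p) (k : ℕ) :
    ‖iteratedFDeriv ℝ k (fun u => F u * G u) p‖ ≤ ∑ i ∈ Finset.range (k + 1),
      (k.choose i : ℝ) * ‖iteratedFDeriv ℝ i F p‖ * ‖iteratedFDeriv ℝ (k - i) G p‖ := by
  obtain ⟨u, hu, hFu⟩ := (ContDiffAt.of_infty_nat hF k).contDiffOn (m := k) le_rfl (by simp)
  obtain ⟨v, hv, hGv⟩ := (ContDiffAt.of_infty_nat hG k).contDiffOn (m := k) le_rfl (by simp)
  obtain ⟨s, hs, hso, hps⟩ := mem_nhds_iff.1 (inter_mem hu hv)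
  have h := norm_iteratedFDerivWithin_mul_le (hFu.mono fun x hx => (hs hx).1)
    (hGv.mono fun x hx => (hs hx).2) hso.uniqueDiffOn hps (n := k) le_rfl
  simpa only [iteratedFDerivWithin_of_isOpen _ hso hps] using h

/-- The factors 1 / k! turn the Leibniz formula into a Cauchy product; the terms of total order at
most n form part of the full product of the two sums. -/
lemma jetNorm_mul_le (hρ : 0 ≤ ρ) (hF : ContDiffAt ℝ (⊤ : ℕ∞) F p)
    (hG : ContDiffAt ℝ (⊤ : ℕ∞) G p) :
    jetNorm ρ n p (fun u => F u * G u) ≤ jetNorm ρ n p F * jetNorm ρ n p G := by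
  set A : ℕ → ℝ := fun i => ρ ^ i / i.factorial * ‖iteratedFDeriv ℝ i F p‖ with hA
  set B : ℕ → ℝ := fun i => ρ ^ i / i.factorial * ‖iteratedFDeriv ℝ i G p‖ with hB
  have hA0 : ∀ i, 0 ≤ A i := fun i => by positivity
  have hB0 : ∀ i, 0 ≤ B i := fun i => by positivity
  have h1 : ∀ k, ρ ^ k / k.factorial * ‖iteratedFDeriv ℝ k (fun u => F u * G u) p‖ ≤
      ∑ q ∈ Finset.HasAntidiagonal.antidiagonal k, A q.1 * B q.2 := by
    intro k
    rw [Finset.Nat.sum_antidiagonal_eq_sum_range_succ (fun i j => A i * B j)]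
    refine (mul_le_mul_of_nonneg_left (norm_iteratedFDeriv_mul_le_of_contDiffAt hF hG k)
      (by positivity)).trans_eq ?_
    rw [Finset.mul_sum]
    refine Finset.sum_congr rfl fun i hi => ?_
    have hik : i ≤ k := Nat.lt_succ_iff.1 (Finset.mem_range.1 hi)
    have hfac : (k.factorial : ℝ) = k.choose i * i.factorial * (k - i).factorial := by
      exact_mod_cast (Nat.choose_mul_factorial_mul_factorial hik).symm
    have hpow : ρ ^ k = ρ ^ i * ρ ^ (k - i) := by rw [← pow_add, Nat.add_sub_cancel' hik]
    have hch : (k.choose i : ℝ) ≠ 0 := by exact_mod_cast (Nat.choose_pos hik).ne'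
    simp only [hA, hB]
    rw [hfac, hpow]
    have hi0 : (i.factorial : ℝ) ≠ 0 := by positivity
    have hki0 : ((k - i).factorial : ℝ) ≠ 0 := by positivity
    field_simp
  calc jetNorm ρ n p (fun u => F u * G u)
      ≤ ∑ k ∈ Finset.range (n + 1), ∑ q ∈ Finset.HasAntidiagonal.antidiagonal k, A q.1 * B q.2 :=
        Finset.sum_le_sum fun k _ => h1 k
    _ = ∑ q ∈ (Finset.range (n + 1)).biUnion Finset.HasAntidiagonal.antidiagonal, A q.1 * B q.2 := by
        rw [Finset.sum_biUnion]
        intro i _ j _ hij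
        rw [Function.onFun, Finset.disjoint_left]
        intro q hq hq'
        rw [Finset.HasAntidiagonal.mem_antidiagonal] at hq hq'
        exact hij (hq.symm.trans hq')
    _ ≤ ∑ q ∈ Finset.range (n + 1) ×ˢ Finset.range (n + 1), A q.1 * B q.2 := by
        refine Finset.sum_le_sum_of_subset_of_nonneg ?_ fun q _ _ => mul_nonneg (hA0 _) (hB0 _)
        intro q hq
        simp only [Finset.mem_biUnion, Finset.mem_range, Finset.HasAntidiagonal.mem_antidiagonal,
          Finset.mem_product] at hq ⊢
        obtain ⟨k, hk, hq⟩ := hq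
        omega
    _ = jetNorm ρ n p F * jetNorm ρ n p G := by
        rw [Finset.sum_product, jetNorm, jetNorm, Finset.sum_mul_sum]

/-- For small `ρ` the jet norm is close to the absolute value at the point. -/
lemma eventually_jetNorm_lt (n : ℕ) {c : ℝ} (hc : |F p| < c) :
    ∀ᶠ ρ in 𝓝 (0 : ℝ), jetNorm ρ n p F < c := by
  have hcont : Continuous fun ρ : ℝ => jetNorm ρ n p F := by
    unfold jetNorm
    fun_prop
  have h0 : jetNorm 0 n p F = |F p| := by
    unfold jetNorm
    rw [Finset.sum_eq_single_of_mem 0 (by simp)]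
    · simp
    · intro k _ hk
      simp [hk]
  exact hcont.continuousAt.eventually (gt_mem_nhds (by simpa only [h0] using hc))

lemma norm_iteratedFDeriv_le_jetNorm (hρ : 0 < ρ) :
    ‖iteratedFDeriv ℝ n F p‖ ≤ n.factorial / ρ ^ n * jetNorm ρ n p F := by
  have h1 : ρ ^ n / n.factorial * ‖iteratedFDeriv ℝ n F p‖ ≤ jetNorm ρ n p F :=
    Finset.single_le_sum (f := fun k => ρ ^ k / k.factorial * ‖iteratedFDeriv ℝ k F p‖)
      (fun k _ => by positivity) (Finset.self_mem_range_succ n)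
  calc ‖iteratedFDeriv ℝ n F p‖
      = n.factorial / ρ ^ n * (ρ ^ n / n.factorial * ‖iteratedFDeriv ℝ n F p‖) := by
        field_simp
    _ ≤ _ := mul_le_mul_of_nonneg_left h1 (by positivity)

end Jets

end

section

variable {s : ℕ} {f g : Fin (s + 1) → ℝ → ℝ} {a b lam : ℝ}

/-! ### The expanding family of an admissible system -/

lemma IsAdmissible.exists_expandingFamily {d : EReal → EReal → ℝ} (hf : IsAdmissible d f)
    (hosc : OpenSetCondition f) : ∃ (g : Fin (s + 1) → ℝ → ℝ) (a b lam : ℝ),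
      ExpandingFamily f g a b lam ∧ ∀ i x, lam ≤ deriv (f i) x := by
  obtain ⟨a, b, hab, hsub, hdisj⟩ := hosc
  obtain ⟨lam, hlam, hderiv⟩ := hf.expanding
  have hdiff : ∀ i, Differentiable ℝ (f i) := fun i => (hf.contDiff i).differentiable (by simp)
  have hexp : ∀ i x y, x ≤ y → lam * (y - x) ≤ f i y - f i x := fun i x y hxy =>
    mul_sub_le_image_sub_of_le_deriv (hdiff i) (hderiv i) hxy
  have hmono : ∀ i, StrictMono (f i) := fun i x y hxy => by
    nlinarith [hexp i x y hxy.le]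
  have hsurj : ∀ i, Function.Surjective (f i) := by
    intro i
    refine (hdiff i).continuous.surjective ?_ ?_
    · refine tendsto_atTop_mono' _ ?_ (tendsto_atTop_add_const_right atTop (f i 0) tendsto_id)
      filter_upwards [eventually_ge_atTop 0] with x hx
      have := hexp i 0 x hx
      simp only [id]
      nlinarith
    · refine tendsto_atBot_mono' _ ?_ (tendsto_atBot_add_const_right atBot (f i 0) tendsto_id)
      filter_upwards [eventually_le_atBot 0] with x hx
      have := hexp i x 0 hx
      simp only [id]
      nlinarith
  have hinv : ∀ i z, f i (Function.surjInv (hsurj i) z) = z := fun i z =>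
    Function.surjInv_eq (hsurj i) z
  have hpre : ∀ i, Set.Ioo (Function.surjInv (hsurj i) a) (Function.surjInv (hsurj i) b) ⊆
      Set.Ioo a b := by
    intro i x hx
    refine hsub i ⟨?_, ?_⟩
    · rw [← hinv i a]
      exact hmono i hx.1
    · rw [← hinv i b]
      exact hmono i hx.2
  have hlt : ∀ i, Function.surjInv (hsurj i) a < Function.surjInv (hsurj i) b := fun i => by
    rwa [← (hmono i).lt_iff_lt, hinv, hinv]
  -- Inclusion of the non-empty open preimage in (a, b) is equivalent to a ≤ g_i a and g_i b ≤ b.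
  have hend := fun i => (Set.Ioo_subset_Ioo_iff (hlt i)).1 (hpre i)
  refine ⟨fun i => Function.surjInv (hsurj i), a, b, lam, ⟨hab, hlam, fun i => (hdiff i).continuous,
    hexp, hinv, fun i => ?_, fun i => ?_, fun i j hij x hx hx' =>
      Set.disjoint_left.1 (hdisj i j hij) hx hx'⟩, hderiv⟩
  · simpa [hinv] using (hmono i).monotone (hend i).1
  · simpa [hinv] using (hmono i).monotone (hend i).2

/-! ### The coding map -/

namespace ExpandingFamily

variable (h : ExpandingFamily f g a b lam)
include h

lemma iter_expand (ω : ℕ → Fin (s + 1)) (n : ℕ) {x y : ℝ} (hxy : x ≤ y) :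
    lam ^ n * (y - x) ≤ iter f ω n y - iter f ω n x := by
  rw [iter_eq_wordMap, iter_eq_wordMap]
  simpa [length_prefixWord] using h.wordMap_expand (prefixWord ω n) hxy

lemma not_bounded_of_lt (ω : ℕ → Fin (s + 1)) {x : ℝ} (hx : b < x) (R : ℝ) :
    ∃ n, R < iter f ω n x :=
  ((h.tendsto_iter_right ω hx).eventually_gt_atTop R).exists

lemma not_bounded_of_gt (ω : ℕ → Fin (s + 1)) {x : ℝ} (hx : x < a) (R : ℝ) :
    ∃ n, iter f ω n x < R := by
  have h1 : Tendsto (fun n : ℕ => lam ^ n * (a - x) + -a) atTop atTop :=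
    tendsto_atTop_add_const_right _ _
      ((tendsto_pow_atTop_atTop_of_one_lt h.one_lt).atTop_mul_const (sub_pos.2 hx))
  obtain ⟨n, hn⟩ := (h1.eventually_gt_atTop (-R)).exists
  exact ⟨n, by linarith [h.iter_left ω n hx.le]⟩

lemma mem_Icc_of_mem_fiberJulia {ω : ℕ → Fin (s + 1)} {x : ℝ} (hx : x ∈ fiberJulia f ω) :
    x ∈ Set.Icc a b := by
  obtain ⟨R, hR⟩ := hx
  refine ⟨le_of_not_gt fun hc => ?_, le_of_not_gt fun hc => ?_⟩
  · obtain ⟨n, hn⟩ := h.not_bounded_of_gt ω hc (-R)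
    linarith [(abs_le.1 (hR n)).1]
  · obtain ⟨n, hn⟩ := h.not_bounded_of_lt ω hc R
    linarith [(abs_le.1 (hR n)).2]

omit h in
lemma map_mem_fiberJulia {ω : ℕ → Fin (s + 1)} {x : ℝ} (hx : x ∈ fiberJulia f ω) :
    f (ω 0) x ∈ fiberJulia f (shift ω) := by
  obtain ⟨R, hR⟩ := hx
  exact ⟨R, fun n => by rw [← iter_succ']; exact hR (n + 1)⟩

lemma iter_mem_of_mem_fiberJulia {ω : ℕ → Fin (s + 1)} {x : ℝ} (hx : x ∈ fiberJulia f ω)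
    (n : ℕ) : iter f ω n x ∈ Set.Icc a b := by
  induction n generalizing ω x with
  | zero => exact h.mem_Icc_of_mem_fiberJulia hx
  | succ n ih =>
    rw [iter_succ']
    exact ih (map_mem_fiberJulia hx)

/-- Outside [a, b] the distance to the interval grows geometrically, so boundedness of an orbit
already confines it to [a, b]. -/
lemma mem_fiberJulia_iff {ω : ℕ → Fin (s + 1)} {x : ℝ} :
    x ∈ fiberJulia f ω ↔ ∀ n, iter f ω n x ∈ Set.Icc a b := by
  refine ⟨fun hx n => h.iter_mem_of_mem_fiberJulia hx n, fun hx => ⟨max |a| |b|, fun n => ?_⟩⟩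
  exact abs_le_max_abs_abs (hx n).1 (hx n).2

lemma fiberJulia_nonempty (ω : ℕ → Fin (s + 1)) : (fiberJulia f ω).Nonempty := by
  have hcont : ∀ n, Continuous (iter f ω n) := fun n =>
    (h.continuous_wordMap (prefixWord ω n)).congr fun x => (iter_eq_wordMap f ω n x).symm
  obtain ⟨x, hx⟩ := IsCompact.nonempty_iInter_of_sequence_nonempty_isCompact_isClosed
    (fun n => {x : ℝ | iter f ω n x ∈ Set.Icc a b})
    (fun n x hx => h.mem_of_map_mem (ω n) hx)
    (fun n => ⟨wordInv g (prefixWord ω n) a, by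
      rw [Set.mem_ofPred_eq, iter_eq_wordMap, h.wordMap_wordInv]
      exact h.left_mem⟩)
    isCompact_Icc
    (fun n => isClosed_Icc.preimage (hcont n))
  exact ⟨x, h.mem_fiberJulia_iff.2 fun n => Set.mem_iInter.1 hx n⟩

/-- Existence of a bounded orbit suffices for this choice; the distortion estimate only uses that
the chosen point lies in the cylinders of ω. -/
lemma codingMap_mem (ω : ℕ → Fin (s + 1)) : codingMap f ω ∈ fiberJulia f ω :=
  Classical.epsilon_spec (p := fun x => x ∈ fiberJulia f ω) (h.fiberJulia_nonempty ω)

lemma codingMap_mem_cylinder (ω : ℕ → Fin (s + 1)) (n : ℕ) :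
    codingMap f ω ∈ Set.Icc (wordInv g (prefixWord ω n) a) (wordInv g (prefixWord ω n) b) := by
  have h1 := h.iter_mem_of_mem_fiberJulia (h.codingMap_mem ω) n
  rw [iter_eq_wordMap] at h1
  have hm := (h.strictMono_wordInv (prefixWord ω n)).monotone
  have h2 := hm h1.1
  have h3 := hm h1.2
  rw [h.wordInv_wordMap] at h2 h3
  exact ⟨h2, h3⟩

lemma mem_limitSet_iff {x : ℝ} : x ∈ limitSet f a b ↔ ∃ ω, x ∈ fiberJulia f ω := by
  simp only [limitSet, Set.mem_ofPred_eq, h.mem_fiberJulia_iff]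

end ExpandingFamily

/-! ### Words and sequences -/

lemma getElem_prefixWord {ι : Type*} (ω : ℕ → ι) (n k : ℕ) (hk : k < (prefixWord ω n).length) :
    (prefixWord ω n)[k] = ω k := by
  induction n generalizing ω k with
  | zero => simp [prefixWord] at hk
  | succ n ih =>
    cases k with
    | zero => rfl
    | succ k => simpa [prefixWord, shift] using ih (shift ω) k (by simpa [prefixWord] using hk)

lemma prefixWord_add {ι : Type*} (ω : ℕ → ι) (m n : ℕ) :
    prefixWord ω (m + n) = prefixWord ω m ++ prefixWord (shift^[m] ω) n := by
  induction m generalizing ω with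
  | zero => simp [prefixWord]
  | succ m ih => simp [Nat.succ_add, prefixWord, ih]

lemma shift_iterate {ι : Type*} (ω : ℕ → ι) (m k : ℕ) : shift^[m] ω k = ω (k + m) := by
  induction m generalizing ω with
  | zero => rfl
  | succ m ih => rw [Function.iterate_succ_apply, ih]; simp [shift, add_assoc]

/-- The periodic continuation of a non-empty word. -/
lemma exists_periodic {ι : Type*} {w : List ι} (hw : w ≠ []) :
    ∃ ω : ℕ → ι, prefixWord ω w.length = w ∧ shift^[w.length] ω = ω := by
  have hpos : 0 < w.length := List.length_pos_iff.2 hw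
  refine ⟨fun n => w[n % w.length]'(Nat.mod_lt _ hpos), ?_, ?_⟩
  · refine List.ext_getElem (length_prefixWord _ _) fun k hk hk' => ?_
    rw [getElem_prefixWord]
    simp only [Nat.mod_eq_of_lt hk']
  · funext k
    rw [shift_iterate]
    simp

lemma exists_prefixWord_eq {ι : Type*} [Nonempty ι] (w : List ι) :
    ∃ ω : ℕ → ι, prefixWord ω w.length = w := by
  cases w with
  | nil => exact ⟨fun _ => Classical.arbitrary ι, rfl⟩
  | cons i w =>
    obtain ⟨ω, hω, -⟩ := exists_periodic (w := i :: w) (by simp)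
    exact ⟨ω, hω⟩

lemma birkhoffSum_periodic {X : Type*} (T : X → X) (u : X → ℝ) {x : X} {n : ℕ}
    (hx : T^[n] x = x) (k : ℕ) : birkhoffSum T u (k * n) x = k * birkhoffSum T u n x := by
  induction k with
  | zero => simp
  | succ k ih =>
    have hk : T^[k * n] x = x := by
      rw [mul_comm, Function.iterate_mul]
      exact Function.iterate_fixed hx k
    rw [add_mul, one_mul, birkhoffSum_add, ih, hk]
    push_cast
    ring

/-! ### Bounded distortion -/

lemma abs_log_sub_log_le {x y : ℝ} (hx : 1 ≤ x) (hy : 1 ≤ y) :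
    |Real.log x - Real.log y| ≤ |x - y| := by
  have key : ∀ {x y : ℝ}, 1 ≤ x → 1 ≤ y → Real.log x - Real.log y ≤ |x - y| := by
    intro x y hx hy
    have hx0 : 0 < x := by linarith
    have hy0 : 0 < y := by linarith
    rw [← Real.log_div hx0.ne' hy0.ne']
    refine (Real.log_le_sub_one_of_pos (div_pos hx0 hy0)).trans ?_
    rw [div_sub_one hy0.ne', div_le_iff₀ hy0]
    nlinarith [le_abs_self (x - y), abs_nonneg (x - y)]
  rw [abs_le]
  refine ⟨?_, key hx hy⟩
  have := key hy hx
  rw [abs_sub_comm] at this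
  linarith

namespace ExpandingFamily

variable (h : ExpandingFamily f g a b lam)
include h

/-- By the mean value theorem the ratio of the two lengths is f_i' at a point ξ of the cylinder. The
logarithm is 1-Lipschitz on [1, ∞), and x and ξ are within the length of the cylinder, so Hölder
continuity of f_i' bounds the error. -/
lemma log_cylLen_cons {ε C : ℝ≥0} {i : Fin (s + 1)} (hdiff : Differentiable ℝ (f i))
    (hderiv : ∀ x, lam ≤ deriv (f i) x) (hC : HolderWith C ε (deriv (f i)))
    (w : List (Fin (s + 1))) {x : ℝ}
    (hx : x ∈ Set.Icc (wordInv g (i :: w) a) (wordInv g (i :: w) b)) :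
    |Real.log (cylLen g a b (i :: w)) + Real.log (deriv (f i) x) - Real.log (cylLen g a b w)| ≤
      C * cylLen g a b (i :: w) ^ (ε : ℝ) := by
  have hlt := h.strictMono_wordInv (i :: w) h.lt
  obtain ⟨ξ, hξ, hslope⟩ := exists_deriv_eq_slope (f i) hlt (hdiff.continuous.continuousOn)
    hdiff.differentiableOn
  have e : f i (wordInv g (i :: w) b) - f i (wordInv g (i :: w) a) = cylLen g a b w := by
    simp [wordInv, h.right_inv, cylLen]
  rw [e] at hslope
  have hL := h.cylLen_pos (i :: w)
  have hLw := h.cylLen_pos w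
  have hslope' : deriv (f i) ξ = cylLen g a b w / cylLen g a b (i :: w) := hslope
  have hlog : Real.log (deriv (f i) ξ) =
      Real.log (cylLen g a b w) - Real.log (cylLen g a b (i :: w)) := by
    rw [hslope', Real.log_div hLw.ne' hL.ne']
  have h1 := abs_log_sub_log_le (h.one_lt.le.trans (hderiv x)) (h.one_lt.le.trans (hderiv ξ))
  have h2 := hC.dist_le x ξ
  have h3 : dist x ξ ≤ cylLen g a b (i :: w) := by
    rw [Real.dist_eq]
    have e1 := hx.1
    have e2 := hx.2
    have e3 := hξ.1
    have e4 := hξ.2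
    unfold cylLen
    exact abs_sub_le_iff.2 ⟨by linarith, by linarith⟩
  calc _ = |Real.log (deriv (f i) x) - Real.log (deriv (f i) ξ)| := by
        rw [hlog]
        congr 1
        ring
    _ ≤ |deriv (f i) x - deriv (f i) ξ| := h1
    _ ≤ C * dist x ξ ^ (ε : ℝ) := h2
    _ ≤ _ := mul_le_mul_of_nonneg_left
        (Real.rpow_le_rpow dist_nonneg h3 ε.coe_nonneg) C.coe_nonneg

/-- **Bounded distortion.** The length of the `n`-cylinder of `ω` is comparable to
`exp (S_n φ ω)`. -/
theorem exists_distortion (hdiff : ∀ i, Differentiable ℝ (f i))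
    (hderiv : ∀ i x, lam ≤ deriv (f i) x) {ε : ℝ≥0} (hε : 0 < ε)
    (hH : ∀ i, ∃ C : ℝ≥0, HolderWith C ε (deriv (f i))) :
    ∃ D : ℝ, ∀ (ω : ℕ → Fin (s + 1)) (n : ℕ),
      |Real.log (cylLen g a b (prefixWord ω n)) - birkhoffSum shift (potPhi f) n ω| ≤ D := by
  choose C hC using hH
  obtain ⟨i₀, hi₀⟩ := Finite.exists_max C
  have hlam0 : 0 < lam := by linarith [h.one_lt]
  have hε' : (0 : ℝ) < ε := hε
  -- The lengths decay like λ^(-n), so the errors at successive levels are dominated by a geometric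
  -- series of ratio λ^(-ε).
  set τ : ℝ := (lam ^ (ε : ℝ))⁻¹ with hτ
  have hτ0 : 0 < τ := inv_pos.2 (Real.rpow_pos_of_pos hlam0 _)
  have hτ1 : τ < 1 := inv_lt_one_of_one_lt₀ (Real.one_lt_rpow h.one_lt hε')
  set A : ℝ := C i₀ * (b - a) ^ (ε : ℝ) with hA
  have hba : 0 < b - a := sub_pos.2 h.lt
  have hA0 : 0 ≤ A := mul_nonneg (C i₀).coe_nonneg (Real.rpow_nonneg hba.le _)
  have key : ∀ (n : ℕ) (ω : ℕ → Fin (s + 1)),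
      |Real.log (cylLen g a b (prefixWord ω n)) - birkhoffSum shift (potPhi f) n ω| ≤
        |Real.log (b - a)| + A * ∑ k ∈ Finset.range n, τ ^ k := by
    intro n
    induction n with
    | zero => intro ω; simp [prefixWord, cylLen, wordInv]
    | succ n ih =>
      intro ω
      have hx : codingMap f ω ∈ Set.Icc (wordInv g (ω 0 :: prefixWord (shift ω) n) a)
          (wordInv g (ω 0 :: prefixWord (shift ω) n) b) := h.codingMap_mem_cylinder ω (n + 1)
      have h1 := h.log_cylLen_cons (hdiff _) (hderiv _) (hC _) _ hx
      have h2 := ih (shift ω)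
      have hL := h.cylLen_pos (ω 0 :: prefixWord (shift ω) n)
      have h3 : C (ω 0) * cylLen g a b (ω 0 :: prefixWord (shift ω) n) ^ (ε : ℝ) ≤ A * τ ^ n := by
        have e1 : cylLen g a b (ω 0 :: prefixWord (shift ω) n) ≤ (b - a) / lam ^ n := by
          refine (h.cylLen_le _).trans ?_
          rw [List.length_cons, length_prefixWord]
          exact div_le_div_of_nonneg_left hba.le (pow_pos hlam0 _)
            (pow_le_pow_right₀ h.one_lt.le (Nat.le_succ n))
        have e2 : ((b - a) / lam ^ n) ^ (ε : ℝ) = (b - a) ^ (ε : ℝ) * τ ^ n := by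
          rw [Real.div_rpow hba.le (pow_nonneg hlam0.le _), div_eq_mul_inv, hτ, inv_pow,
            ← Real.rpow_natCast, ← Real.rpow_natCast, ← Real.rpow_mul hlam0.le,
            ← Real.rpow_mul hlam0.le, mul_comm (n : ℝ)]
        have e3 := Real.rpow_le_rpow hL.le e1 hε'.le
        rw [e2] at e3
        rw [hA, mul_assoc]
        exact mul_le_mul (by exact_mod_cast hi₀ _) e3 (Real.rpow_nonneg hL.le _)
          (C i₀).coe_nonneg
      have h4 : potPhi f ω = -Real.log (deriv (f (ω 0)) (codingMap f ω)) := by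
        rw [potPhi, abs_of_pos (hlam0.trans_le (hderiv _ _))]
      rw [birkhoffSum_succ', h4, Finset.sum_range_succ, mul_add]
      change |Real.log (cylLen g a b (ω 0 :: prefixWord (shift ω) n)) - _| ≤ _
      have h5 := abs_add_le (Real.log (cylLen g a b (ω 0 :: prefixWord (shift ω) n)) +
        Real.log (deriv (f (ω 0)) (codingMap f ω)) -
          Real.log (cylLen g a b (prefixWord (shift ω) n)))
        (Real.log (cylLen g a b (prefixWord (shift ω) n)) -
          birkhoffSum shift (potPhi f) n (shift ω))
      refine le_trans (le_of_eq ?_) (h5.trans (by linarith))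
      congr 1
      ring
  refine ⟨|Real.log (b - a)| + A * (1 - τ)⁻¹, fun ω n => (key n ω).trans ?_⟩
  have := (summable_geometric_of_lt_one hτ0.le hτ1).sum_le_tsum (Finset.range n)
    fun _ _ => by positivity
  rw [tsum_geometric_of_lt_one hτ0.le hτ1] at this
  gcongr

end ExpandingFamily

end

section

variable {s : ℕ}

/-! ### The weights -/

lemma weight_pos {p : Fin s → ℝ} (hp : p ∈ simplex s) (i : Fin (s + 1)) : 0 < weight p i := by
  refine Fin.lastCases ?_ (fun j => ?_) i
  · simpa [weight] using hp.2
  · simpa [weight] using (hp.1 j).1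

lemma sum_weight (p : Fin s → ℝ) : ∑ i, weight p i = 1 := by
  rw [Fin.sum_univ_castSucc]
  simp [weight]

lemma weight_lt_one (hs : 1 ≤ s) {p : Fin s → ℝ} (hp : p ∈ simplex s) (i : Fin (s + 1)) :
    weight p i < 1 := by
  have : Nontrivial (Fin (s + 1)) := Fin.nontrivial_iff_two_le.2 (by omega)
  obtain ⟨j, hj⟩ := exists_ne i
  have h1 : weight p i + weight p j ≤ ∑ k, weight p k := by
    rw [← Finset.sum_pair hj.symm]
    exact Finset.sum_le_sum_of_subset_of_nonneg (Finset.subset_univ _)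
      fun k _ _ => (weight_pos hp k).le
  rw [sum_weight] at h1
  linarith [weight_pos hp j]

lemma word_weight_pos {p : Fin s → ℝ} (hp : p ∈ simplex s) (w : List (Fin (s + 1))) :
    0 < (w.map (weight p)).prod :=
  List.prod_pos (by simpa using fun i _ => weight_pos hp i)

lemma birkhoffSum_potPsi {p : Fin s → ℝ} (hp : p ∈ simplex s) (n : ℕ) (ω : ℕ → Fin (s + 1)) :
    birkhoffSum shift (potPsi p) n ω = Real.log ((prefixWord ω n).map (weight p)).prod := by
  induction n generalizing ω with
  | zero => simp [prefixWord]
  | succ n ih =>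
    rw [birkhoffSum_succ', ih, prefixWord, List.map_cons, List.prod_cons,
      Real.log_mul (weight_pos hp _).ne' (word_weight_pos hp _).ne', potPsi]

/-! ### Word characterisations of the exponents -/

/-- An expanding family with bounded distortion. -/
structure DistortionFamily (f g : Fin (s + 1) → ℝ → ℝ) (a b lam D M : ℝ) : Prop extends
    ExpandingFamily f g a b lam where
  le_deriv : ∀ i x, lam ≤ deriv (f i) x
  deriv_le : ∀ i, ∀ x ∈ Set.Icc a b, deriv (f i) x ≤ M
  distortion : ∀ (ω : ℕ → Fin (s + 1)) (n : ℕ),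
    |Real.log (cylLen g a b (prefixWord ω n)) - birkhoffSum shift (potPhi f) n ω| ≤ D

lemma IsAdmissible.exists_distortionFamily {f : Fin (s + 1) → ℝ → ℝ} {d : EReal → EReal → ℝ}
    (hf : IsAdmissible d f) (hosc : OpenSetCondition f) :
    ∃ (g : Fin (s + 1) → ℝ → ℝ) (a b lam D M : ℝ), DistortionFamily f g a b lam D M := by
  obtain ⟨g, a, b, lam, h, hderiv⟩ := hf.exists_expandingFamily hosc
  obtain ⟨ε, hε, hH⟩ := hf.holder_deriv
  obtain ⟨D, hD⟩ := h.exists_distortion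
    (fun i => (hf.contDiff i).differentiable (by simp)) hderiv hε hH
  have hbdd : ∀ i, ∃ M, ∀ x ∈ Set.Icc a b, deriv (f i) x ≤ M := fun i => by
    obtain ⟨M, hM⟩ := isCompact_Icc.bddAbove_image
      ((hf.contDiff i).continuous_deriv le_rfl).continuousOn (K := Set.Icc a b)
    exact ⟨M, fun x hx => hM ⟨x, hx, rfl⟩⟩
  choose M hM using hbdd
  obtain ⟨i₀, hi₀⟩ := Finite.exists_max M
  exact ⟨g, a, b, lam, D, M i₀, h, hderiv, fun i x hx => (hM i x hx).trans (hi₀ i), hD⟩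

namespace DistortionFamily

variable {f g : Fin (s + 1) → ℝ → ℝ} {a b lam D M : ℝ} (h : DistortionFamily f g a b lam D M)
include h

lemma log_lam_pos : 0 < Real.log lam := Real.log_pos h.one_lt

lemma lam_le_M : lam ≤ M :=
  (h.le_deriv 0 a).trans (h.deriv_le 0 a h.left_mem)

lemma log_M_pos : 0 < Real.log M := Real.log_pos (h.one_lt.trans_le h.lam_le_M)

lemma potPhi_bounds (ω : ℕ → Fin (s + 1)) :
    -Real.log M ≤ potPhi f ω ∧ potPhi f ω ≤ -Real.log lam := by
  have hlam0 : 0 < lam := by linarith [h.one_lt]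
  have h1 := h.le_deriv (ω 0) (codingMap f ω)
  have h2 := h.deriv_le (ω 0) _ (h.mem_Icc_of_mem_fiberJulia (h.codingMap_mem ω))
  rw [potPhi, abs_of_pos (hlam0.trans_le h1)]
  exact ⟨neg_le_neg (Real.log_le_log (hlam0.trans_le h1) h2),
    neg_le_neg (Real.log_le_log hlam0 h1)⟩

lemma birkhoffSum_potPhi_le (ω : ℕ → Fin (s + 1)) (n : ℕ) :
    birkhoffSum shift (potPhi f) n ω ≤ -(n * Real.log lam) := by
  unfold birkhoffSum
  refine (Finset.sum_le_card_nsmul _ _ _ fun k _ => (h.potPhi_bounds _).2).trans_eq ?_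
  simp

lemma le_birkhoffSum_potPhi (ω : ℕ → Fin (s + 1)) (n : ℕ) :
    -(n * Real.log M) ≤ birkhoffSum shift (potPhi f) n ω := by
  unfold birkhoffSum
  refine le_trans (le_of_eq ?_)
    (Finset.card_nsmul_le_sum _ _ _ fun k _ => (h.potPhi_bounds _).1)
  simp

lemma birkhoffSum_potPhi_neg (ω : ℕ → Fin (s + 1)) {n : ℕ} (hn : 1 ≤ n) :
    birkhoffSum shift (potPhi f) n ω < 0 := by
  have h1 := h.birkhoffSum_potPhi_le ω n
  have h2 : (1 : ℝ) ≤ n := by exact_mod_cast hn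
  nlinarith [h.log_lam_pos]

lemma distortion_le (ω : ℕ → Fin (s + 1)) (n : ℕ) :
    Real.log (cylLen g a b (prefixWord ω n)) ≤ birkhoffSum shift (potPhi f) n ω + D := by
  linarith [(abs_le.1 (h.distortion ω n)).2]

lemma le_distortion (ω : ℕ → Fin (s + 1)) (n : ℕ) :
    birkhoffSum shift (potPhi f) n ω - D ≤ Real.log (cylLen g a b (prefixWord ω n)) := by
  linarith [(abs_le.1 (h.distortion ω n)).1]

/-- The lengths of cylinders are almost supermultiplicative. -/
lemma cylLen_mul_le (u v : List (Fin (s + 1))) :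
    cylLen g a b u * cylLen g a b v ≤ Real.exp (3 * D) * cylLen g a b (u ++ v) := by
  obtain ⟨ω, hω⟩ := exists_prefixWord_eq (u ++ v)
  rw [List.length_append, prefixWord_add] at hω
  obtain ⟨hu, hv⟩ := List.append_inj hω (length_prefixWord _ _)
  -- Birkhoff sums along one ω are additive, so each of u, v and u ++ v costs one distortion
  -- constant: hence 3 D.
  have e1 := h.distortion_le ω u.length
  have e2 := h.distortion_le (shift^[u.length] ω) v.length
  have e3 := h.le_distortion ω (u.length + v.length)
  rw [prefixWord_add, birkhoffSum_add] at e3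
  rw [hu] at e1
  rw [hv] at e2
  rw [hu, hv] at e3
  rw [← Real.log_le_log_iff (mul_pos (h.cylLen_pos _) (h.cylLen_pos _))
    (mul_pos (Real.exp_pos _) (h.cylLen_pos _)),
    Real.log_mul (h.cylLen_pos _).ne' (h.cylLen_pos _).ne',
    Real.log_mul (Real.exp_pos _).ne' (h.cylLen_pos _).ne', Real.log_exp]
  linarith

lemma le_cylLen (w : List (Fin (s + 1))) :
    Real.exp (-(w.length * Real.log M) - D) ≤ cylLen g a b w := by
  obtain ⟨ω, hω⟩ := exists_prefixWord_eq w
  have e1 := h.le_distortion ω w.length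
  have e2 := h.le_birkhoffSum_potPhi ω w.length
  rw [hω] at e1
  rw [← Real.le_log_iff_exp_le (h.cylLen_pos _)]
  linarith

variable {p : Fin s → ℝ} (hp : p ∈ simplex s)
include hp

/-- Uniform bounds are what make the real-valued liminf, limsup, infimum and supremum defining α₋
and α₊ meaningful. -/
lemma exists_ratio_bound (hs : 1 ≤ s) : ∃ R, ∀ ω n, 0 ≤ ratio f p ω n ∧ ratio f p ω n ≤ R := by
  obtain ⟨i, hi⟩ := Finite.exists_max fun i => -Real.log (weight p i)
  have hneg : ∀ i, Real.log (weight p i) ≤ 0 := fun i =>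
    Real.log_nonpos (weight_pos hp i).le (weight_lt_one hs hp i).le
  refine ⟨-Real.log (weight p i) / Real.log lam, fun ω n => ?_⟩
  have hR : 0 ≤ -Real.log (weight p i) / Real.log lam :=
    div_nonneg (neg_nonneg.2 (hneg i)) h.log_lam_pos.le
  -- At n = 0 the quotient is 0 / 0, which has the value 0.
  rcases Nat.eq_zero_or_pos n with rfl | hn
  · simpa [ratio] using hR
  have h0 := h.birkhoffSum_potPhi_neg ω hn
  have h1 : birkhoffSum shift (potPsi p) n ω ≤ 0 :=
    Finset.sum_nonpos fun k _ => hneg _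
  have h2 : -(n * -Real.log (weight p i)) ≤ birkhoffSum shift (potPsi p) n ω := by
    unfold birkhoffSum
    refine le_trans (le_of_eq ?_) (Finset.card_nsmul_le_sum _ _ (Real.log (weight p i))
      fun k _ => ?_)
    · simp
    · have := hi ((shift^[k] ω) 0)
      simp only [potPsi]
      linarith
  refine ⟨div_nonneg_of_nonpos h1 h0.le, ?_⟩
  rw [ratio, div_le_iff_of_neg h0]
  refine le_trans ?_ h2
  have h3 := mul_le_mul_of_nonneg_left (h.birkhoffSum_potPhi_le ω n) hR
  refine h3.trans_eq ?_
  have := h.log_lam_pos.ne'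
  field_simp

lemma isBoundedUnder_ratio (hs : 1 ≤ s) (ω : ℕ → Fin (s + 1)) :
    IsBoundedUnder (· ≤ ·) atTop (ratio f p ω) ∧ IsBoundedUnder (· ≥ ·) atTop (ratio f p ω) := by
  obtain ⟨R, hR⟩ := h.exists_ratio_bound hp hs
  exact ⟨isBoundedUnder_of ⟨R, fun n => (hR ω n).2⟩, isBoundedUnder_of ⟨0, fun n => (hR ω n).1⟩⟩

lemma liminf_mem (hs : 1 ≤ s) {R : ℝ} (hR : ∀ ω n, 0 ≤ ratio f p ω n ∧ ratio f p ω n ≤ R)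
    (ω : ℕ → Fin (s + 1)) :
    0 ≤ liminf (ratio f p ω) atTop ∧ liminf (ratio f p ω) atTop ≤ limsup (ratio f p ω) atTop ∧
      limsup (ratio f p ω) atTop ≤ R := by
  obtain ⟨h1, h2⟩ := h.isBoundedUnder_ratio hp hs ω
  exact ⟨le_liminf_of_le h1.isCoboundedUnder_ge (Eventually.of_forall fun n => (hR ω n).1),
    liminf_le_limsup h1 h2,
    limsup_le_of_le h2.isCoboundedUnder_le (Eventually.of_forall fun n => (hR ω n).2)⟩

lemma bddBelow_liminf (hs : 1 ≤ s) :
    BddBelow (Set.range fun ω => liminf (ratio f p ω) atTop) := by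
  obtain ⟨R, hR⟩ := h.exists_ratio_bound hp hs
  exact ⟨0, by rintro _ ⟨ω, rfl⟩; exact (h.liminf_mem hp hs hR ω).1⟩

lemma bddAbove_limsup (hs : 1 ≤ s) :
    BddAbove (Set.range fun ω => limsup (ratio f p ω) atTop) := by
  obtain ⟨R, hR⟩ := h.exists_ratio_bound hp hs
  exact ⟨R, by rintro _ ⟨ω, rfl⟩; exact (h.liminf_mem hp hs hR ω).2.2⟩

lemma alphaMinus_le_alphaPlus (hs : 1 ≤ s) : alphaMinus f p ≤ alphaPlus f p := by
  obtain ⟨R, hR⟩ := h.exists_ratio_bound hp hs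
  exact (ciInf_le (h.bddBelow_liminf hp hs) fun _ => 0).trans
    ((h.liminf_mem hp hs hR _).2.1.trans (le_ciSup (h.bddAbove_limsup hp hs) fun _ => 0))

omit hp in
lemma tendsto_const_div (c : ℝ) (ω : ℕ → Fin (s + 1)) :
    Tendsto (fun n => c / birkhoffSum shift (potPhi f) n ω) atTop (𝓝 0) := by
  refine Tendsto.const_div_atBot ?_ c
  refine tendsto_atBot_mono (fun n => h.birkhoffSum_potPhi_le ω n) ?_
  exact tendsto_neg_atTop_atBot.comp
    ((tendsto_natCast_atTop_atTop (R := ℝ)).atTop_mul_const h.log_lam_pos)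

/-- If the word weights are dominated by the `α`-th powers of the cylinder lengths, then
`α ≤ α₋`. -/
theorem le_alphaMinus (hs : 1 ≤ s) {K α : ℝ} (hα : 0 ≤ α)
    (hK : ∀ w : List (Fin (s + 1)), (w.map (weight p)).prod ≤ K * cylLen g a b w ^ α) :
    α ≤ alphaMinus f p := by
  have hK0 : 0 < K := by
    have h3 := (word_weight_pos hp []).trans_le (hK [])
    exact pos_of_mul_pos_left h3 (Real.rpow_nonneg (h.cylLen_pos []).le _)
  refine le_ciInf fun ω => ?_
  -- Taking logarithms and dividing by the negative S_n φ bounds the ratio below by this sequence;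
  -- the constants disappear because S_n φ tends to -∞.
  have ht : Tendsto (fun n => α + (Real.log K + α * D) / birkhoffSum shift (potPhi f) n ω) atTop
      (𝓝 (α + 0)) := (h.tendsto_const_div _ ω).const_add α
  rw [add_zero] at ht
  rw [← ht.liminf_eq]
  refine liminf_le_liminf ?_ ht.isBoundedUnder_ge
    (h.isBoundedUnder_ratio hp hs ω).1.isCoboundedUnder_ge
  filter_upwards [eventually_ge_atTop 1] with n hn
  have h0 := h.birkhoffSum_potPhi_neg ω hn
  have h1 := Real.log_le_log (word_weight_pos hp _) (hK (prefixWord ω n))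
  have hL := h.cylLen_pos (prefixWord ω n)
  rw [← birkhoffSum_potPsi hp, Real.log_mul hK0.ne' (Real.rpow_pos_of_pos hL _).ne',
    Real.log_rpow hL] at h1
  have h2 := mul_le_mul_of_nonneg_left (h.distortion_le ω n) hα
  rw [ratio, le_div_iff_of_neg h0, add_mul, div_mul_cancel₀ _ h0.ne]
  linarith

/-- If the word weights dominate the `α`-th powers of the cylinder lengths, then `α₊ ≤ α`. -/
theorem alphaPlus_le (hs : 1 ≤ s) {K α : ℝ} (hα : 0 ≤ α)
    (hK : ∀ w : List (Fin (s + 1)), cylLen g a b w ^ α ≤ K * (w.map (weight p)).prod) :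
    alphaPlus f p ≤ α := by
  have hK0 : 0 < K := by
    have h3 := (Real.rpow_pos_of_pos (h.cylLen_pos []) α).trans_le (hK [])
    exact pos_of_mul_pos_left h3 (word_weight_pos hp _).le
  refine ciSup_le fun ω => ?_
  have ht : Tendsto (fun n => α + (-Real.log K - α * D) / birkhoffSum shift (potPhi f) n ω) atTop
      (𝓝 (α + 0)) := (h.tendsto_const_div _ ω).const_add α
  rw [add_zero] at ht
  rw [← ht.limsup_eq]
  refine limsup_le_limsup ?_ (h.isBoundedUnder_ratio hp hs ω).2.isCoboundedUnder_le
    ht.isBoundedUnder_le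
  filter_upwards [eventually_ge_atTop 1] with n hn
  have h0 := h.birkhoffSum_potPhi_neg ω hn
  have hL := h.cylLen_pos (prefixWord ω n)
  have h1 := Real.log_le_log (Real.rpow_pos_of_pos hL _) (hK (prefixWord ω n))
  rw [Real.log_mul hK0.ne' (word_weight_pos hp _).ne', ← birkhoffSum_potPsi hp,
    Real.log_rpow hL] at h1
  have h2 := mul_le_mul_of_nonneg_left (h.le_distortion ω n) hα
  rw [ratio, div_le_iff_of_neg h0, add_mul, div_mul_cancel₀ _ h0.ne]
  linarith

-- At multiples of the period the quotient repeats its value at one period. This lets asymptotic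
-- exponents control a single finite word.
omit h hp in
lemma frequently_ratio_periodic {ω : ℕ → Fin (s + 1)} {n : ℕ} (hn : 1 ≤ n)
    (hω : shift^[n] ω = ω) : ∃ᶠ k in atTop, ratio f p ω k = ratio f p ω n := by
  rw [frequently_atTop]
  intro m
  refine ⟨(m + 1) * n, ?_, ?_⟩
  · nlinarith
  · rw [ratio, ratio, birkhoffSum_periodic _ _ hω, birkhoffSum_periodic _ _ hω,
      mul_div_mul_left _ _ (by positivity)]

lemma alphaMinus_le_ratio_periodic (hs : 1 ≤ s) {ω : ℕ → Fin (s + 1)} {n : ℕ} (hn : 1 ≤ n)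
    (hω : shift^[n] ω = ω) : alphaMinus f p ≤ ratio f p ω n :=
  (ciInf_le (h.bddBelow_liminf hp hs) ω).trans
    (liminf_le_of_frequently_le ((frequently_ratio_periodic hn hω).mono fun _ hk => hk.le)
      (h.isBoundedUnder_ratio hp hs ω).2)

lemma ratio_periodic_le_alphaPlus (hs : 1 ≤ s) {ω : ℕ → Fin (s + 1)} {n : ℕ} (hn : 1 ≤ n)
    (hω : shift^[n] ω = ω) : ratio f p ω n ≤ alphaPlus f p :=
  (le_limsup_of_frequently_le ((frequently_ratio_periodic hn hω).mono fun _ hk => hk.ge)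
      (h.isBoundedUnder_ratio hp hs ω).1).trans (le_ciSup (h.bddAbove_limsup hp hs) ω)

lemma alphaMinus_nonneg (hs : 1 ≤ s) : 0 ≤ alphaMinus f p := by
  obtain ⟨R, hR⟩ := h.exists_ratio_bound hp hs
  exact le_ciInf fun ω => (h.liminf_mem hp hs hR ω).1

/-- For the periodic continuation of w the ratio at time |w| is at least α₋, that is, log P(w) ≤ α₋
S_n φ. Distortion replaces S_n φ by the logarithm of the length at the cost of a constant, so the
exponent α₋ itself is reached. -/
theorem exists_weight_le (hs : 1 ≤ s) : ∃ K : ℝ, ∀ w : List (Fin (s + 1)),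
    (w.map (weight p)).prod ≤ K * cylLen g a b w ^ alphaMinus f p := by
  have hα := h.alphaMinus_nonneg hp hs
  set α := alphaMinus f p with hαdef
  -- The second entry handles the empty word, which has no periodic continuation.
  refine ⟨max (Real.exp (α * D)) (cylLen g a b [] ^ α)⁻¹, fun w => ?_⟩
  have hL := h.cylLen_pos w
  rcases eq_or_ne w [] with rfl | hw
  · have h0 := Real.rpow_pos_of_pos hL α
    calc (([] : List (Fin (s + 1))).map (weight p)).prod
        = (cylLen g a b [] ^ α)⁻¹ * cylLen g a b [] ^ α := by
          rw [inv_mul_cancel₀ h0.ne']; simp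
      _ ≤ _ := mul_le_mul_of_nonneg_right (le_max_right _ _) h0.le
  obtain ⟨ω, hω, hper⟩ := exists_periodic hw
  have hn : 1 ≤ w.length := List.length_pos_iff.2 hw
  have h1 := h.alphaMinus_le_ratio_periodic hp hs hn hper
  rw [ratio, le_div_iff_of_neg (h.birkhoffSum_potPhi_neg ω hn), birkhoffSum_potPsi hp, hω] at h1
  have h2 := h.le_distortion ω w.length
  rw [hω] at h2
  have h3 := mul_le_mul_of_nonneg_left h2 hα
  refine le_trans ?_ (mul_le_mul_of_nonneg_right (le_max_left _ _) (Real.rpow_nonneg hL.le _))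
  rw [← Real.log_le_log_iff (word_weight_pos hp w)
    (mul_pos (Real.exp_pos _) (Real.rpow_pos_of_pos hL _)),
    Real.log_mul (Real.exp_pos _).ne' (Real.rpow_pos_of_pos hL _).ne', Real.log_exp,
    Real.log_rpow hL]
  linarith

theorem exists_le_weight (hs : 1 ≤ s) : ∃ K : ℝ, ∀ w : List (Fin (s + 1)),
    cylLen g a b w ^ alphaPlus f p ≤ K * (w.map (weight p)).prod := by
  have hα := (h.alphaMinus_nonneg hp hs).trans (h.alphaMinus_le_alphaPlus hp hs)
  set α := alphaPlus f p with hαdef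
  refine ⟨max (Real.exp (α * D)) (cylLen g a b [] ^ α), fun w => ?_⟩
  have hL := h.cylLen_pos w
  rcases eq_or_ne w [] with rfl | hw
  · simp
  obtain ⟨ω, hω, hper⟩ := exists_periodic hw
  have hn : 1 ≤ w.length := List.length_pos_iff.2 hw
  have h1 := h.ratio_periodic_le_alphaPlus hp hs hn hper
  rw [ratio, div_le_iff_of_neg (h.birkhoffSum_potPhi_neg ω hn), birkhoffSum_potPsi hp, hω] at h1
  have h2 := h.distortion_le ω w.length
  rw [hω] at h2
  have h3 := mul_le_mul_of_nonneg_left h2 hα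
  refine le_trans ?_ (mul_le_mul_of_nonneg_right (le_max_left _ _) (word_weight_pos hp w).le)
  rw [← Real.log_le_log_iff (Real.rpow_pos_of_pos hL _)
    (mul_pos (Real.exp_pos _) (word_weight_pos hp w)),
    Real.log_mul (Real.exp_pos _).ne' (word_weight_pos hp w).ne', Real.log_exp,
    Real.log_rpow hL]
  linarith

theorem alphaMinus_pos (hs : 1 ≤ s) : 0 < alphaMinus f p := by
  obtain ⟨i, hi⟩ := Finite.exists_max fun i => weight p i
  have hθ0 := weight_pos hp i
  have hθ1 := weight_lt_one hs hp i
  have hlog : 0 < -Real.log (weight p i) := neg_pos.2 (Real.log_neg hθ0 hθ1)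
  -- Chosen so that M^(-α) is the largest weight: lengths decay no faster than M^(-n), weights at
  -- least as fast as the n-th power of the largest one.
  set α : ℝ := -Real.log (weight p i) / Real.log M with hα
  have hα0 : 0 < α := div_pos hlog h.log_M_pos
  refine hα0.trans_le (h.le_alphaMinus hp hs (K := Real.exp (α * D)) hα0.le fun w => ?_)
  have h1 : (w.map (weight p)).prod ≤ weight p i ^ w.length := by
    induction w with
    | nil => simp
    | cons j w ih =>
      simp only [List.map_cons, List.prod_cons, List.length_cons, pow_succ']
      exact mul_le_mul (hi j) ih (word_weight_pos hp w).le hθ0.le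
  refine h1.trans ?_
  have h2 := h.le_cylLen w
  have hL := h.cylLen_pos w
  rw [← Real.le_log_iff_exp_le hL] at h2
  rw [← Real.log_le_log_iff (pow_pos hθ0 _)
    (mul_pos (Real.exp_pos _) (Real.rpow_pos_of_pos hL _)),
    Real.log_mul (Real.exp_pos _).ne' (Real.rpow_pos_of_pos hL _).ne', Real.log_exp,
    Real.log_rpow hL, Real.log_pow]
  have h3 := mul_le_mul_of_nonneg_left h2 hα0.le
  have h4 : α * Real.log M = -Real.log (weight p i) := div_mul_cancel₀ _ h.log_M_pos.ne'
  nlinarith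

end DistortionFamily

end

section

variable {s : ℕ}

/-! ### Rigidity of the mass distribution -/

lemma lt_one_of_sum_eq_one {ι : Type*} [Fintype ι] [Nontrivial ι] {P : ι → ℝ}
    (hP : ∀ i, 0 < P i) (hP1 : ∑ i, P i = 1) (i : ι) : P i < 1 := by
  classical
  obtain ⟨j, hj⟩ := exists_ne i
  have h1 : P i + P j ≤ ∑ k, P k := by
    rw [← Finset.sum_pair hj.symm]
    exact Finset.sum_le_sum_of_subset_of_nonneg (Finset.subset_univ _) fun k _ _ => (hP k).le
  rw [hP1] at h1
  linarith [hP j]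

/-- If the weight of one word is small compared to `q`, the weights on the alphabet of words of
the same length can be increased at that word. -/
lemma tilted_weight_le {ι : Type*} {P : ι → ℝ} (hP : ∀ i, 0 < P i) {q : List ι → ℝ}
    {K C : ℝ} (hC : 0 < C)
    (hq : ∀ w, 0 < q w) (hmul : ∀ u v, q u * q v ≤ C * q (u ++ v))
    (hK : ∀ w : List ι, (w.map P).prod ≤ K * q w) {l : ℕ} {v₀ : Fin l → ι}
    (hv₀ : 2 * C ^ 2 * K * ((List.ofFn v₀).map P).prod ≤ q (List.ofFn v₀))
    {r : (Fin l → ι) → ℝ} (hr₀ : r v₀ = 2 * ((List.ofFn v₀).map P).prod)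
    (hr : ∀ v, v ≠ v₀ → r v = ((List.ofFn v).map P).prod)
    (vs : List (Fin l → ι)) (u : List ι) :
    (u.map P).prod * (vs.map r).prod ≤ K * q (u ++ vs.flatMap List.ofFn) := by
  have hpos : ∀ w : List ι, 0 < (w.map P).prod := fun w =>
    List.prod_pos (by simpa using fun i _ => hP i)
  have hK0 : 0 < K := pos_of_mul_pos_left ((hpos []).trans_le (hK [])) (hq []).le
  have hr0 : ∀ v, 0 < r v := fun v => by
    by_cases hv : v = v₀
    · rw [hv, hr₀]
      exact mul_pos two_pos (hpos _)
    · rw [hr v hv]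
      exact hpos _
  have hrpos : ∀ vs : List (Fin l → ι), 0 < (vs.map r).prod := fun vs =>
    List.prod_pos (by simpa using fun v _ => hr0 v)
  induction vs generalizing u with
  | nil => simpa using hK u
  | cons v vs ih =>
    by_cases hv : v = v₀
    -- The word is cut into u, v₀ and the rest. Rejoining costs C ^ 2, and using the bound for the
    -- two outer pieces separately costs an extra K; together with the factor 2 this is what the
    -- assumed smallness of the weight of v₀ absorbs.
    · subst hv
      have h1 := hK u
      have h2 := ih []
      simp only [List.map_nil, List.prod_nil, one_mul, List.nil_append] at h2
      have h3 := hmul u (List.ofFn v)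
      have h4 := hmul (u ++ List.ofFn v) (vs.flatMap List.ofFn)
      simp only [List.map_cons, List.prod_cons, List.flatMap_cons, hr₀]
      rw [← List.append_assoc]
      set w := List.ofFn v
      set t := vs.flatMap List.ofFn
      have hpw := hpos w
      calc (u.map P).prod * (2 * (w.map P).prod * (vs.map r).prod)
          ≤ (K * q u) * (2 * (w.map P).prod * (K * q t)) := by
            have := hrpos vs
            have := hq u
            gcongr
        _ = K / C ^ 2 * (q u * (2 * C ^ 2 * K * (w.map P).prod) * q t) := by
            field_simp
        _ ≤ K / C ^ 2 * (q u * q w * q t) := by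
            have := (hq u).le
            have := (hq t).le
            gcongr
        _ ≤ K / C ^ 2 * (C * q (u ++ w) * q t) := by
            have := (hq t).le
            gcongr
        _ = K / C * (q (u ++ w) * q t) := by field_simp
        _ ≤ K / C * (C * q (u ++ w ++ t)) := by gcongr
        _ = K * q (u ++ w ++ t) := by field_simp
    -- An unmodified block is moved into the prefix u, so no constant is lost; this is why the
    -- induction runs over all u.
    · have h1 := ih (u ++ List.ofFn v)
      simp only [List.map_cons, List.prod_cons, List.flatMap_cons, hr v hv]
      rw [List.map_append, List.prod_append, mul_assoc, List.append_assoc] at h1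
      exact h1

namespace DistortionFamily

variable {f g : Fin (s + 1) → ℝ → ℝ} {a b lam D M : ℝ} (h : DistortionFamily f g a b lam D M)
include h

/-- If the word weights are dominated by the `δ`-th powers of the lengths of the cylinders, where
`δ` is the dimension of the limit set, then these quantities are comparable. -/
theorem exists_le_weight_of_dimH_le (hs : 1 ≤ s) {P : Fin (s + 1) → ℝ} (hP : ∀ i, 0 < P i)
    (hP1 : ∑ i, P i = 1) {K δ : ℝ} (hδ : 0 ≤ δ)
    (hdim : dimH (limitSet f a b) ≤ ENNReal.ofReal δ)
    (hK : ∀ w : List (Fin (s + 1)), (w.map P).prod ≤ K * cylLen g a b w ^ δ) :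
    ∃ K' : ℝ, ∀ w : List (Fin (s + 1)), cylLen g a b w ^ δ ≤ K' * (w.map P).prod := by
  classical
  by_contra! hcon
  have hpos : ∀ w : List (Fin (s + 1)), 0 < (w.map P).prod := fun w =>
    List.prod_pos (by simpa using fun i _ => hP i)
  have hL := h.cylLen_pos
  set C : ℝ := Real.exp (3 * D) ^ δ with hCdef
  have hC : 0 < C := Real.rpow_pos_of_pos (Real.exp_pos _) _
  have hmul : ∀ u v : List (Fin (s + 1)), cylLen g a b u ^ δ * cylLen g a b v ^ δ ≤
      C * cylLen g a b (u ++ v) ^ δ := by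
    intro u v
    rw [hCdef, ← Real.mul_rpow (hL u).le (hL v).le,
      ← Real.mul_rpow (Real.exp_pos _).le (hL _).le]
    exact Real.rpow_le_rpow (mul_pos (hL u) (hL v)).le (h.cylLen_mul_le u v) hδ
  -- The first entry makes w bad enough for the tilting lemma; the second excludes the empty word.
  obtain ⟨w, hw⟩ := hcon (max (2 * C ^ 2 * K) (cylLen g a b [] ^ δ))
  have hwne : w ≠ [] := by
    rintro rfl
    simp at hw
  obtain ⟨l, v₀, rfl⟩ : ∃ (l : ℕ) (v₀ : Fin l → Fin (s + 1)), w = List.ofFn v₀ :=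
    ⟨w.length, w.get, (List.ofFn_get w).symm⟩
  have hl : l ≠ 0 := by
    rintro rfl
    simp at hwne
  -- The product weights on blocks of length l, doubled at the bad block v₀, so that the total mass
  -- Z exceeds 1 while the bound by the δ-th powers survives.
  set r : (Fin l → Fin (s + 1)) → ℝ := fun v =>
    ((List.ofFn v).map P).prod + if v = v₀ then ((List.ofFn v₀).map P).prod else 0 with hr
  set Z : ℝ := 1 + ((List.ofFn v₀).map P).prod with hZ
  have hZ1 : 1 < Z := by linarith [hpos (List.ofFn v₀)]
  have hZ0 : 0 < Z := by linarith
  have hsum : ∑ v, r v = Z := by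
    rw [hr, Finset.sum_add_distrib, ExpandingFamily.sum_prod_ofFn hP1]
    simp [hZ]
  have hr0 : ∀ v, 0 < r v := fun v => by
    simp only [hr]
    have := hpos (List.ofFn v)
    have := hpos (List.ofFn v₀)
    split_ifs <;> linarith
  have htilt := tilted_weight_le hP hC (fun w => Real.rpow_pos_of_pos (hL w) δ) hmul hK
    (v₀ := v₀) (le_trans (mul_le_mul_of_nonneg_right (le_max_left _ _) (hpos _).le) hw.le)
    (r := r) (by simp only [hr, if_true]; ring) (fun v hv => by simp [hr, hv])
  have hlogZ : 0 < Real.log Z := Real.log_pos hZ1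
  have hlogM := h.log_M_pos
  have hl0 : (0 : ℝ) < l := by exact_mod_cast Nat.pos_of_ne_zero hl
  -- A word of n blocks has length at least exp(-D) M^(-l n), whose η-th power is a constant times
  -- Z^(-n). Normalising the weights by Z thus raises the exponent from δ to δ + η.
  set η : ℝ := Real.log Z / (l * Real.log M) with hη
  have hη0 : 0 < η := by positivity
  have hK0 : 0 < K :=
    pos_of_mul_pos_left ((hpos []).trans_le (hK [])) (Real.rpow_nonneg (hL []).le _)
  have : Nontrivial (Fin (s + 1)) := Fin.nontrivial_iff_two_le.2 (by omega)
  have : Nonempty (Fin l) := ⟨⟨0, Nat.pos_of_ne_zero hl⟩⟩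
  have hr1 : ∑ v, r v / Z = 1 := by rw [← Finset.sum_div, hsum, div_self hZ0.ne']
  have hrpos : ∀ v, 0 < r v / Z := fun v => div_pos (hr0 v) hZ0
  have hbound : ∀ vs : List (Fin l → Fin (s + 1)), (vs.map fun v => r v / Z).prod ≤
      K * Real.exp (η * D) *
        cylLen (fun v : Fin l → Fin (s + 1) => wordInv g (List.ofFn v)) a b vs ^ (δ + η) := by
    intro vs
    have e1 : (vs.map fun v => r v / Z).prod = (vs.map r).prod / Z ^ vs.length := by
      induction vs with
      | nil => simp
      | cons v vs ih => simp only [List.map_cons, List.prod_cons, ih, List.length_cons]; field_simp; ring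
    have e2 : cylLen (fun v : Fin l → Fin (s + 1) => wordInv g (List.ofFn v)) a b vs =
        cylLen g a b (vs.flatMap List.ofFn) := by
      simp only [cylLen, ExpandingFamily.wordInv_iterate]
    have e3 := htilt vs []
    simp only [List.map_nil, List.prod_nil, one_mul, List.nil_append] at e3
    have e4 : (vs.flatMap List.ofFn).length = vs.length * l := by
      induction vs with
      | nil => simp
      | cons v vs ih => simp [add_mul, add_comm]
    have e5 := h.le_cylLen (vs.flatMap List.ofFn)
    rw [e4] at e5
    have hLt := hL (vs.flatMap List.ofFn)
    set t := vs.flatMap List.ofFn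
    have e6 : 1 ≤ Z ^ vs.length * (Real.exp (η * D) * cylLen g a b t ^ η) := by
      have e7 := Real.rpow_le_rpow (Real.exp_pos _).le e5 hη0.le
      rw [← Real.exp_mul] at e7
      have e8 : Z ^ vs.length = Real.exp (vs.length * Real.log Z) := by
        rw [Real.exp_nat_mul, Real.exp_log hZ0]
      calc (1 : ℝ) = Real.exp (vs.length * Real.log Z) * (Real.exp (η * D) *
            Real.exp ((-((vs.length * l : ℕ) * Real.log M) - D) * η)) := by
            rw [← Real.exp_add, ← Real.exp_add, eq_comm, Real.exp_eq_one_iff, hη]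
            push_cast
            field_simp
            ring
        _ ≤ _ := by
            rw [e8]
            gcongr
    rw [e1, e2, Real.rpow_add hLt, div_le_iff₀ (by positivity)]
    have hq := Real.rpow_pos_of_pos hLt δ
    calc (vs.map r).prod ≤ K * cylLen g a b t ^ δ * 1 := by rw [mul_one]; exact e3
      _ ≤ K * cylLen g a b t ^ δ *
          (Z ^ vs.length * (Real.exp (η * D) * cylLen g a b t ^ η)) := by gcongr
      _ = _ := by ring
  -- Mass distribution for the block family gives dimension at least δ + η for a subset of the limit
  -- set, a contradiction.
  have h1 := (h.toExpandingFamily.iterate hl).le_dimH_limitSet hrpos hr1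
    (lt_one_of_sum_eq_one hrpos hr1) (add_nonneg hδ hη0.le) hbound
  have h2 := h1.trans ((dimH_mono (h.toExpandingFamily.limitSet_iterate_subset hl)).trans hdim)
  rw [ENNReal.ofReal_le_ofReal_iff hδ] at h2
  linarith

end DistortionFamily

end

section

/-! ### Metrics on the compactification -/

namespace IsCompactificationMetric

variable {d : EReal → EReal → ℝ} (hd : IsCompactificationMetric d)
include hd

lemma nonneg (x y : EReal) : 0 ≤ d x y := by
  have h1 := hd.triangle x y x
  rw [hd.self, hd.symm y x] at h1
  linarith

lemma pos_of_ne {x y : EReal} (hxy : x ≠ y) : 0 < d x y :=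
  lt_of_le_of_ne (hd.nonneg x y) fun h => hxy (hd.eq_of_dist_eq_zero x y h.symm)

lemma ball_mem_nhds (x : EReal) {ε : ℝ} (hε : 0 < ε) : {y | d x y < ε} ∈ 𝓝 x :=
  (hd.mem_nhds_iff x _).2 ⟨ε, hε, subset_rfl⟩

lemma continuous : Continuous fun q : EReal × EReal => d q.1 q.2 := by
  rw [continuous_iff_continuousAt]
  rintro ⟨x, y⟩
  rw [ContinuousAt, Metric.tendsto_nhds]
  intro ε hε
  have h := prod_mem_nhds (hd.ball_mem_nhds x (half_pos hε)) (hd.ball_mem_nhds y (half_pos hε))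
  filter_upwards [h] with q hq
  obtain ⟨h1, h2⟩ := hq
  rw [Set.mem_ofPred_eq] at h1 h2
  rw [Real.dist_eq, abs_sub_lt_iff]
  have e1 := hd.triangle q.1 x q.2
  have e2 := hd.triangle x y q.2
  have e3 := hd.triangle x q.1 y
  have e4 := hd.triangle q.1 q.2 y
  rw [hd.symm q.1 x] at e1
  rw [hd.symm q.2 y] at e4
  constructor <;> linarith

lemma exists_lower_bound {A B : Set EReal} (hA : IsClosed A) (hB : IsClosed B)
    (hAB : Disjoint A B) : ∃ c > 0, ∀ x ∈ A, ∀ y ∈ B, c ≤ d x y := by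
  rcases (A ×ˢ B).eq_empty_or_nonempty with he | hne
  · exact ⟨1, one_pos, fun x hx y hy => absurd (he ▸ Set.mk_mem_prod hx hy : (x, y) ∈ ∅)
      (Set.notMem_empty _)⟩
  · obtain ⟨q, hq, hmin⟩ := (hA.isCompact.prod hB.isCompact).exists_isMinOn hne
      hd.continuous.continuousOn
    refine ⟨d q.1 q.2, hd.pos_of_ne fun h => ?_, fun x hx y hy => hmin (Set.mk_mem_prod hx hy)⟩
    exact Set.disjoint_left.1 hAB hq.1 (h ▸ hq.2)

end IsCompactificationMetric

/-- The nearest point projection of the compactification to `[a, b]`. -/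
def clamp (a b : ℝ) (x : EReal) : ℝ :=
  EReal.rec (motive := fun _ => ℝ) a (fun y : ℝ => max a (min b y)) b x

lemma clamp_coe (a b x : ℝ) : clamp a b x = max a (min b x) := rfl

lemma clamp_mem {a b : ℝ} (hab : a ≤ b) (x : EReal) : clamp a b x ∈ Set.Icc a b := by
  induction x with
  | bot => exact ⟨le_rfl, hab⟩
  | coe x => exact ⟨le_max_left _ _, max_le hab (min_le_left _ _)⟩
  | top => exact ⟨hab, le_rfl⟩

lemma clamp_of_le {a b : ℝ} {x : EReal} (hx : x ≤ a) : clamp a b x = a := by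
  induction x with
  | bot => rfl
  | coe x =>
    rw [clamp_coe, max_eq_left ((min_le_right _ _).trans (EReal.coe_le_coe_iff.1 hx))]
  | top => simp at hx

lemma clamp_of_ge {a b : ℝ} (hab : a ≤ b) {x : EReal} (hx : (b : EReal) ≤ x) :
    clamp a b x = b := by
  induction x with
  | bot => simp at hx
  | coe x => rw [clamp_coe, min_eq_left (EReal.coe_le_coe_iff.1 hx), max_eq_right hab]
  | top => rfl

/-- Within [a - 1, b + 1] this is strong equivalence with the Euclidean metric. If a gap [b, b + 1]
or [a - 1, a] separates the points, compactness bounds d below while the projections differ by at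
most b - a. In the remaining cases the projections coincide. -/
lemma IsCompactificationMetric.exists_clamp_le {d : EReal → EReal → ℝ}
    (hd : IsCompactificationMetric d) {a b : ℝ} (hab : a < b) :
    ∃ c > 0, ∀ x y, c * |clamp a b x - clamp a b y| ≤ d x y := by
  obtain ⟨C, hC, hCd⟩ := hd.strongly_equivalent (Set.Icc (a - 1) (b + 1)) isCompact_Icc
  obtain ⟨c₁, hc₁, h₁⟩ := hd.exists_lower_bound (A := Set.Iic (b : EReal))
    (B := Set.Ici ((b + 1 : ℝ) : EReal)) isClosed_Iic isClosed_Ici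
    (Set.disjoint_left.2 fun x hx hx' => absurd
      (EReal.coe_le_coe_iff.1 (le_trans (Set.mem_Ici.1 hx') (Set.mem_Iic.1 hx))) (by linarith))
  obtain ⟨c₂, hc₂, h₂⟩ := hd.exists_lower_bound (A := Set.Iic ((a - 1 : ℝ) : EReal))
    (B := Set.Ici (a : EReal)) isClosed_Iic isClosed_Ici
    (Set.disjoint_left.2 fun x hx hx' => absurd
      (EReal.coe_le_coe_iff.1 (le_trans (Set.mem_Ici.1 hx') (Set.mem_Iic.1 hx))) (by linarith))
  have hba : 0 < b - a := sub_pos.2 hab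
  refine ⟨min C⁻¹ (min (c₁ / (b - a)) (c₂ / (b - a))), by positivity, fun x y => ?_⟩
  set c := min C⁻¹ (min (c₁ / (b - a)) (c₂ / (b - a))) with hc
  have hc0 : 0 < c := by positivity
  wlog hxy : x ≤ y generalizing x y
  · rw [hd.symm, abs_sub_comm]
    exact this y x (le_of_not_ge hxy)
  have hle : |clamp a b x - clamp a b y| ≤ b - a := by
    have e1 := clamp_mem hab.le x
    have e2 := clamp_mem hab.le y
    exact abs_sub_le_iff.2 ⟨by linarith [e1.2, e2.1], by linarith [e1.1, e2.2]⟩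
  by_cases hA : x ≤ b ∧ ((b + 1 : ℝ) : EReal) ≤ y
  · calc c * |clamp a b x - clamp a b y| ≤ c₁ / (b - a) * (b - a) := by
          gcongr
          exact (min_le_right _ _).trans (min_le_left _ _)
      _ = c₁ := div_mul_cancel₀ _ hba.ne'
      _ ≤ d x y := h₁ x hA.1 y hA.2
  by_cases hB : x ≤ ((a - 1 : ℝ) : EReal) ∧ (a : EReal) ≤ y
  · calc c * |clamp a b x - clamp a b y| ≤ c₂ / (b - a) * (b - a) := by
          gcongr
          exact (min_le_right _ _).trans (min_le_right _ _)
      _ = c₂ := div_mul_cancel₀ _ hba.ne'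
      _ ≤ d x y := h₂ x hB.1 y hB.2
  rcases le_or_gt x b with hxb | hxb
  swap
  · rw [clamp_of_ge hab.le hxb.le, clamp_of_ge hab.le (hxb.le.trans hxy), sub_self, abs_zero,
      mul_zero]
    exact hd.nonneg x y
  rcases le_or_gt (a : EReal) y with hya | hya
  swap
  · rw [clamp_of_le hya.le, clamp_of_le (hxy.trans hya.le), sub_self, abs_zero,
      mul_zero]
    exact hd.nonneg x y
  have hy : y < ((b + 1 : ℝ) : EReal) := lt_of_not_ge fun h => hA ⟨hxb, h⟩
  have hx : ((a - 1 : ℝ) : EReal) < x := lt_of_not_ge fun h => hB ⟨h, hya⟩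
  induction x with
  | bot => simp at hx
  | top => simp at hxb
  | coe x =>
    induction y with
    | bot => simp at hya
    | top => simp at hy
    | coe y =>
      have hx' := EReal.coe_lt_coe_iff.1 hx
      have hy' := EReal.coe_lt_coe_iff.1 hy
      have hxy' := EReal.coe_le_coe_iff.1 hxy
      have e1 := (hCd x ⟨hx'.le, by linarith⟩ y ⟨by linarith, hy'.le⟩).1
      have e2 : |clamp a b x - clamp a b y| ≤ |x - y| := by
        rw [clamp_coe, clamp_coe]
        refine (abs_max_sub_max_le_max _ _ _ _).trans (max_le (by simp) ?_)
        refine (abs_min_sub_min_le_max _ _ _ _).trans (max_le (by simp) le_rfl)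
      refine le_trans ?_ e1
      exact mul_le_mul (min_le_left _ _) e2 (abs_nonneg _) (by positivity)

/-- A function of the projection to `[a, b]` satisfying a Euclidean Hölder estimate is Hölder
continuous with respect to `d`. -/
lemma isHolder_of_clamp {d : EReal → EReal → ℝ} (hd : IsCompactificationMetric d) {a b : ℝ}
    (hab : a < b) {C : EReal → ℝ} {K α : ℝ} (hα : 0 ≤ α) (hK : 0 ≤ K)
    (h : ∀ x y, |C x - C y| ≤ K * |clamp a b x - clamp a b y| ^ α) : IsHolder d α C := by
  obtain ⟨c, hc, hcd⟩ := hd.exists_clamp_le hab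
  refine ⟨K * (c ^ α)⁻¹, fun x y => (h x y).trans ?_⟩
  rw [mul_assoc]
  refine mul_le_mul_of_nonneg_left ?_ hK
  rw [inv_mul_eq_div, ← Real.div_rpow (hd.nonneg x y) hc.le]
  refine Real.rpow_le_rpow (abs_nonneg _) ?_ hα
  rw [le_div_iff₀ hc, mul_comm]
  exact hcd x y

lemma IsHolder.exists_bound {d : EReal → EReal → ℝ} (hd : IsCompactificationMetric d)
    {C : EReal → ℝ} {α : ℝ} (hα : 0 ≤ α) (h : IsHolder d α C) (a b : ℝ) :
    ∃ K : ℝ, 0 ≤ K ∧ ∀ x ∈ Set.Icc a b, ∀ y ∈ Set.Icc a b,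
      |C (x : EReal) - C (y : EReal)| ≤ K * |x - y| ^ α := by
  obtain ⟨K, hK⟩ := h
  obtain ⟨c, hc, hcd⟩ := hd.strongly_equivalent (Set.Icc a b) isCompact_Icc
  refine ⟨|K| * c ^ α, by positivity, fun x hx y hy => ?_⟩
  have e1 := Real.rpow_le_rpow (hd.nonneg x y) (hcd x hx y hy).2 hα
  rw [Real.mul_rpow hc.le (abs_nonneg _)] at e1
  calc |C (x : EReal) - C (y : EReal)| ≤ K * d x y ^ α := hK x y
    _ ≤ |K| * (c ^ α * |x - y| ^ α) := by
        have := Real.rpow_nonneg (hd.nonneg x y) α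
        exact mul_le_mul (le_abs_self K) e1 this (abs_nonneg K)
    _ = _ := by ring

/-! ### The Julia set -/

lemma iter_extend_coe {ι : Type*} (f : ι → ℝ → ℝ) (ω : ℕ → ι) (n : ℕ) (x : ℝ) :
    iter (fun i => extend (f i)) ω n (x : EReal) = ((iter f ω n x : ℝ) : EReal) := by
  induction n with
  | zero => rfl
  | succ n ih =>
    change extend (f (ω n)) (iter (fun i => extend (f i)) ω n x) = _
    rw [ih]
    rfl

lemma iter_add {ι X : Type*} (F : ι → X → X) (ω : ℕ → ι) (m n : ℕ) (x : X) :
    iter F ω (m + n) x = iter F (shift^[m] ω) n (iter F ω m x) := by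
  induction m generalizing ω x with
  | zero => simp [iter]
  | succ m ih =>
    rw [Nat.succ_add, iter_succ', ih, iter_succ', Function.iterate_succ_apply]

section Julia

variable {s : ℕ} {f g : Fin (s + 1) → ℝ → ℝ} {a b lam : ℝ} {d : EReal → EReal → ℝ}

/-- Along a coding sequence the orbit of x stays in [a, b], while expansion drives any y > x beyond
b + 1. The d-distance between the two regions is bounded below, so equicontinuity fails at x. -/
lemma ExpandingFamily.mem_juliaSet (h : ExpandingFamily f g a b lam)
    (hd : IsCompactificationMetric d) {x : ℝ} (hx : x ∈ limitSet f a b) :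
    (x : EReal) ∈ juliaSet d f := by
  obtain ⟨ω, hω⟩ := hx
  intro U hU heq
  obtain ⟨c, hc, hcd⟩ := hd.exists_lower_bound (A := Set.Iic (b : EReal))
    (B := Set.Ici ((b + 1 : ℝ) : EReal)) isClosed_Iic isClosed_Ici
    (Set.disjoint_left.2 fun x hx hx' => absurd
      (EReal.coe_le_coe_iff.1 (le_trans (Set.mem_Ici.1 hx') (Set.mem_Iic.1 hx))) (by linarith))
  obtain ⟨δ, hδ, hδd⟩ := heq x (mem_of_mem_nhds hU) c hc
  have hnear : ∀ᶠ y : ℝ in 𝓝 x, (y : EReal) ∈ U ∧ d x y < δ :=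
    continuous_coe_real_ereal.continuousAt.eventually
      (inter_mem hU (hd.ball_mem_nhds x hδ))
  obtain ⟨y, ⟨hyU, hyd⟩, hxy⟩ :=
    ((hnear.filter_mono nhdsWithin_le_nhds).and (self_mem_nhdsWithin (s := Set.Ioi x))).exists
  have hxy' : 0 < y - x := sub_pos.2 hxy
  have ht := (tendsto_pow_atTop_atTop_of_one_lt h.one_lt).atTop_mul_const hxy'
  obtain ⟨n, hn, hn1⟩ := ((ht.eventually_ge_atTop (b + 1 - a)).and
    (eventually_ge_atTop 1)).exists
  have h1 := h.iter_expand ω n (x := x) (y := y) (by linarith)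
  have h2 : b + 1 ≤ iter f ω n y := by linarith [(hω n).1]
  have h3 := hδd _ ⟨ω, n, hn1, rfl⟩ y hyU hyd
  simp only [iter_extend_coe] at h3
  exact absurd h3 (not_lt.2 (hcd _ (EReal.coe_le_coe_iff.2 (hω n).2) _
    (EReal.coe_le_coe_iff.2 h2)))

lemma ExpandingFamily.mem_of_map_mem_large (h : ExpandingFamily f g a b lam) {a' b' : ℝ}
    (ha : a' ≤ a) (hb : b ≤ b') (i : Fin (s + 1)) {x : ℝ} (hx : f i x ∈ Set.Icc a' b') :
    x ∈ Set.Icc a' b' := by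
  have hlam := h.one_lt
  refine ⟨le_of_not_gt fun hc => ?_, le_of_not_gt fun hc => ?_⟩
  · have h1 := h.expand i x a (by linarith)
    nlinarith [h.left_le i, hx.1]
  · have h1 := h.expand i b x (by linarith)
    nlinarith [h.le_right i, hx.2]

lemma eventually_iter_close (hd : IsCompactificationMetric d) (hf : ∀ i, Continuous (f i))
    {ε : ℝ} (hε : 0 < ε) (n : ℕ) (x : ℝ) :
    ∀ᶠ y : ℝ in 𝓝 x, ∀ ω, d (iter f ω n x : ℝ) (iter f ω n y : ℝ) < ε := by
  induction n generalizing x with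
  | zero =>
    filter_upwards [continuous_coe_real_ereal.continuousAt.eventually
      (hd.ball_mem_nhds (x : EReal) hε)] with y hy ω
    exact hy
  | succ n ih =>
    have h1 : ∀ i, ∀ᶠ y : ℝ in 𝓝 x, ∀ ω, d (iter f ω n (f i x) : ℝ) (iter f ω n (f i y) : ℝ) < ε :=
      fun i => (hf i).continuousAt.eventually (ih (f i x))
    filter_upwards [eventually_all.2 h1] with y hy ω
    rw [iter_succ', iter_succ']
    exact hy _ _

/-- Near x all orbits are, by a common time N, on the same side of a larger interval outside which
every map contracts. From then on distances do not increase, and up to time N only finitely many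
continuous maps occur. -/
lemma ExpandingFamily.notMem_juliaSet (h : ExpandingFamily f g a b lam)
    (hd : IsCompactificationMetric d) (hf : IsAdmissible d f) {x : ℝ}
    (hx : x ∉ limitSet f a b) : (x : EReal) ∉ juliaSet d f := by
  obtain ⟨Vp, hVp, Vm, hVm, c, hc, hV⟩ := hf.contracting_near_infinity
  obtain ⟨rp, hrp⟩ := EReal.mem_nhds_top_iff.1 hVp
  obtain ⟨rm, hrm⟩ := EReal.mem_nhds_bot_iff.1 hVm
  set a' := min a rm with ha'
  set b' := max b rp with hb'
  have hlam := h.one_lt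
  have ha : a' ≤ a := min_le_left _ _
  have hb : b ≤ b' := le_max_left _ _
  have hx' : ¬ ∃ ω : ℕ → Fin (s + 1), ∀ n, iter f ω n x ∈ Set.Icc a' b' := by
    rintro ⟨ω, hω⟩
    refine hx (h.mem_limitSet_iff.2 ⟨ω, max |a'| |b'|, fun n => ?_⟩)
    exact abs_le_max_abs_abs (hω n).1 (hω n).2
  obtain ⟨N, hN⟩ := GenTakagi.exists_escape_time h.continuous isClosed_Icc
    (fun i _ => h.mem_of_map_mem_large ha hb i) hx'
  have hside := eventually_sameSide h.continuous hN
  have hup : ∀ i (u : ℝ), b' < u → b' < f i u := fun i u hu => by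
    have h1 := h.expand i b u (by linarith)
    nlinarith [h.le_right i]
  have hdown : ∀ i (u : ℝ), u < a' → f i u < a' := fun i u hu => by
    have h1 := h.expand i u a (by linarith)
    nlinarith [h.left_le i]
  have hVpmem : ∀ u : ℝ, b' < u → (u : EReal) ∈ Vp := fun u hu =>
    hrp (EReal.coe_lt_coe_iff.2 ((le_max_right _ _).trans_lt hu))
  have hVmmem : ∀ u : ℝ, u < a' → (u : EReal) ∈ Vm := fun u hu =>
    hrm (EReal.coe_lt_coe_iff.2 (hu.trans_le (min_le_right _ _)))
  have hcontr : ∀ (m : ℕ) (τ : ℕ → Fin (s + 1)) (u v : ℝ), SameSide a' b' u v →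
      d (iter f τ m u : ℝ) (iter f τ m v : ℝ) ≤ d (u : EReal) (v : EReal) := by
    intro m
    induction m with
    | zero => intro τ u v _; exact le_rfl
    | succ m ih =>
      intro τ u v huv
      rw [iter_succ', iter_succ']
      have hdn := hd.nonneg (u : EReal) v
      rcases huv with ⟨hu, hv⟩ | ⟨hu, hv⟩
      · refine (ih (shift τ) _ _ (Or.inl ⟨hdown _ u hu, hdown _ v hv⟩)).trans ?_
        have h1 := (hV (τ 0)).2 u (hVmmem u hu) v (hVmmem v hv)
        exact h1.trans (by nlinarith)
      · refine (ih (shift τ) _ _ (Or.inr ⟨hup _ u hu, hup _ v hv⟩)).trans ?_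
        have h1 := (hV (τ 0)).1 u (hVpmem u hu) v (hVpmem v hv)
        exact h1.trans (by nlinarith)
  have hsame : ∀ {u v w : ℝ}, SameSide a' b' u v → SameSide a' b' u w → SameSide a' b' v w := by
    have hab' : a' < b' := by linarith [h.lt]
    rintro u v w (⟨h1, h2⟩ | ⟨h1, h2⟩) (⟨h3, h4⟩ | ⟨h3, h4⟩)
    · exact Or.inl ⟨h2, h4⟩
    · linarith
    · linarith
    · exact Or.inr ⟨h2, h4⟩
  intro hJ
  refine hJ _ (EReal.isOpenEmbedding_coe.image_mem_nhds.2 hside) ?_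
  rintro _ ⟨y, hy, rfl⟩ ε hε
  have hfin : ∀ᶠ z : ℝ in 𝓝 y, ∀ n ∈ Finset.range (N + 1), ∀ ω,
      d (iter f ω n y : ℝ) (iter f ω n z : ℝ) < ε :=
    (eventually_all_finset _).2 fun n _ => eventually_iter_close hd h.continuous hε n y
  obtain ⟨δ, hδ, hδs⟩ := (hd.mem_nhds_iff _ _).1
    (EReal.isOpenEmbedding_coe.image_mem_nhds.2 hfin)
  refine ⟨δ, hδ, ?_⟩
  rintro _ ⟨ω, n, -, rfl⟩ _ ⟨z, hz, rfl⟩ hyz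
  obtain ⟨z', hz', hzz⟩ := hδs hyz
  obtain rfl : z' = z := EReal.coe_injective hzz
  rw [iter_extend_coe, iter_extend_coe]
  rcases le_or_gt n N with hn | hn
  · exact hz' n (Finset.mem_range.2 (by omega)) ω
  · obtain ⟨m, rfl⟩ := Nat.exists_eq_add_of_lt hn
    rw [add_assoc, iter_add f ω N (m + 1) y, iter_add f ω N (m + 1) z']
    exact (hcontr _ _ _ _ (hsame (hy ω) (hz ω))).trans_lt
      (hz' N (Finset.self_mem_range_succ N) ω)

theorem ExpandingFamily.dimJulia_eq (h : ExpandingFamily f g a b lam)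
    (hd : IsCompactificationMetric d) (hf : IsAdmissible d f) :
    dimJulia d f = dimH (limitSet f a b) := by
  have : {x : ℝ | (x : EReal) ∈ juliaSet d f} = limitSet f a b := by
    ext x
    exact ⟨fun hx => by_contra fun hc => h.notMem_juliaSet hd hf hc hx, h.mem_juliaSet hd⟩
  rw [dimJulia, this]

end Julia

end

section

variable {s : ℕ}

/-! ### Mixed partial derivatives -/

section MixedPartial

variable {p : Fin s → ℝ}

lemma partialDeriv_eventuallyEq (i : Fin s) {F G : (Fin s → ℝ) → ℝ} (h : F =ᶠ[𝓝 p] G) :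
    partialDeriv i F =ᶠ[𝓝 p] partialDeriv i G := by
  filter_upwards [eventually_eventually_nhds.2 h] with u hu
  exact Filter.EventuallyEq.lineDeriv_eq hu

/-- Near `p`, the operator `op` evaluates an iterated derivative at a fixed tuple of vectors. -/
def IsDerivativeOperator (p : Fin s → ℝ) (op : ((Fin s → ℝ) → ℝ) → (Fin s → ℝ) → ℝ) : Prop :=
  ∃ (m : ℕ) (v : Fin m → Fin s → ℝ), ∀ F, ContDiffAt ℝ (⊤ : ℕ∞) F p →
    op F =ᶠ[𝓝 p] fun u => iteratedFDeriv ℝ m F u v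

lemma IsDerivativeOperator.partialDeriv {op : ((Fin s → ℝ) → ℝ) → (Fin s → ℝ) → ℝ}
    (h : IsDerivativeOperator p op) (i : Fin s) :
    IsDerivativeOperator p fun F => partialDeriv i (op F) := by
  obtain ⟨m, v, hv⟩ := h
  refine ⟨m + 1, Fin.cons (Pi.single i 1) v, fun F hF => ?_⟩
  refine (partialDeriv_eventuallyEq i (hv F hF)).trans ?_
  have hs : ∀ᶠ u in 𝓝 p, ContDiffAt ℝ ((1 + m : ℕ) : WithTop ℕ∞) F u :=
    (ContDiffAt.of_infty_nat hF (1 + m)).eventually (by exact_mod_cast ENat.natCast_ne_top (1 + m))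
  filter_upwards [hs] with u hu
  have hd : DifferentiableAt ℝ (iteratedFDeriv ℝ m F) u :=
    (hu.iteratedFDeriv_right (m := 1) (i := m)
      (by push_cast; exact le_rfl)).differentiableAt (by simp)
  rw [GenTakagi.partialDeriv, iteratedFDeriv_succ_apply_left, Fin.cons_zero, Fin.tail_cons,
    ← fderiv_continuousMultilinear_apply_const_apply hd]
  exact (hd.continuousMultilinear_apply_const v).lineDeriv_eq_fderiv

/-- Through this description mixed partials inherit locality, linearity and norm bounds from
`iteratedFDeriv`. -/
lemma isDerivativeOperator_mixedPartial (p : Fin s → ℝ) (n : Fin s → ℕ) :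
    IsDerivativeOperator p (mixedPartial n) := by
  have hit : ∀ (i : Fin s) (k : ℕ) (op : ((Fin s → ℝ) → ℝ) → (Fin s → ℝ) → ℝ),
      IsDerivativeOperator p op →
        IsDerivativeOperator p fun F => (partialDeriv i)^[k] (op F) := by
    intro i k op hop
    induction k with
    | zero => exact hop
    | succ k ih => simpa only [Function.iterate_succ_apply'] using ih.partialDeriv i
  unfold mixedPartial
  generalize List.finRange s = l
  induction l with
  | nil => exact ⟨0, fun i => i.elim0, fun F _ => Eventually.of_forall fun u => by simp⟩
  | cons i l ih => exact hit i (n i) _ ih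

lemma mixedPartial_congr {n : Fin s → ℕ} {F G : (Fin s → ℝ) → ℝ} (h : F =ᶠ[𝓝 p] G)
    (hG : ContDiffAt ℝ (⊤ : ℕ∞) G p) : mixedPartial n F p = mixedPartial n G p := by
  obtain ⟨m, v, hv⟩ := isDerivativeOperator_mixedPartial p n
  rw [(hv F (hG.congr_of_eventuallyEq h)).eq_of_nhds, (hv G hG).eq_of_nhds,
    (h.iteratedFDeriv ℝ m).eq_of_nhds]

lemma mixedPartial_sub {n : Fin s → ℕ} {F G : (Fin s → ℝ) → ℝ}
    (hF : ContDiffAt ℝ (⊤ : ℕ∞) F p) (hG : ContDiffAt ℝ (⊤ : ℕ∞) G p) :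
    mixedPartial n (fun u => F u - G u) p = mixedPartial n F p - mixedPartial n G p := by
  obtain ⟨m, v, hv⟩ := isDerivativeOperator_mixedPartial p n
  rw [(hv F hF).eq_of_nhds, (hv G hG).eq_of_nhds, (hv _ (hF.sub hG)).eq_of_nhds]
  change iteratedFDeriv ℝ m (F - G) p v = _
  rw [iteratedFDeriv_sub_apply (ContDiffAt.of_infty_nat hF m) (ContDiffAt.of_infty_nat hG m)]
  rfl

/-- The order m comes before ρ, because ρ is later chosen small depending on m. -/
lemma exists_mixedPartial_le_jetNorm (p : Fin s → ℝ) (n : Fin s → ℕ) :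
    ∃ m : ℕ, ∀ ρ > 0, ∃ c ≥ 0, ∀ F : (Fin s → ℝ) → ℝ, ContDiffAt ℝ (⊤ : ℕ∞) F p →
      |mixedPartial n F p| ≤ c * jetNorm ρ m p F := by
  obtain ⟨m, v, hv⟩ := isDerivativeOperator_mixedPartial p n
  refine ⟨m, fun ρ hρ => ⟨m.factorial / ρ ^ m * ∏ i, ‖v i‖, by positivity, fun F hF => ?_⟩⟩
  rw [(hv F hF).eq_of_nhds, ← Real.norm_eq_abs]
  refine (ContinuousMultilinearMap.le_opNorm _ _).trans ?_
  calc ‖iteratedFDeriv ℝ m F p‖ * ∏ i, ‖v i‖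
      ≤ (m.factorial / ρ ^ m * jetNorm ρ m p F) * ∏ i, ‖v i‖ := by
        gcongr
        exact norm_iteratedFDeriv_le_jetNorm hρ
    _ = _ := by ring

end MixedPartial

/-! ### Smooth dependence of the escape probability on the weights -/

lemma isOpen_simplex (s : ℕ) : IsOpen (simplex s) := by
  have : simplex s = (⋂ i, {p : Fin s → ℝ | p i ∈ Set.Ioo (0 : ℝ) 1}) ∩
      {p : Fin s → ℝ | ∑ i, p i < 1} := by
    ext p
    simp [simplex]
  rw [this]
  refine (isOpen_iInter_of_finite fun i => isOpen_Ioo.preimage (continuous_apply i)).inter ?_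
  exact isOpen_lt (by fun_prop) continuous_const

lemma contDiff_weight (i : Fin (s + 1)) : ContDiff ℝ (⊤ : ℕ∞) fun u : Fin s → ℝ => weight u i := by
  refine Fin.lastCases ?_ (fun j => ?_) i
  · simp only [weight, Fin.snoc_last]
    fun_prop
  · simp only [weight, Fin.snoc_castSucc]
    fun_prop

/-- The escape probability for the weights with parameter `u`. -/
def escape (f : Fin (s + 1) → ℝ → ℝ) (u : Fin s → ℝ) (x : ℝ) : ℝ := escapeProb f (weight u) x

lemma probInfty_coe (f : Fin (s + 1) → ℝ → ℝ) (u : Fin s → ℝ) (x : ℝ) :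
    probInfty f u x = escape f u x := by
  unfold probInfty escape escapeProb
  congr 1
  ext ω
  simp only [iter_extend_coe, Set.mem_ofPred_eq, EReal.tendsto_coe_nhds_top_iff]

lemma iter_extend_const {ι : Type*} (f : ι → ℝ → ℝ) (ω : ℕ → ι) (n : ℕ) :
    iter (fun i => extend (f i)) ω n ⊤ = ⊤ ∧ iter (fun i => extend (f i)) ω n ⊥ = ⊥ := by
  induction n with
  | zero => exact ⟨rfl, rfl⟩
  | succ n ih =>
    constructor
    · change extend (f (ω n)) (iter (fun i => extend (f i)) ω n ⊤) = ⊤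
      rw [ih.1]
      rfl
    · change extend (f (ω n)) (iter (fun i => extend (f i)) ω n ⊥) = ⊥
      rw [ih.2]
      rfl

namespace ExpandingFamily

variable {f g : Fin (s + 1) → ℝ → ℝ} {a b lam : ℝ} (h : ExpandingFamily f g a b lam)
include h

lemma isDistribution_escape (hs : 1 ≤ s) {u : Fin s → ℝ} (hu : u ∈ simplex s) :
    IsDistribution f a b (weight u) (escape f u) :=
  h.isDistribution_escapeProb (fun i => (weight_pos hu i).le) (sum_weight u) (weight_lt_one hs hu)

lemma probInfty_eq_clamp (hs : 1 ≤ s) {u : Fin s → ℝ} (hu : u ∈ simplex s) (x : EReal) :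
    probInfty f u x = escape f u (clamp a b x) := by
  have hT := h.isDistribution_escape hs hu
  induction x with
  | bot =>
    rw [show clamp a b ⊥ = a from rfl, hT.left a le_rfl]
    have : {ω | Tendsto (fun n => iter (fun i => extend (f i)) ω n ⊥) atTop (𝓝 ⊤)} = ∅ := by
      refine Set.eq_empty_of_forall_notMem fun ω hω => ?_
      simp only [Set.mem_ofPred_eq, (iter_extend_const f ω _).2] at hω
      exact bot_ne_top (tendsto_nhds_unique tendsto_const_nhds hω)
    simp [probInfty, this]
  | top =>
    rw [show clamp a b ⊤ = b from rfl, hT.right b le_rfl]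
    have : {ω | Tendsto (fun n => iter (fun i => extend (f i)) ω n ⊤) atTop (𝓝 ⊤)} =
        Set.univ := by
      refine Set.eq_univ_of_forall fun ω => ?_
      simp only [Set.mem_ofPred_eq, (iter_extend_const f ω _).1]
      exact tendsto_const_nhds
    have hprob : IsProbabilityMeasure (bernoulli u) := by
      have := isProbabilityMeasure_marginal (fun i => (weight_pos hu i).le) (sum_weight u)
      unfold bernoulli
      infer_instance
    simp [probInfty, this]
  | coe x =>
    rw [probInfty_coe, clamp_coe]
    rcases le_total x a with hxa | hxa
    · rw [max_eq_left ((min_le_right _ _).trans hxa), hT.left x hxa, hT.left a le_rfl]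
    · rcases le_total x b with hxb | hxb
      · rw [min_eq_right hxb, max_eq_right hxa]
      · rw [min_eq_left hxb, max_eq_right h.lt.le, hT.right x hxb, hT.right b le_rfl]

/-- Since T_u = 1_[b, ∞) + 1_(a, b) T_u, the functional equation becomes an inhomogeneous linear one
in which only images in (a, b) re-enter. The operator at p has norm at most the largest weight,
which is < 1. Smoothness in the supremum norm makes all parameter derivatives bounded uniformly in
x. -/
theorem exists_contDiffAt_escape (hs : 1 ≤ s) {p : Fin s → ℝ} (hp : p ∈ simplex s) :
    ∃ H : (Fin s → ℝ) → lp (fun _ : ℝ => ℝ) ∞, ContDiffAt ℝ (⊤ : ℕ∞) H p ∧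
      ∀ᶠ u in 𝓝 p, ∀ x, (H u : ℝ → ℝ) x = escape f u x := by
  obtain ⟨i₀, hi₀⟩ := Finite.exists_max fun i => weight p i
  have hopen : ∀ᶠ u in 𝓝 p, u ∈ simplex s := (isOpen_simplex s).mem_nhds hp
  refine exists_contDiffAt_solution (φ := f) (S := Set.Ioo a b) (c := weight)
    (fun i j x hi hj => by
      by_contra hij
      exact h.disj i j hij x hi hj)
    (fun i => (contDiff_weight i).contDiffAt) (weight_pos hp i₀).le (weight_lt_one hs hp i₀)
    (fun i => by rw [abs_of_pos (weight_pos hp i)]; exact hi₀ i)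
    (fun i => ⟨fun x => (Set.Ici b).indicator 1 (f i x), memℓp_infty ⟨1, by
      rintro _ ⟨x, rfl⟩
      by_cases hx : f i x ∈ Set.Ici b <;> simp [hx]⟩⟩) ?_ ?_
  · filter_upwards [hopen] with u hu x
    have hT := h.isDistribution_escape hs hu
    rw [abs_of_nonneg (hT.nonneg x)]
    exact hT.le_one x
  · filter_upwards [hopen] with u hu x
    have hT := h.isDistribution_escape hs hu
    rw [hT.eq_sum x]
    refine Finset.sum_congr rfl fun i _ => ?_
    congr 1
    generalize f i x = z
    change escape f u z = (Set.Ici b).indicator 1 z + (Set.Ioo a b).indicator (escape f u) z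
    rcases le_or_gt z a with hza | hza
    · rw [hT.left z hza, Set.indicator_of_notMem, Set.indicator_of_notMem, add_zero]
      · exact fun hc => not_lt.2 hza hc.1
      · exact fun hc => not_le.2 h.lt (le_trans (Set.mem_Ici.1 hc) hza)
    · rcases lt_or_ge z b with hzb | hzb
      · rw [Set.indicator_of_notMem (fun hc => not_lt.2 (Set.mem_Ici.1 hc) hzb),
          Set.indicator_of_mem (show z ∈ Set.Ioo a b from ⟨hza, hzb⟩), zero_add]
      · rw [hT.right z hzb, Set.indicator_of_mem (Set.mem_Ici.2 hzb),
          Set.indicator_of_notMem (fun hc => not_lt.2 hzb hc.2), Pi.one_apply, add_zero]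

lemma contDiffAt_escape (hs : 1 ≤ s) {p : Fin s → ℝ} (hp : p ∈ simplex s) (x : ℝ) :
    ContDiffAt ℝ (⊤ : ℕ∞) (fun u => escape f u x) p := by
  obtain ⟨H, hH, hHe⟩ := h.exists_contDiffAt_escape hs hp
  have h1 : ContDiffAt ℝ (⊤ : ℕ∞) (lp.evalCLM ℝ (fun _ : ℝ => ℝ) ∞ x ∘ H) p :=
    (lp.evalCLM ℝ (fun _ : ℝ => ℝ) ∞ x).contDiff.contDiffAt.comp p hH
  refine h1.congr_of_eventuallyEq ?_
  filter_upwards [hHe] with u hu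
  exact (hu x).symm

lemma exists_jetNorm_escape_le (hs : 1 ≤ s) {p : Fin s → ℝ} (hp : p ∈ simplex s) {ρ : ℝ}
    (hρ : 0 ≤ ρ) (m : ℕ) : ∃ B : ℝ, ∀ x, jetNorm ρ m p (fun u => escape f u x) ≤ B := by
  obtain ⟨H, hH, hHe⟩ := h.exists_contDiffAt_escape hs hp
  refine ⟨∑ k ∈ Finset.range (m + 1), ρ ^ k / k.factorial * ‖iteratedFDeriv ℝ k H p‖,
    fun x => ?_⟩
  have he : (fun u => escape f u x) =ᶠ[𝓝 p] lp.evalCLM ℝ (fun _ : ℝ => ℝ) ∞ x ∘ H := by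
    filter_upwards [hHe] with u hu
    exact (hu x).symm
  rw [jetNorm_congr he]
  refine Finset.sum_le_sum fun k _ => mul_le_mul_of_nonneg_left ?_ (by positivity)
  have hnorm : ‖lp.evalCLM ℝ (fun _ : ℝ => ℝ) ∞ x‖ ≤ 1 := by
    refine ContinuousLinearMap.opNorm_le_bound _ zero_le_one fun u => ?_
    rw [one_mul]
    exact lp.norm_apply_le_norm ENNReal.top_ne_zero u x
  refine (ContinuousLinearMap.norm_iteratedFDeriv_comp_left _ hH (n := k)
    (by exact_mod_cast le_top)).trans ?_
  exact mul_le_of_le_one_left (norm_nonneg _) hnorm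

theorem contDiffAt_probInfty (hs : 1 ≤ s) {p : Fin s → ℝ} (hp : p ∈ simplex s) (x : EReal) :
    ContDiffAt ℝ (⊤ : ℕ∞) (fun u => probInfty f u x) p := by
  refine (h.contDiffAt_escape hs hp (clamp a b x)).congr_of_eventuallyEq ?_
  filter_upwards [(isOpen_simplex s).mem_nhds hp] with u hu
  exact h.probInfty_eq_clamp hs hu x

lemma takagi_eq (hs : 1 ≤ s) {p : Fin s → ℝ} (hp : p ∈ simplex s) (n : Fin s → ℕ) (x : EReal) :
    takagi f p n x = mixedPartial n (fun u => escape f u (clamp a b x)) p := by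
  refine mixedPartial_congr ?_ (h.contDiffAt_escape hs hp _)
  filter_upwards [(isOpen_simplex s).mem_nhds hp] with u hu
  exact h.probInfty_eq_clamp hs hu x

/-- The increments of the jets of the escape probability form a subinvariant distance. -/
lemma subinvariant_jetNorm (hs : 1 ≤ s) {p : Fin s → ℝ} (hp : p ∈ simplex s) {ρ : ℝ}
    (hρ : 0 ≤ ρ) (m : ℕ) {κ : Fin (s + 1) → ℝ} (hκ0 : ∀ i, 0 < κ i) (hκ1 : ∀ i, κ i < 1)
    (hκ : ∀ i, jetNorm ρ m p (fun u => weight u i) ≤ κ i) :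
    ∃ B, Subinvariant f a b κ
      (fun x y => jetNorm ρ m p fun u => escape f u x - escape f u y) B := by
  obtain ⟨B, hB⟩ := h.exists_jetNorm_escape_le hs hp hρ m
  have hsm := h.contDiffAt_escape hs hp
  have hopen : ∀ᶠ u in 𝓝 p, u ∈ simplex s := (isOpen_simplex s).mem_nhds hp
  refine ⟨B + B, hκ0, hκ1, fun x y => jetNorm_nonneg hρ,
    fun x y => (jetNorm_sub_le hρ (hsm x) (hsm y)).trans (add_le_add (hB x) (hB y)),
    fun x y => jetNorm_sub_comm, fun x => ?_, fun x y hx => ?_, fun x y hx => ?_, fun x y => ?_⟩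
  · simp only [sub_self]
    exact jetNorm_zero
  · refine jetNorm_congr ?_
    filter_upwards [hopen] with u hu
    have hT := h.isDistribution_escape hs hu
    rw [hT.left x hx, hT.left a le_rfl]
  · refine jetNorm_congr ?_
    filter_upwards [hopen] with u hu
    have hT := h.isDistribution_escape hs hu
    rw [hT.right x hx, hT.right b le_rfl]
  · have he : (fun u => escape f u x - escape f u y) =ᶠ[𝓝 p]
        fun u => ∑ i, weight u i * (escape f u (f i x) - escape f u (f i y)) := by
      filter_upwards [hopen] with u hu
      have hT := h.isDistribution_escape hs hu
      rw [hT.eq_sum x, hT.eq_sum y, ← Finset.sum_sub_distrib]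
      simp only [mul_sub]
    have hw : ∀ i, ContDiffAt ℝ (⊤ : ℕ∞) (fun u : Fin s → ℝ => weight u i) p :=
      fun i => (contDiff_weight i).contDiffAt
    rw [jetNorm_congr he]
    refine (jetNorm_sum_le _ hρ fun i _ => (hw i).mul ((hsm _).sub (hsm _))).trans ?_
    refine Finset.sum_le_sum fun i _ => ?_
    exact (jetNorm_mul_le hρ (hw i) ((hsm _).sub (hsm _))).trans
      (mul_le_mul_of_nonneg_right (hκ i) (jetNorm_nonneg hρ))

/-- Every `C_n` is Hölder continuous with every exponent smaller than an exponent for which the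
word weights are dominated by the lengths of the cylinders. -/
theorem exists_takagi_holder (hs : 1 ≤ s) {p : Fin s → ℝ} (hp : p ∈ simplex s) {K α β : ℝ}
    (hK : ∀ w : List (Fin (s + 1)), (w.map (weight p)).prod ≤ K * cylLen g a b w ^ β)
    (hα : 0 ≤ α) (hαβ : α < β) (n : Fin s → ℕ) :
    ∃ K', 0 ≤ K' ∧ ∀ x y : EReal,
      |takagi f p n x - takagi f p n y| ≤ K' * |clamp a b x - clamp a b y| ^ α := by
  have hlam0 : 0 < lam := by linarith [h.one_lt]
  have hba : 0 < b - a := sub_pos.2 h.lt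
  have hK0 : 0 < K := pos_of_mul_pos_left ((word_weight_pos hp []).trans_le (hK []))
    (Real.rpow_nonneg (h.cylLen_pos []).le _)
  obtain ⟨m, hm⟩ := exists_mixedPartial_le_jetNorm p n
  have h1lt : 1 < lam ^ (β - α) := Real.one_lt_rpow h.one_lt (sub_pos.2 hαβ)
  -- The factor r is lost per letter. The first bound lets the surplus β - α in the exponent absorb
  -- it; the second keeps the enlarged weights below 1.
  obtain ⟨r, ⟨hr, hr1⟩, hr2⟩ : ∃ r : ℝ, (1 < r ∧ r < lam ^ (β - α)) ∧ ∀ i, r * weight p i < 1 := by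
    have e1 : ∀ᶠ r in 𝓝[>] (1 : ℝ), r < lam ^ (β - α) :=
      (gt_mem_nhds h1lt).filter_mono nhdsWithin_le_nhds
    have e2 : ∀ᶠ r in 𝓝[>] (1 : ℝ), ∀ i, r * weight p i < 1 := by
      refine eventually_all.2 fun i => Eventually.filter_mono nhdsWithin_le_nhds ?_
      have hc : ContinuousAt (fun r : ℝ => r * weight p i) 1 := by fun_prop
      exact hc.eventually (gt_mem_nhds (by simpa using weight_lt_one hs hp i))
    obtain ⟨r, ⟨h1, h2⟩, h3⟩ := ((e1.and e2).and self_mem_nhdsWithin).exists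
    exact ⟨r, ⟨h3, h1⟩, h2⟩
  have hr0 : 0 < r := by linarith
  -- As ρ tends to 0 the jet norm of a weight tends to its value at p.
  obtain ⟨ρ, hρ, hρκ⟩ : ∃ ρ > 0, ∀ i, jetNorm ρ m p (fun u => weight u i) < r * weight p i := by
    have e : ∀ᶠ ρ in 𝓝[>] (0 : ℝ), ∀ i, jetNorm ρ m p (fun u => weight u i) < r * weight p i := by
      refine eventually_all.2 fun i => Eventually.filter_mono nhdsWithin_le_nhds ?_
      refine eventually_jetNorm_lt m ?_
      have := weight_pos hp i
      rw [abs_of_pos this]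
      nlinarith
    obtain ⟨ρ, h1, h2⟩ := (e.and self_mem_nhdsWithin).exists
    exact ⟨ρ, h2, h1⟩
  obtain ⟨B, hB⟩ := h.subinvariant_jetNorm hs hp hρ.le m
    (fun i => mul_pos hr0 (weight_pos hp i)) hr2 fun i => (hρκ i).le
  have hword : ∀ w : List (Fin (s + 1)), (w.map fun i => r * weight p i).prod ≤
      K * (b - a) ^ (β - α) * cylLen g a b w ^ α := by
    intro w
    have hL := h.cylLen_pos w
    have e1 : (w.map fun i => r * weight p i).prod = r ^ w.length * (w.map (weight p)).prod := by
      induction w with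
      | nil => simp
      | cons i w ih =>
        simp only [List.map_cons, List.prod_cons, ih (h.cylLen_pos w), List.length_cons]
        ring
    have e2 : r ^ w.length ≤ ((b - a) / cylLen g a b w) ^ (β - α) := by
      calc r ^ w.length ≤ (lam ^ (β - α)) ^ w.length := by gcongr
        _ = (lam ^ w.length) ^ (β - α) := by
            rw [← Real.rpow_natCast, ← Real.rpow_mul hlam0.le, mul_comm, Real.rpow_mul hlam0.le,
              Real.rpow_natCast]
        _ ≤ _ := by
            refine Real.rpow_le_rpow (pow_nonneg hlam0.le _) ?_ (sub_pos.2 hαβ).le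
            rw [le_div_iff₀ hL, mul_comm, ← le_div_iff₀ (pow_pos hlam0 _)]
            exact h.cylLen_le w
    rw [e1]
    calc r ^ w.length * (w.map (weight p)).prod
        ≤ ((b - a) / cylLen g a b w) ^ (β - α) * (K * cylLen g a b w ^ β) :=
          mul_le_mul e2 (hK w) (word_weight_pos hp w).le
            (Real.rpow_nonneg (div_pos hba hL).le _)
      _ = K * (b - a) ^ (β - α) * cylLen g a b w ^ α := by
          rw [Real.div_rpow hba.le hL.le, show β = (β - α) + α by ring, Real.rpow_add hL]
          have := (Real.rpow_pos_of_pos hL (β - α)).ne'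
          simp only [add_sub_cancel_right]
          field_simp
  obtain ⟨K', hK'0, hK'⟩ := hB.holder_bound h hα hword
  obtain ⟨c, hc0, hc⟩ := hm ρ hρ
  have hsm := h.contDiffAt_escape hs hp
  refine ⟨c * K', mul_nonneg hc0 hK'0, fun x y => ?_⟩
  rw [h.takagi_eq hs hp, h.takagi_eq hs hp, ← mixedPartial_sub (hsm _) (hsm _)]
  refine (hc _ ((hsm _).sub (hsm _))).trans ?_
  rw [mul_assoc]
  refine mul_le_mul_of_nonneg_left ?_ hc0
  rcases le_total (clamp a b x) (clamp a b y) with hxy | hxy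
  · rw [abs_sub_comm, abs_of_nonneg (sub_nonneg.2 hxy)]
    exact hK' _ _ hxy
  · rw [abs_of_nonneg (sub_nonneg.2 hxy), jetNorm_sub_comm]
    exact hK' _ _ hxy

end ExpandingFamily

end

section

variable {s : ℕ}

/-! ### Mixed partial derivatives of polynomials -/

section Polynomial

open MvPolynomial

lemma partialDeriv_eval (i : Fin s) (Q : MvPolynomial (Fin s) ℝ) :
    partialDeriv i (fun u => eval u Q) = fun u => eval u (pderiv i Q) := by
  funext u
  refine HasLineDerivAt.lineDeriv ?_
  change HasDerivAt (fun t : ℝ => eval (u + t • Pi.single i 1) Q) (eval u (pderiv i Q)) 0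
  induction Q using MvPolynomial.induction_on with
  | C r => simpa using hasDerivAt_const (0 : ℝ) r
  | add P Q hP hQ =>
    simp only [map_add]
    exact hP.fun_add hQ
  | mul_X P j hP =>
    have hX : HasDerivAt (fun t : ℝ => u j + t * (Pi.single i 1 : Fin s → ℝ) j)
        ((Pi.single i 1 : Fin s → ℝ) j) 0 := by
      simpa using ((hasDerivAt_id (0 : ℝ)).mul_const _).const_add (u j)
    simp only [map_mul, eval_X, Pi.add_apply, Pi.smul_apply, smul_eq_mul]
    refine (hP.fun_mul hX).congr_deriv ?_
    rcases eq_or_ne j i with rfl | hji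
    · simp [Derivation.leibniz]
      ring
    · simp [Derivation.leibniz, pderiv_X_of_ne hji, hji]
      ring

/-- The mixed derivative as an operator on polynomials. -/
def polyPartial (n : Fin s → ℕ) (l : List (Fin s)) (Q : MvPolynomial (Fin s) ℝ) :
    MvPolynomial (Fin s) ℝ :=
  l.foldr (fun i H => (pderiv i)^[n i] H) Q

lemma mixedPartial_eval (n : Fin s → ℕ) (Q : MvPolynomial (Fin s) ℝ) :
    mixedPartial n (fun u => eval u Q) = fun u => eval u (polyPartial n (List.finRange s) Q) := by
  have hit : ∀ (i : Fin s) (k : ℕ) (H : MvPolynomial (Fin s) ℝ),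
      (partialDeriv i)^[k] (fun u => eval u H) = fun u => eval u ((pderiv i)^[k] H) := by
    intro i k H
    induction k with
    | zero => rfl
    | succ k ih => simp only [Function.iterate_succ_apply', ih, partialDeriv_eval]
  unfold mixedPartial polyPartial
  induction List.finRange s with
  | nil => rfl
  | cons i l ih => simp only [List.foldr_cons, ih, hit]

/-- The Taylor shift of a polynomial to the point `p`. -/
def taylorShift (p : Fin s → ℝ) : MvPolynomial (Fin s) ℝ →ₐ[ℝ] MvPolynomial (Fin s) ℝ :=
  aeval fun i => X i + C (p i)

@[simp]
lemma taylorShift_X (p : Fin s → ℝ) (i : Fin s) : taylorShift p (X i) = X i + C (p i) :=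
  aeval_X _ i

lemma coeff_zero_taylorShift (p : Fin s → ℝ) (Q : MvPolynomial (Fin s) ℝ) :
    coeff 0 (taylorShift p Q) = eval p Q := by
  rw [← constantCoeff_eq]
  induction Q using MvPolynomial.induction_on with
  | C r => simp
  | add P Q hP hQ => simp [hP, hQ]
  | mul_X P j hP => simp [hP]

lemma taylorShift_pderiv (p : Fin s → ℝ) (i : Fin s) (Q : MvPolynomial (Fin s) ℝ) :
    taylorShift p (pderiv i Q) = pderiv i (taylorShift p Q) := by
  induction Q using MvPolynomial.induction_on with
  | C r => simp
  | add P Q hP hQ => simp [hP, hQ]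
  | mul_X P j hP =>
    rcases eq_or_ne j i with rfl | hji
    · simp [Derivation.leibniz, hP]
    · simp [Derivation.leibniz, hP, pderiv_X_of_ne hji]

/-- Each derivative shifts a Taylor exponent by one and contributes a positive integer factor. Only
positivity of the product and its independence of the polynomial matter. -/
lemma exists_coeff_polyPartial (p : Fin s → ℝ) (n : Fin s → ℕ) (l : List (Fin s)) :
    ∀ m : Fin s →₀ ℕ, ∃ r : ℝ, 0 < r ∧ ∀ Q, coeff m (taylorShift p (polyPartial n l Q)) =
      r * coeff (m + (l.map fun i => Finsupp.single i (n i)).sum) (taylorShift p Q) := by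
  have hit : ∀ (i : Fin s) (k : ℕ) (m : Fin s →₀ ℕ), ∃ r : ℝ, 0 < r ∧ ∀ Q,
      coeff m (taylorShift p ((pderiv i)^[k] Q)) =
        r * coeff (m + Finsupp.single i k) (taylorShift p Q) := by
    intro i k
    induction k with
    | zero => exact fun m => ⟨1, one_pos, fun Q => by simp⟩
    | succ k ih =>
      intro m
      obtain ⟨r, hr, h⟩ := ih m
      refine ⟨r * ((m + Finsupp.single i k) i + 1 : ℝ), by positivity, fun Q => ?_⟩
      rw [Function.iterate_succ_apply, h, taylorShift_pderiv, coeff_pderiv, add_assoc,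
        ← Finsupp.single_add]
      push_cast
      ring
  induction l with
  | nil => exact fun m => ⟨1, one_pos, fun Q => by simp [polyPartial]⟩
  | cons i l ih =>
    intro m
    obtain ⟨r, hr, h⟩ := hit i (n i) m
    obtain ⟨r', hr', h'⟩ := ih (m + Finsupp.single i (n i))
    refine ⟨r * r', mul_pos hr hr', fun Q => ?_⟩
    change coeff m (taylorShift p ((pderiv i)^[n i] (polyPartial n l Q))) = _
    rw [h, h', List.map_cons, List.sum_cons, add_assoc, mul_assoc]

/-- A mixed derivative of a polynomial at `p` is a positive multiple of a Taylor coefficient. -/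
lemma exists_mixedPartial_eval_eq (p : Fin s → ℝ) (n : Fin s → ℕ) :
    ∃ r : ℝ, 0 < r ∧ ∀ Q : MvPolynomial (Fin s) ℝ, mixedPartial n (fun u => eval u Q) p =
      r * coeff (Finsupp.equivFunOnFinite.symm n) (taylorShift p Q) := by
  obtain ⟨r, hr, h⟩ := exists_coeff_polyPartial p n (List.finRange s) 0
  refine ⟨r, hr, fun Q => ?_⟩
  have e : ((List.finRange s).map fun i => Finsupp.single i (n i)).sum =
      Finsupp.equivFunOnFinite.symm n := by
    rw [← Fin.sum_univ_def]
    exact Finsupp.univ_sum_single (Finsupp.equivFunOnFinite.symm n)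
  simp only [mixedPartial_eval]
  rw [← coeff_zero_taylorShift, h, zero_add, e]

/-- The weight `p_i` as a polynomial in the parameters. -/
def weightPoly (i : Fin (s + 1)) : MvPolynomial (Fin s) ℝ :=
  Fin.snoc (α := fun _ => MvPolynomial (Fin s) ℝ) X (1 - ∑ j, X j) i

@[simp]
lemma weightPoly_castSucc (j : Fin s) : weightPoly j.castSucc = X j := by
  simp [weightPoly]

lemma eval_weightPoly (u : Fin s → ℝ) (i : Fin (s + 1)) : eval u (weightPoly i) = weight u i := by
  induction i using Fin.lastCases with
  | last => simp [weightPoly, weight]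
  | cast j => simp [weightPoly, weight]

/-- The weight of a word as a polynomial in the parameters. -/
def wordPoly (w : List (Fin (s + 1))) : MvPolynomial (Fin s) ℝ := (w.map weightPoly).prod

lemma eval_wordPoly (u : Fin s → ℝ) (w : List (Fin (s + 1))) :
    eval u (wordPoly w) = (w.map (weight u)).prod := by
  induction w with
  | nil => simp [wordPoly]
  | cons i w ih =>
    rw [wordPoly, List.map_cons, List.prod_cons, map_mul, eval_weightPoly, List.map_cons,
      List.prod_cons, ← ih, wordPoly]

lemma wordPoly_append_castSucc (w : List (Fin (s + 1))) (j : Fin s) :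
    wordPoly (w ++ [j.castSucc]) = wordPoly w * X j := by
  simp [wordPoly]

end Polynomial

/-! ### Optimality of the exponent for non-trivial elements of `𝒯` -/

lemma clamp_of_mem {a b x : ℝ} (hx : x ∈ Set.Icc a b) : clamp a b x = x := by
  rw [clamp_coe, min_eq_right hx.2, max_eq_right hx.1]

namespace ExpandingFamily

open MvPolynomial

variable {f g : Fin (s + 1) → ℝ → ℝ} {a b lam : ℝ} (h : ExpandingFamily f g a b lam)
include h

/-- Near p the increment of T_u over the cylinder of w equals the word polynomial at u; this
identity is differentiated in u. -/
lemma takagi_sub_endpoints (hs : 1 ≤ s) {p : Fin s → ℝ} (hp : p ∈ simplex s) (n : Fin s → ℕ)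
    (w : List (Fin (s + 1))) :
    takagi f p n (wordInv g w b : ℝ) - takagi f p n (wordInv g w a : ℝ) =
      mixedPartial n (fun u => eval u (wordPoly w)) p := by
  have hsm := h.contDiffAt_escape hs hp
  rw [h.takagi_eq hs hp, h.takagi_eq hs hp, ← mixedPartial_sub (hsm _) (hsm _),
    clamp_of_mem (h.wordInv_mem w h.right_mem), clamp_of_mem (h.wordInv_mem w h.left_mem)]
  symm
  refine mixedPartial_congr ?_ ((hsm _).sub (hsm _))
  filter_upwards [(isOpen_simplex s).mem_nhds hp] with u hu
  rw [(h.isDistribution_escape hs hu).sub_endpoints h w, eval_wordPoly]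

/-- The increments of a Hölder continuous element of `𝒯` stay controlled by the lengths of the
cylinders when the weights of the words are multiplied by a fixed polynomial. -/
lemma exists_le_of_wordPoly_mul {L : MvPolynomial (Fin s) ℝ →ₗ[ℝ] ℝ} {K α : ℝ} (hα : 0 ≤ α)
    (hK0 : 0 ≤ K) (hK : ∀ w, |L (wordPoly w)| ≤ K * cylLen g a b w ^ α)
    (Q : MvPolynomial (Fin s) ℝ) :
    ∃ K', 0 ≤ K' ∧ ∀ w, |L (wordPoly w * Q)| ≤ K' * cylLen g a b w ^ α := by
  induction Q using MvPolynomial.induction_on with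
  | C r =>
    refine ⟨|r| * K, by positivity, fun w => ?_⟩
    rw [mul_comm, ← smul_eq_C_mul, map_smul, smul_eq_mul, abs_mul, mul_assoc]
    exact mul_le_mul_of_nonneg_left (hK w) (abs_nonneg r)
  | add P Q hP hQ =>
    obtain ⟨K₁, h1, hP⟩ := hP
    obtain ⟨K₂, h2, hQ⟩ := hQ
    refine ⟨K₁ + K₂, add_nonneg h1 h2, fun w => ?_⟩
    rw [mul_add, map_add, add_mul]
    exact (abs_add_le _ _).trans (add_le_add (hP w) (hQ w))
  | mul_X P j hP =>
    obtain ⟨K₁, h1, hP⟩ := hP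
    refine ⟨K₁, h1, fun w => ?_⟩
    -- Multiplying by X_j appends the letter j to the word, and the longer word has a shorter
    -- cylinder.
    rw [mul_comm P, ← mul_assoc, ← wordPoly_append_castSucc]
    refine (hP _).trans (mul_le_mul_of_nonneg_left ?_ h1)
    exact Real.rpow_le_rpow (h.cylLen_pos _).le (h.cylLen_append_le _ _) hα

/-- If a non-trivial element of `𝒯` is `α`-Hölder continuous, then the word weights are dominated
by the `α`-th powers of the lengths of the cylinders. -/
theorem exists_weight_le_of_isHolder (hs : 1 ≤ s) {p : Fin s → ℝ} (hp : p ∈ simplex s)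
    {d : EReal → EReal → ℝ} (hd : IsCompactificationMetric d) {C : EReal → ℝ}
    (hC : IsNontrivial f p C) {α : ℝ} (hα : 0 ≤ α) (hHol : IsHolder d α C) :
    ∃ K : ℝ, ∀ w : List (Fin (s + 1)), (w.map (weight p)).prod ≤ K * cylLen g a b w ^ α := by
  obtain ⟨β, hβ, rfl⟩ := hC
  choose r hr0 hr using exists_mixedPartial_eval_eq p
  obtain ⟨K, hK0, hK⟩ := hHol.exists_bound hd hα a b
  set e : (Fin s → ℕ) → (Fin s →₀ ℕ) := fun n => Finsupp.equivFunOnFinite.symm n with he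
  -- The functional taking a word polynomial to the increment of C over the corresponding cylinder,
  -- extended to all polynomials.
  let L : MvPolynomial (Fin s) ℝ →ₗ[ℝ] ℝ :=
    ∑ n ∈ β.support, (β n * r n) • (lcoeff ℝ (e n) ∘ₗ (taylorShift p).toLinearMap)
  have hL : ∀ Q, L Q = ∑ n ∈ β.support, β n * r n * coeff (e n) (taylorShift p Q) := by
    intro Q
    simp [L, LinearMap.sum_apply]
  have hLw : ∀ w, |L (wordPoly w)| ≤ K * cylLen g a b w ^ α := by
    intro w
    have h1 := hK _ (h.wordInv_mem w h.right_mem) _ (h.wordInv_mem w h.left_mem)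
    rw [← cylLen, abs_of_pos (h.cylLen_pos w)] at h1
    refine le_of_eq_of_le (congrArg _ ?_) h1
    rw [hL, Finset.sum_apply, Finset.sum_apply, ← Finset.sum_sub_distrib]
    refine Finset.sum_congr rfl fun n _ => ?_
    rw [Pi.smul_apply, Pi.smul_apply, ← smul_sub, h.takagi_sub_endpoints hs hp, hr, smul_eq_mul,
      mul_assoc]
  -- After the Taylor shift, Q is the monomial of exponent n. By maximality of n no other index of
  -- the support dominates n, so only the n-th coefficient of the product survives, and it is the
  -- value at p, that is, P(w).
  obtain ⟨n, hn⟩ := Finset.exists_maximal (Finsupp.support_nonempty_iff.2 hβ)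
  have hβn : β n ≠ 0 := Finsupp.mem_support_iff.1 hn.prop
  set Q : MvPolynomial (Fin s) ℝ := ∏ i, (X i - MvPolynomial.C (p i)) ^ n i with hQ
  have hshift : taylorShift p Q = monomial (e n) 1 := by
    rw [hQ, map_prod, monomial_eq, Finsupp.prod_fintype _ _ (by simp)]
    simp [he]
  have hLQ : ∀ w, L (wordPoly w * Q) = β n * r n * (w.map (weight p)).prod := by
    intro w
    rw [hL, Finset.sum_eq_single n]
    · rw [map_mul, hshift, coeff_mul_monomial', if_pos le_rfl, tsub_self, coeff_zero_taylorShift,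
        eval_wordPoly, mul_one]
    · intro m hm hmn
      rw [map_mul, hshift, coeff_mul_monomial', if_neg, mul_zero]
      intro hle
      have hle' : n ≤ m := fun i => hle i
      exact hmn (le_antisymm (hn.le_of_ge hm hle') hle')
    · exact fun hn' => absurd hn.prop hn'
  obtain ⟨K', hK'0, hK'⟩ := h.exists_le_of_wordPoly_mul hα hK0 hLw Q
  have hc : 0 < |β n * r n| := abs_pos.2 (mul_ne_zero hβn (hr0 n).ne')
  refine ⟨K' / |β n * r n|, fun w => ?_⟩
  have h1 := hK' w
  rw [hLQ, abs_mul, abs_of_pos (word_weight_pos hp w)] at h1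
  rw [div_mul_eq_mul_div, le_div_iff₀ hc, mul_comm]
  exact h1

theorem exists_takagiSpace_holder (hs : 1 ≤ s) {p : Fin s → ℝ} (hp : p ∈ simplex s) {K α β : ℝ}
    (hK : ∀ w : List (Fin (s + 1)), (w.map (weight p)).prod ≤ K * cylLen g a b w ^ β)
    (hα : 0 ≤ α) (hαβ : α < β) {C : EReal → ℝ} (hC : C ∈ takagiSpace f p) :
    ∃ K', 0 ≤ K' ∧ ∀ x y : EReal, |C x - C y| ≤ K' * |clamp a b x - clamp a b y| ^ α := by
  induction hC using Submodule.span_induction with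
  | mem C hC =>
    obtain ⟨n, rfl⟩ := hC
    exact h.exists_takagi_holder hs hp hK hα hαβ n
  | zero => exact ⟨0, le_rfl, fun x y => by simp⟩
  | add C C' _ _ hC hC' =>
    obtain ⟨K₁, h1, hC⟩ := hC
    obtain ⟨K₂, h2, hC'⟩ := hC'
    refine ⟨K₁ + K₂, add_nonneg h1 h2, fun x y => ?_⟩
    rw [Pi.add_apply, Pi.add_apply, add_sub_add_comm, add_mul]
    exact (abs_add_le _ _).trans (add_le_add (hC x y) (hC' x y))
  | smul c C _ hC =>
    obtain ⟨K₁, h1, hC⟩ := hC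
    refine ⟨|c| * K₁, by positivity, fun x y => ?_⟩
    rw [Pi.smul_apply, Pi.smul_apply, ← smul_sub, smul_eq_mul, abs_mul, mul_assoc]
    exact mul_le_mul_of_nonneg_left (hC x y) (abs_nonneg c)

lemma probInfty_sub_endpoints (hs : 1 ≤ s) {p : Fin s → ℝ} (hp : p ∈ simplex s)
    (w : List (Fin (s + 1))) :
    probInfty f p (wordInv g w b : ℝ) - probInfty f p (wordInv g w a : ℝ) =
      (w.map (weight p)).prod := by
  rw [h.probInfty_eq_clamp hs hp, h.probInfty_eq_clamp hs hp,
    clamp_of_mem (h.wordInv_mem w h.right_mem), clamp_of_mem (h.wordInv_mem w h.left_mem),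
    (h.isDistribution_escape hs hp).sub_endpoints h w]

/-- If the word weights are dominated by the `α`-th powers of the lengths of the cylinders, then
`T_p` is `α`-Hölder continuous. -/
theorem isHolder_probInfty (hs : 1 ≤ s) {p : Fin s → ℝ} (hp : p ∈ simplex s)
    {d : EReal → EReal → ℝ} (hd : IsCompactificationMetric d) {K α : ℝ} (hα : 0 ≤ α)
    (hK : ∀ w : List (Fin (s + 1)), (w.map (weight p)).prod ≤ K * cylLen g a b w ^ α) :
    IsHolder d α (probInfty f p) := by
  have hT := h.isDistribution_escape hs hp
  obtain ⟨K', hK'0, hK'⟩ :=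
    (hT.subinvariant (weight_pos hp) (weight_lt_one hs hp)).holder_bound h hα hK
  refine isHolder_of_clamp hd h.lt hα hK'0 fun x y => ?_
  rw [h.probInfty_eq_clamp hs hp, h.probInfty_eq_clamp hs hp]
  rcases le_total (clamp a b x) (clamp a b y) with hxy | hxy
  · rw [abs_sub_comm (clamp a b x), abs_of_nonneg (sub_nonneg.2 hxy)]
    exact hK' _ _ hxy
  · rw [abs_sub_comm, abs_of_nonneg (sub_nonneg.2 hxy)]
    exact hK' _ _ hxy

theorem exists_weight_le_of_isHolder_probInfty (hs : 1 ≤ s) {p : Fin s → ℝ} (hp : p ∈ simplex s)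
    {d : EReal → EReal → ℝ} (hd : IsCompactificationMetric d) {α : ℝ} (hα : 0 ≤ α)
    (hHol : IsHolder d α (probInfty f p)) :
    ∃ K : ℝ, ∀ w : List (Fin (s + 1)), (w.map (weight p)).prod ≤ K * cylLen g a b w ^ α := by
  obtain ⟨K, -, hK⟩ := hHol.exists_bound hd hα a b
  refine ⟨K, fun w => ?_⟩
  have h1 := hK _ (h.wordInv_mem w h.right_mem) _ (h.wordInv_mem w h.left_mem)
  rw [← cylLen, abs_of_pos (h.cylLen_pos w),
    h.probInfty_sub_endpoints hs hp, abs_of_pos (word_weight_pos hp w)] at h1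
  exact h1

end ExpandingFamily

end

end GenTakagi

end

/-! ### Assembly of the theorem. -/

open GenTakagi in
theorem theorem1p3 {s : ℕ} (hs : 1 ≤ s)
    (d : EReal → EReal → ℝ) (hd : IsCompactificationMetric d)
    (f : Fin (s + 1) → ℝ → ℝ) (hf : IsAdmissible d f) (hosc : OpenSetCondition f)
    (p : Fin s → ℝ) (hp : p ∈ simplex s) :
    -- the parameter derivatives of `u ↦ T_u(x)` at `p` of all orders exist
    (∀ x : EReal, ContDiffAt ℝ (⊤ : ℕ∞) (fun u => probInfty f u x) p) ∧
    IsHolder d (alphaMinus f p) (probInfty f p) ∧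
    (∀ C ∈ takagiSpace f p, ∀ α : ℝ, 0 < α → α < alphaMinus f p → IsHolder d α C) ∧
    (∀ C : EReal → ℝ, IsNontrivial f p C →
      IsLUB {α : ℝ | 0 ≤ α ∧ IsHolder d α C} (alphaMinus f p)) ∧
    ENNReal.ofReal (alphaMinus f p) ≤ dimJulia d f ∧
    (alphaMinus f p = alphaPlus f p ↔ IsHolder d (dimJulia d f).toReal (probInfty f p)) := by
  obtain ⟨g, a, b, lam, D, M, h⟩ := hf.exists_distortionFamily hosc
  have h' := h.toExpandingFamily
  have hα0 := h.alphaMinus_pos hp hs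
  obtain ⟨K, hK⟩ := h.exists_weight_le hp hs
  have hdim : dimJulia d f = dimH (limitSet f a b) := h'.dimJulia_eq hd hf
  have hpart1 : IsHolder d (alphaMinus f p) (probInfty f p) :=
    h'.isHolder_probInfty hs hp hd hα0.le hK
  have hpart2 : ∀ C ∈ takagiSpace f p, ∀ α : ℝ, 0 < α → α < alphaMinus f p → IsHolder d α C := by
    intro C hC α hα hαlt
    obtain ⟨K', hK'0, hK'⟩ := h'.exists_takagiSpace_holder hs hp hK hα.le hαlt hC
    exact isHolder_of_clamp hd h.lt hα.le hK'0 hK'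
  have hpart4 : ENNReal.ofReal (alphaMinus f p) ≤ dimJulia d f := by
    rw [hdim]
    exact h'.le_dimH_limitSet (weight_pos hp) (sum_weight p) (weight_lt_one hs hp) hα0.le hK
  refine ⟨h'.contDiffAt_probInfty hs hp, hpart1, hpart2, fun C hC => ⟨?_, fun B hB => ?_⟩,
    hpart4, fun heq => ?_, fun hT => ?_⟩
  · rintro α ⟨hα, hHol⟩
    obtain ⟨K', hK'⟩ := h'.exists_weight_le_of_isHolder hs hp hd hC hα hHol
    exact h.le_alphaMinus hp hs hα hK'
  · have hCmem : C ∈ takagiSpace f p := by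
      obtain ⟨β, -, rfl⟩ := hC
      exact Submodule.sum_mem _ fun n _ =>
        Submodule.smul_mem _ _ (Submodule.subset_span ⟨n, rfl⟩)
    refine le_of_forall_lt fun c hc => ?_
    -- The maximum with 0 keeps the exponent positive, as part 2 requires.
    obtain ⟨α, hα, hαlt⟩ := exists_between (max_lt hc hα0)
    have hpos := (le_max_right c 0).trans_lt hα
    exact ((le_max_left c 0).trans_lt hα).trans_le (hB ⟨hpos.le, hpart2 C hCmem α hpos hαlt⟩)
  -- If the exponents agree, word weights are comparable to α₋-th powers of lengths, so the
  -- dimension equals α₋ and part 1 applies.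
  · obtain ⟨K', hK'⟩ := h.exists_le_weight hp hs
    rw [← heq] at hK'
    have hle := h'.dimH_limitSet_le (sum_weight p) hα0.le hK'
    rw [← hdim] at hle
    rwa [le_antisymm hle hpart4, ENNReal.toReal_ofReal hα0.le]
  -- Finiteness is needed because `toReal` sends ⊤ to 0.
  · have htop : dimJulia d f ≠ ⊤ := by
      refine ne_top_of_le_ne_top ENNReal.one_ne_top ?_
      calc dimJulia d f ≤ dimH (Set.univ : Set ℝ) := dimH_mono (Set.subset_univ _)
        _ = 1 := Real.dimH_univ
    obtain ⟨K', hK'⟩ :=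
      h'.exists_weight_le_of_isHolder_probInfty hs hp hd ENNReal.toReal_nonneg hT
    have h1 : (dimJulia d f).toReal ≤ alphaMinus f p :=
      h.le_alphaMinus hp hs ENNReal.toReal_nonneg hK'
    -- Hölder continuity at the dimension gave dim ≤ α₋, so rigidity applies with δ = α₋ and yields
    -- the reverse comparison.
    obtain ⟨K₂, hK₂⟩ := h.exists_le_weight_of_dimH_le hs (weight_pos hp) (sum_weight p)
      (δ := alphaMinus f p) hα0.le
      (by rw [← hdim]; exact (ENNReal.le_ofReal_iff_toReal_le htop hα0.le).2 h1) hK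
    exact le_antisymm (h.alphaMinus_le_alphaPlus hp hs) (h.alphaPlus_le hp hs hα0.le hK₂)
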